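/- Let $L=L(v)$ be one of the following operators on $[0,\pi]$. (Hill) $Ly=-y''+vy$ with a complex-valued $v\in H^{-1}_{per}$, i.e. $v=c+Q'$ with $c\in\mathbb C$, $Q\in L^2([0,\pi])$. The operator is defined by means of the quasi-derivative: $y\in H^1$, $y'-Qy$ absolutely continuous, $Ly=-(y'-Qy)'-Qy'+cy\in L^2$, with the periodic ($+$) or antiperiodic ($-$) conditions $y(\pi)=\pm y(0)$, $(y'-Qy)(\pi)=\pm (y'-Qy)(0)$. Set $\lambda_n^0=n^2$, $r_n=n/4$ for $n\in\mathbb N$, $n\ge 1$. (Dirac) $Ly=i\begin{pmatrix}1&0\\0&-1\end{pmatrix}y'+\begin{pmatrix}0&P\\Q&0\end{pmatrix}y$ with $P,Q\in L^2([0,\pi])$ complex-valued and the conditions $y(\pi)=\pm y(0)$. Set $\lambda_n^0=n$, $r_n=1/2$ for $n\in\mathbb Z$. For $|n|$ large, the disc $|\lambda-\lambda_n^0|<r_n$ contains exactly two periodic (if $n$ is even) or antiperiodic (if $n$ is odd) eigenvalues of $L$, counted with algebraic multiplicity. Denote them by $\lambda_n^\pm$, where $\lambda_n^+$ is the one with the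 larger real part, or with the larger imaginary part if the real parts are equal, and put $z_n^\pm=\lambda_n^\pm-\lambda_n^0$, $z_n^*=\frac12(z_n^++z_n^-)$, $\gamma_n=\lambda_n^+-\lambda_n^-$. Let $\begin{pmatrix}\alpha_n(z)&\beta_n^-(z)\\ \beta_n^+(z)&\alpha_n(z)\end{pmatrix}$ be the matrix, in the basis $e^1_n,e^2_n$, of $S_n(z)=\sum_{k\ge 0}P_n(VD_n(z))^kVP_n$, where $V$ is multiplication by $v$, written in the Fourier basis, $P_n$ is the projection onto the span of $e_n^1,e_n^2$, and $D_n(z)$ is the reduced resolvent of the free operator at $\lambda_n^0+z$: in the Hill case $e^1_n=e^{-inx}$, $e^2_n=e^{inx}$, $\langle Ve^{ijx},e^{ikx}\rangle=V(k-j)$, where $V(0)=c$ and $V(m)=\frac{im}{\pi}\int_0^\pi Q(x)e^{-imx}dx$ for even $m\neq 0$, and $D_n(z)e^{ijx}=(n^2-j^2+z)^{-1}e^{ijx}$ for $j\in n+2\mathbb Z$, $j\neq\pm n$, $D_n(z)e^{\pm inx}=0$; in the Dirac case $e^1_k=(e^{-ikx},0)^T$, $e^2_k=(0,e^{ikx})^T$,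 $\langle Ve^2_j,e^1_k\rangle=p(-k-j)$, $\langle Ve^1_j,e^2_k\rangle=q(k+j)$, the other entries being $0$, where $p(m),q(m)$ are the coefficients of $e^{imx}$, $m\in 2\mathbb Z$, in the Fourier series of $P,Q$ on $[0,\pi]$, and $D_n(z)e^{i}_j=(n-j+z)^{-1}e^{i}_j$ for $i=1,2$, $j\in n+2\mathbb Z$, $j\ne n$, $D_n(z)e^{i}_n=0$. (All these series converge for $|n|$ large and $|z|\le r_n$.) Put $D_n=\{z:\ |z-z_n^*|\le 2(|\beta_n^-(z_n^*)|+|\beta_n^+(z_n^*)|)\}$. Let $\Delta$ be an infinite set of indices $n$ ($n\in\mathbb N$ in the Hill case, $n\in\mathbb Z$ in the Dirac case), all even or all odd, and let $\eta_n>0$, $\eta_n\to0$ ($n\in\Delta$), be such that, for $n\in\Delta$ with $|n|$ large, $\beta_n^-(z_n^*)\ne0$, $\beta_n^+(z_n^*)\neq 0$ and $$\beta_n^\pm(z)=\beta_n^\pm(z_n^*)\,(1+O(\eta_n)),\qquad z\in D_n,$$ with the $O$-constant independent of $n$ and $z$. Then, for all $n\in\Delta$ with $|n|$ large enough, $\lambda_n^-$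 and $\lambda_n^+$ are the only eigenvalues (periodic for even $n$, antiperiodic for odd $n$) in the disc $|\lambda-\lambda_n^0|<r_n$, and there are analytic branches $\sqrt{\beta_n^\pm(z)}$ of $[\beta_n^\pm(z)]^{1/2}$, defined in a neighbourhood of $D_n$, such that $z_n^+$ is the only root in $D_n$ of $$z-\alpha_n(z)=\sqrt{\beta_n^-(z)}\sqrt{\beta_n^+(z)}$$ and $z_n^-$ is the only root in $D_n$ of $$z-\alpha_n(z)=-\sqrt{\beta_n^-(z)}\sqrt{\beta_n^+(z)}.$$ Moreover, with these branches, $\gamma_n\sim 2\sqrt{\beta_n^-(z_n^*)}\sqrt{\beta_n^+(z_n^*)}$, $n\in\Delta$, that is, the ratio of the two sides tends to $1$ as $|n|\to\infty$, $n\in\Delta$. -/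

import Mathlib

open MeasureTheory Filter Topology

noncomputable section

namespace SpectralGap

/-! ### Periodic and antiperiodic Hill and Dirac operators on `[0, π]` -/

/-- Lebesgue measure on the interval `[0, π]`. -/
def intervalMeasure : Measure ℝ := volume.restrict (Set.Icc 0 Real.pi)

/-- `y` is absolutely continuous on `[0, π]` with derivative `g ∈ L¹(0, π)`. -/
def HasL1Deriv (y g : ℝ → ℂ) : Prop :=
  IntervalIntegrable g volume 0 Real.pi ∧
    ∀ x ∈ Set.Icc 0 Real.pi, y x = y 0 + ∫ t in (0 : ℝ)..x, g t

/-- The graph of the Hill operator `L y = -y'' + v y` with the singular potential `v = c + Q'`,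
`Q ∈ L²`, and the boundary conditions of sign `σ` (`σ = 1` periodic, `σ = -1` antiperiodic),
defined through the quasi-derivative `u = y' - Q y`:
`y ∈ H¹`, `u` is absolutely continuous, `L y = -u' - Q y' + c y ∈ L²`,
`y(π) = σ y(0)` and `u(π) = σ u(0)`.
`HillGraph c Q σ y f` says that `y` is in the domain and `L y = f`. -/
def HillGraph (c : ℂ) (Q : ℝ → ℂ) (σ : ℂ) (y f : ℝ → ℂ) : Prop :=
  ∃ y' u u' : ℝ → ℂ,
    HasL1Deriv y y' ∧ MemLp y' 2 intervalMeasure ∧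
    (∀ᵐ x ∂intervalMeasure, u x = y' x - Q x * y x) ∧ HasL1Deriv u u' ∧
    (∀ᵐ x ∂intervalMeasure, f x = -u' x - Q x * y' x + c * y x) ∧ MemLp f 2 intervalMeasure ∧
    y Real.pi = σ * y 0 ∧ u Real.pi = σ * u 0

/-- `lam` is an eigenvalue of the Hill operator with boundary conditions of sign `σ`. -/
def IsHillEigenvalue (c : ℂ) (Q : ℝ → ℂ) (σ lam : ℂ) : Prop :=
  ∃ y : ℝ → ℂ, (∃ x ∈ Set.Icc 0 Real.pi, y x ≠ 0) ∧ HillGraph c Q σ y (fun x => lam * y x)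

/-- The graph of the Dirac operator `L y = i diag(1, -1) y' + (0 P; Q 0) y`, `y = (y₁, y₂)`, with
the boundary conditions `y(π) = σ y(0)`.
`DiracGraph P Q σ y₁ y₂ f₁ f₂` says that `y` is in the domain and `L y = (f₁, f₂)`. -/
def DiracGraph (P Q : ℝ → ℂ) (σ : ℂ) (y₁ y₂ f₁ f₂ : ℝ → ℂ) : Prop :=
  ∃ g₁ g₂ : ℝ → ℂ,
    HasL1Deriv y₁ g₁ ∧ HasL1Deriv y₂ g₂ ∧
    (∀ᵐ x ∂intervalMeasure, f₁ x = Complex.I * g₁ x + P x * y₂ x) ∧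
    (∀ᵐ x ∂intervalMeasure, f₂ x = -Complex.I * g₂ x + Q x * y₁ x) ∧
    MemLp f₁ 2 intervalMeasure ∧ MemLp f₂ 2 intervalMeasure ∧
    y₁ Real.pi = σ * y₁ 0 ∧ y₂ Real.pi = σ * y₂ 0

/-- `lam` is an eigenvalue of the Dirac operator with boundary conditions of sign `σ`. -/
def IsDiracEigenvalue (P Q : ℝ → ℂ) (σ lam : ℂ) : Prop :=
  ∃ y₁ y₂ : ℝ → ℂ, (∃ x ∈ Set.Icc 0 Real.pi, y₁ x ≠ 0 ∨ y₂ x ≠ 0) ∧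
    DiracGraph P Q σ y₁ y₂ (fun x => lam * y₁ x) (fun x => lam * y₂ x)

/-! ### The functionals `α_n` and `β_n^±` -/

/-- The coefficient of `e^{imx}` (`m` even) in the Fourier series of `f` on `[0, π]`. -/
def fourierCoeffPi (f : ℝ → ℂ) (m : ℤ) : ℂ :=
  (Real.pi : ℂ)⁻¹ * ∫ x in (0 : ℝ)..Real.pi, f x * Complex.exp (-(Complex.I * m * x))

/-- The Fourier coefficients of the distribution `v = c + Q'`. -/
def hillCoeff (c : ℂ) (Q : ℝ → ℂ) (m : ℤ) : ℂ :=
  if m = 0 then c else Complex.I * m * fourierCoeffPi Q m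

/-- `iterEntry V d b k a` is the entry `⟨(V d)^k V e_b, e_a⟩`, where `V` is an infinite matrix and
`d` a diagonal one; that is
`∑_{j₁, …, j_k} V(a, j₁) d(j₁) V(j₁, j₂) d(j₂) ⋯ d(j_k) V(j_k, b)`. -/
def iterEntry {ι : Type} (V : ι → ι → ℂ) (d : ι → ℂ) (b : ι) : ℕ → ι → ℂ
  | 0, a => V a b
  | k + 1, a => ∑' j, V a j * d j * iterEntry V d b k j

/-- The entry `S(a, b) = ∑_{k ≥ 0} ⟨(V d)^k V e_b, e_a⟩`. -/
def reducedEntry {ι : Type} (V : ι → ι → ℂ) (d : ι → ℂ) (a b : ι) : ℂ :=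
  ∑' k, iterEntry V d b k a

/-- The matrix of multiplication by `v = c + Q'` in the basis `e^{ikx}`. -/
def hillMatrix (c : ℂ) (Q : ℝ → ℂ) (k j : ℤ) : ℂ := hillCoeff c Q (k - j)

/-- The reduced resolvent of `-d²/dx²` at `n² + z`: the value `1 / (n² - j² + z)` at the indices
`j ∈ n + 2ℤ`, `j ≠ ±n`. -/
def hillDiag (n : ℤ) (z : ℂ) (j : ℤ) : ℂ :=
  if Even (j - n) ∧ j ≠ n ∧ j ≠ -n then ((n : ℂ) ^ 2 - (j : ℂ) ^ 2 + z)⁻¹ else 0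

/-- The matrix of `v = (0 P; Q 0)` in the basis `(false, k) ↦ e¹_k = (e^{-ikx}, 0)`,
`(true, k) ↦ e²_k = (0, e^{ikx})`. -/
def diracMatrix (P Q : ℝ → ℂ) : Bool × ℤ → Bool × ℤ → ℂ
  | (false, k), (true, j) => fourierCoeffPi P (-k - j)
  | (true, k), (false, j) => fourierCoeffPi Q (k + j)
  | (false, _), (false, _) => 0
  | (true, _), (true, _) => 0

/-- The reduced resolvent of the free Dirac operator at `n + z`: the value `1 / (n - j + z)` at the
indices `j ∈ n + 2ℤ`, `j ≠ n`. -/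
def diracDiag (n : ℤ) (z : ℂ) (a : Bool × ℤ) : ℂ :=
  if Even (a.2 - n) ∧ a.2 ≠ n then ((n : ℂ) - (a.2 : ℂ) + z)⁻¹ else 0

/-! ### Hill and Dirac potentials together -/

/-- A potential: `hill c Q` is the Hill potential `v = c + Q'`, `dirac P Q` the Dirac potential
`v = (0 P; Q 0)`. -/
inductive Potential : Type
  | hill (c : ℂ) (Q : ℝ → ℂ)
  | dirac (P Q : ℝ → ℂ)

namespace Potential

/-- `v ∈ H^{-1}_per`, that is `v = c + Q'` with `Q ∈ L²`, in the Hill case;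
`P, Q ∈ L²` in the Dirac case. -/
def Admissible : Potential → Prop
  | hill _ Q => MemLp Q 2 intervalMeasure
  | dirac P Q => MemLp P 2 intervalMeasure ∧ MemLp Q 2 intervalMeasure

/-- The indices of the spectral gaps: `ℕ` in the Hill case, `ℤ` in the Dirac case. -/
def indices : Potential → Set ℤ
  | hill _ _ => {n | 0 < n}
  | dirac _ _ => Set.univ

/-- `λ_n^0`: `n²` in the Hill case, `n` in the Dirac case. -/
def lam0 : Potential → ℤ → ℂ
  | hill _ _, n => (n : ℂ) ^ 2
  | dirac _ _, n => n

/-- The radius of the disc about `λ_n^0`: `n / 4` in the Hill case, `1 / 2` in the Dirac case. -/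
def radius : Potential → ℤ → ℝ
  | hill _ _, n => (n : ℝ) / 4
  | dirac _ _, _ => 1 / 2

/-- `lam` is an eigenvalue of `L` with boundary conditions of sign `σ`. -/
def IsEigenvalue : Potential → ℂ → ℂ → Prop
  | hill c Q, σ, lam => IsHillEigenvalue c Q σ lam
  | dirac P Q, σ, lam => IsDiracEigenvalue P Q σ lam

/-- The periodic (`n` even) or antiperiodic (`n` odd) eigenvalues close to `λ_n^0`. -/
def eigenvaluesNear (v : Potential) (n : ℤ) : Set ℂ :=
  {lam | v.IsEigenvalue ((-1 : ℂ) ^ n) lam ∧ ‖lam - v.lam0 n‖ < v.radius n}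

/-- `α_n(z)`: the diagonal entry of the reduced matrix. -/
def alpha : Potential → ℤ → ℂ → ℂ
  | hill c Q, n, z => reducedEntry (hillMatrix c Q) (hillDiag n z) (-n) (-n)
  | dirac P Q, n, z => reducedEntry (diracMatrix P Q) (diracDiag n z) (false, n) (false, n)

/-- `β_n^-(z)`: the upper right entry of the reduced matrix. -/
def betaMinus : Potential → ℤ → ℂ → ℂ
  | hill c Q, n, z => reducedEntry (hillMatrix c Q) (hillDiag n z) (-n) n
  | dirac P Q, n, z => reducedEntry (diracMatrix P Q) (diracDiag n z) (false, n) (true, n)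

/-- `β_n^+(z)`: the lower left entry of the reduced matrix. -/
def betaPlus : Potential → ℤ → ℂ → ℂ
  | hill c Q, n, z => reducedEntry (hillMatrix c Q) (hillDiag n z) n (-n)
  | dirac P Q, n, z => reducedEntry (diracMatrix P Q) (diracDiag n z) (true, n) (false, n)

end Potential

/-- Comparison by real part, then by imaginary part. -/
def LexLE (a b : ℂ) : Prop := a.re < b.re ∨ (a.re = b.re ∧ a.im ≤ b.im)

open Classical in
/-- The lexicographically largest element of a set of complex numbers (`0` if there is none). -/
def lexMax (S : Set ℂ) : ℂ :=
  if h : ∃ a ∈ S, ∀ b ∈ S, LexLE b a then h.choose else 0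

open Classical in
/-- The lexicographically smallest element of a set of complex numbers (`0` if there is none). -/
def lexMin (S : Set ℂ) : ℂ :=
  if h : ∃ a ∈ S, ∀ b ∈ S, LexLE a b then h.choose else 0

namespace Potential

/-- `λ_n^+`: of the eigenvalues close to `λ_n^0`, the one with the larger real part, or with the
larger imaginary part if the real parts are equal. There being two of them with multiplicity,
`λ_n^+ = λ_n^-` exactly when there is a double one. -/
def lamPlus (v : Potential) (n : ℤ) : ℂ := lexMax (v.eigenvaluesNear n)

/-- `λ_n^-`: the other one of the two eigenvalues close to `λ_n^0`. -/
def lamMinus (v : Potential) (n : ℤ) : ℂ := lexMin (v.eigenvaluesNear n)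

/-- `z_n^+ = λ_n^+ - λ_n^0`. -/
def zPlus (v : Potential) (n : ℤ) : ℂ := v.lamPlus n - v.lam0 n

/-- `z_n^- = λ_n^- - λ_n^0`. -/
def zMinus (v : Potential) (n : ℤ) : ℂ := v.lamMinus n - v.lam0 n

/-- `z_n^* = (z_n^+ + z_n^-) / 2`. -/
def zStar (v : Potential) (n : ℤ) : ℂ := (v.zPlus n + v.zMinus n) / 2

/-- The spectral gap `γ_n = λ_n^+ - λ_n^-`. -/
def gap (v : Potential) (n : ℤ) : ℂ := v.lamPlus n - v.lamMinus n

/-- The closed disc `D_n` with centre `z_n^*` and radius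
`ρ_n = 2 (|β_n^-(z_n^*)| + |β_n^+(z_n^*)|)`. -/
def disc (v : Potential) (n : ℤ) : Set ℂ :=
  Metric.closedBall (v.zStar n)
    (2 * (‖v.betaMinus n (v.zStar n)‖ + ‖v.betaPlus n (v.zStar n)‖))

end Potential

end SpectralGap

end

namespace SpectralGap

/-! ### The equation `(z - α(z))² = β₁(z) β₂(z)` for small analytic functions -/

/-! Expand an eigenfunction in the free eigenbasis and separate the two resonant coordinates `a, b`
from the rest. Off these two coordinates the equation at `λ_n^0 + z` reads `Y = d V Y`, with `d` the
reduced resolvent. It is solved by a Neumann series, because `√D V √D`, with `D` a majorant of `|d|`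
valid for all `|z| < r_n`, has Hilbert–Schmidt norm tending to `0` as `|n| → ∞`. For a singular Hill
potential `V` is unbounded on `ℓ²` (its entries may grow like `|m| |Q̂(m)|`); this is why the vector
`V Y` is measured in the `D`-weighted `ℓ²` space and why each half of the weight is needed to absorb
one factor `|m|`.

Substituting the solution back leaves `det (z - S_n(z)) = 0`, and conversely each null vector of `z
- S_n(z)` extends to an eigenfunction. A symmetry transposing `V` and preserving `d` interchanges
the resonant coordinates, so the diagonal entries agree and the equation is `(z - α)² = β⁻ β⁺`. Here
`α, β^±` are analytic on `|z| < r_n` and uniformly `o(r_n)`. This information is packaged in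
`SmallTriple` by `Potential.eventually_smallTriple`.

The left side minus the right is a small perturbation of `z²`. The maximum principle produces a root
(`exists_root`), and a Lipschitz estimate for a difference quotient excludes three distinct ones
(`root_eq_of_three`). So the eigenvalues in the disc form a set of one or two points, whose
lexicographic extremes are `λ_n^±`; algebraic multiplicity is never used.

When `β^±` are almost constant on `D_n`, they have analytic square roots there, and `z ↦ α ± √β⁻
√β⁺` are contractions. A contraction has at most one fixed point, so two distinct roots lie on
different branches. A single double root is impossible: the opposite branch would have a fixed point
too, hence the same one, and `√β⁻ √β⁺` would vanish at `z_n^*`. This is `exists_branches`.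
Subtracting the equations of the two branches gives the asymptotics of `γ_n`, since `α` changes by
`o(|γ_n|)` and `√β⁻ √β⁺` is nearly constant. -/

theorem norm_deriv_le_of_bounded_on_ball {f : ℂ → ℂ} {c : ℂ} {R R' M : ℝ} (hR : R' < R)
    (hf : DifferentiableOn ℂ f (Metric.ball c R)) (hM : ∀ z ∈ Metric.ball c R, ‖f z‖ ≤ M)
    {x : ℂ} (hx : x ∈ Metric.ball c R') : ‖deriv f x‖ ≤ M / (R - R') := by
  have hsub : Metric.closedBall x (R - R') ⊆ Metric.ball c R := by
    intro y hy
    rw [Metric.mem_closedBall] at hy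
    rw [Metric.mem_ball] at *
    linarith [dist_triangle y x c]
  refine Complex.norm_deriv_le_of_forall_mem_sphere_norm_le (by linarith)
    ((hf.mono hsub).diffContOnCl_ball subset_rfl) fun z hz => hM z (hsub ?_)
  exact Metric.sphere_subset_closedBall hz

/-- Cauchy's estimate on discs of radius `R - R'`, combined with the mean value inequality on the
convex smaller ball. Every Lipschitz constant for an analytic function below comes from here. -/
theorem norm_sub_le_of_bounded_on_ball {f : ℂ → ℂ} {c : ℂ} {R R' M : ℝ} (hR : R' < R)
    (hf : DifferentiableOn ℂ f (Metric.ball c R)) (hM : ∀ z ∈ Metric.ball c R, ‖f z‖ ≤ M)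
    {x y : ℂ} (hx : x ∈ Metric.ball c R') (hy : y ∈ Metric.ball c R') :
    ‖f y - f x‖ ≤ M / (R - R') * ‖y - x‖ := by
  refine Convex.norm_image_sub_le_of_norm_deriv_le (s := Metric.ball c R') (fun w hw => ?_)
    (fun w hw => norm_deriv_le_of_bounded_on_ball hR hf hM hw) (convex_ball _ _) hx hy
  exact hf.differentiableAt (Metric.isOpen_ball.mem_nhds (Metric.ball_subset_ball hR.le hw))

/-- Three analytic functions on the disc `|z| < r`, bounded by `ε r`. -/
structure SmallTriple (r ε : ℝ) (α β₁ β₂ : ℂ → ℂ) : Prop where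
  pos : 0 < r
  diff_alpha : DifferentiableOn ℂ α (Metric.ball 0 r)
  diff_one : DifferentiableOn ℂ β₁ (Metric.ball 0 r)
  diff_two : DifferentiableOn ℂ β₂ (Metric.ball 0 r)
  bound_alpha : ∀ z ∈ Metric.ball (0 : ℂ) r, ‖α z‖ ≤ ε * r
  bound_one : ∀ z ∈ Metric.ball (0 : ℂ) r, ‖β₁ z‖ ≤ ε * r
  bound_two : ∀ z ∈ Metric.ball (0 : ℂ) r, ‖β₂ z‖ ≤ ε * r

namespace SmallTriple

variable {r ε : ℝ} {α β₁ β₂ : ℂ → ℂ}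

theorem eps_nonneg (h : SmallTriple r ε α β₁ β₂) : 0 ≤ ε := by
  have := (norm_nonneg _).trans (h.bound_alpha 0 (Metric.mem_ball_self h.pos))
  nlinarith [h.pos]

theorem norm_mul_le (h : SmallTriple r ε α β₁ β₂) {z : ℂ} (hz : z ∈ Metric.ball (0 : ℂ) r) :
    ‖β₁ z * β₂ z‖ ≤ (ε * r) ^ 2 := by
  rw [norm_mul, sq]
  exact mul_le_mul (h.bound_one z hz) (h.bound_two z hz) (norm_nonneg _)
    ((norm_nonneg _).trans (h.bound_one z hz))

theorem norm_root_le (h : SmallTriple r ε α β₁ β₂) {z : ℂ} (hz : z ∈ Metric.ball (0 : ℂ) r)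
    (hroot : (z - α z) ^ 2 = β₁ z * β₂ z) : ‖z‖ ≤ 2 * ε * r := by
  have h1 : ‖z - α z‖ ^ 2 ≤ (ε * r) ^ 2 := by
    rw [← norm_pow, hroot]; exact h.norm_mul_le hz
  have h2 : ‖z - α z‖ ≤ ε * r :=
    abs_le_of_sq_le_sq' h1 (mul_nonneg h.eps_nonneg h.pos.le) |>.2
  have h3 := h.bound_alpha z hz
  have h4 : ‖z‖ ≤ ‖z - α z‖ + ‖α z‖ := by simpa using norm_add_le (z - α z) (α z)
  linarith

theorem diff_char (h : SmallTriple r ε α β₁ β₂) :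
    DifferentiableOn ℂ (fun z => (z - α z) ^ 2 - β₁ z * β₂ z) (Metric.ball 0 r) :=
  ((differentiableOn_id.sub h.diff_alpha).pow 2).sub (h.diff_one.mul h.diff_two)

/-- Without a root, the reciprocal of `g = (z - α)² - β₁ β₂` would be analytic. The maximum
principle on `|z| ≤ r/2` then fails: `|g| ≥ r²/8` on the circle, while `|g(0)| ≤ 2 (ε r)²` is far
smaller. -/
theorem exists_root (h : SmallTriple r ε α β₁ β₂) (hε : ε ≤ 1 / 100) :
    ∃ z ∈ Metric.ball (0 : ℂ) r, (z - α z) ^ 2 = β₁ z * β₂ z := by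
  by_contra! hno
  have hr := h.pos
  have hεr : ε * r ≤ r / 100 := by nlinarith
  have hεr0 : 0 ≤ ε * r := mul_nonneg h.eps_nonneg hr.le
  set g : ℂ → ℂ := fun z => (z - α z) ^ 2 - β₁ z * β₂ z with hg
  have hsub : Metric.closedBall (0 : ℂ) (r / 2) ⊆ Metric.ball 0 r :=
    Metric.closedBall_subset_ball (by linarith)
  have hg0 : ∀ z ∈ Metric.ball (0 : ℂ) r, g z ≠ 0 := fun z hz => sub_ne_zero.2 (hno z hz)
  have hd : DiffContOnCl ℂ (fun z => (g z)⁻¹) (Metric.ball 0 (r / 2)) :=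
    ((h.diff_char.inv hg0).mono hsub).diffContOnCl_ball subset_rfl
  have hfr : ∀ z ∈ frontier (Metric.ball (0 : ℂ) (r / 2)), ‖(g z)⁻¹‖ ≤ (r ^ 2 / 8)⁻¹ := by
    intro z hz
    rw [frontier_ball _ (by linarith), mem_sphere_zero_iff_norm] at hz
    have hzr : z ∈ Metric.ball (0 : ℂ) r := by rw [mem_ball_zero_iff]; linarith
    rw [norm_inv]
    refine inv_anti₀ (by positivity) ?_
    have h1 := h.bound_alpha z hzr
    have h2 : ‖z‖ ≤ ‖z - α z‖ + ‖α z‖ := by simpa using norm_add_le (z - α z) (α z)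
    have h3 : ‖(z - α z) ^ 2‖ ≤ ‖g z‖ + ‖β₁ z * β₂ z‖ := by
      simpa [hg] using norm_add_le (g z) (β₁ z * β₂ z)
    have h4 := h.norm_mul_le hzr
    rw [norm_pow] at h3
    have h5 : (49 / 100) * r ≤ ‖z - α z‖ := by linarith
    nlinarith
  have h0 := Complex.norm_le_of_forall_mem_frontier_norm_le Metric.isBounded_ball hd hfr
    (subset_closure (Metric.mem_ball_self (by linarith : (0:ℝ) < r / 2)))
  have h0r : (0 : ℂ) ∈ Metric.ball (0 : ℂ) r := Metric.mem_ball_self hr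
  rw [norm_inv, inv_le_inv₀ (norm_pos_iff.2 (hg0 0 h0r)) (by positivity)] at h0
  have h1 : ‖g 0‖ ≤ ‖(0 - α 0) ^ 2‖ + ‖β₁ 0 * β₂ 0‖ := norm_sub_le _ _
  have h2 := h.bound_alpha 0 h0r
  have h3 := h.norm_mul_le h0r
  rw [norm_pow, zero_sub, norm_neg] at h1
  have h4 : ‖α 0‖ ^ 2 ≤ (ε * r) ^ 2 := by gcongr
  nlinarith

/-- Write the characteristic function as `z² + δ(z)` with `δ` small. Dividing the difference of the
equations at `z` and `a` by `z - a` shows that a root `z ≠ a` satisfies `δ[a, z] = -(z + a)`. The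
difference quotient `δ[a, ·]` has Lipschitz constant `32 ε < 1`, whereas the right side preserves
distances, so `z` is determined by `a`. Two applications of Cauchy's estimate, on `r → r/2 → r/4`,
give the constant. -/
theorem root_eq_of_three (h : SmallTriple r ε α β₁ β₂) (hε : ε ≤ 1 / 100) {a b c : ℂ}
    (ha : a ∈ Metric.ball (0 : ℂ) r) (hb : b ∈ Metric.ball (0 : ℂ) r)
    (hc : c ∈ Metric.ball (0 : ℂ) r) (hra : (a - α a) ^ 2 = β₁ a * β₂ a)
    (hrb : (b - α b) ^ 2 = β₁ b * β₂ b) (hrc : (c - α c) ^ 2 = β₁ c * β₂ c)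
    (hab : b ≠ a) (hac : c ≠ a) : b = c := by
  have hr := h.pos
  have hε0 := h.eps_nonneg
  set δ : ℂ → ℂ := fun z => ((z - α z) ^ 2 - β₁ z * β₂ z) - z ^ 2 with hδ
  have hδd : DifferentiableOn ℂ δ (Metric.ball 0 r) := h.diff_char.sub (differentiableOn_pow 2)
  have hδb : ∀ z ∈ Metric.ball (0 : ℂ) r, ‖δ z‖ ≤ 4 * ε * r ^ 2 := by
    intro z hz
    have e : δ z = -2 * z * α z + α z ^ 2 - β₁ z * β₂ z := by simp only [hδ]; ring
    have h1 := h.bound_alpha z hz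
    have h2 := h.norm_mul_le hz
    have h3 : ‖z‖ < r := by simpa using hz
    have h4 : ‖δ z‖ ≤ 2 * ‖z‖ * ‖α z‖ + ‖α z‖ ^ 2 + ‖β₁ z * β₂ z‖ := by
      rw [e]
      refine (norm_sub_le _ _).trans (add_le_add_left ((norm_add_le _ _).trans ?_) _)
      simp
    have h5 : ‖z‖ * ‖α z‖ ≤ r * (ε * r) := by gcongr
    have h6 : ‖α z‖ ^ 2 ≤ (ε * r) ^ 2 := by gcongr
    have h7 : (ε * r) ^ 2 ≤ ε * r ^ 2 / 100 := by nlinarith [mul_nonneg hε0 (sq_nonneg r)]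
    nlinarith [mul_nonneg hε0 (sq_nonneg r)]
  have small : ∀ z ∈ Metric.ball (0 : ℂ) r, (z - α z) ^ 2 = β₁ z * β₂ z →
      z ∈ Metric.ball (0 : ℂ) (r / 4) := by
    intro z hz hrz
    have := h.norm_root_le hz hrz
    rw [mem_ball_zero_iff]
    nlinarith
  have ha4 := small a ha hra
  have hb4 := small b hb hrb
  have hc4 := small c hc hrc
  have ha2 : a ∈ Metric.ball (0 : ℂ) (r / 2) := Metric.ball_subset_ball (by linarith) ha4
  have hdd : DifferentiableOn ℂ (dslope δ a) (Metric.ball 0 (r / 2)) :=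
    (Complex.differentiableOn_dslope (Metric.isOpen_ball.mem_nhds ha2)).2
      (hδd.mono (Metric.ball_subset_ball (by linarith)))
  have hdb : ∀ z ∈ Metric.ball (0 : ℂ) (r / 2), ‖dslope δ a z‖ ≤ 8 * ε * r := by
    intro z hz
    have e : 4 * ε * r ^ 2 / (r - r / 2) = 8 * ε * r := by field_simp; ring
    rcases eq_or_ne z a with rfl | hza
    · rw [dslope_same, ← e]
      exact norm_deriv_le_of_bounded_on_ball (by linarith) hδd hδb hz
    · rw [dslope_of_ne _ hza, slope_def_field, norm_div, div_le_iff₀ (norm_pos_iff.2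
        (sub_ne_zero.2 hza)), ← e]
      exact norm_sub_le_of_bounded_on_ball (by linarith) hδd hδb ha2 hz
  have key := norm_sub_le_of_bounded_on_ball (by linarith : r / 4 < r / 2) hdd hdb hb4 hc4
  have hval : ∀ z, z ≠ a → (z - α z) ^ 2 = β₁ z * β₂ z → dslope δ a z = -(z + a) := by
    intro z hza hrz
    rw [dslope_of_ne _ hza, slope_def_field, div_eq_iff (sub_ne_zero.2 hza)]
    simp only [hδ, hra, hrz]
    ring
  rw [hval b hab hrb, hval c hac hrc] at key
  have e1 : -(c + a) - -(b + a) = -(c - b) := by ring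
  have e2 : 8 * ε * r / (r / 2 - r / 4) = 32 * ε := by field_simp; ring
  rw [e1, norm_neg, e2] at key
  have : ‖c - b‖ ≤ 0 := by nlinarith [norm_nonneg (c - b)]
  exact (sub_eq_zero.1 (norm_le_zero_iff.1 this)).symm

end SmallTriple

/-! ### Analytic square roots -/

theorem cpow_half_sq (w : ℂ) : (w ^ (2⁻¹ : ℂ)) ^ 2 = w := by
  simp [← Complex.cpow_nat_mul]

/-- In `w - 1 = (√w - 1)(√w + 1)` the second factor has modulus at least `1`, since the principal
root has nonnegative real part. -/
theorem norm_cpow_half_sub_one_le (w : ℂ) : ‖w ^ (2⁻¹ : ℂ) - 1‖ ≤ ‖w - 1‖ := by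
  have hsq := cpow_half_sq w
  have hre : 0 ≤ (w ^ (2⁻¹ : ℂ)).re := by
    rw [Complex.cpow_inv_two_re]; exact Real.sqrt_nonneg _
  have h1 : 1 ≤ ‖w ^ (2⁻¹ : ℂ) + 1‖ := by
    refine le_trans ?_ (Complex.re_le_norm _)
    simp only [Complex.add_re, Complex.one_re]
    linarith
  have h2 : w - 1 = (w ^ (2⁻¹ : ℂ) - 1) * (w ^ (2⁻¹ : ℂ) + 1) := by
    linear_combination -hsq
  rw [h2, norm_mul]
  exact le_mul_of_one_le_right (norm_nonneg _) h1

/-- An analytic square root near a point at which the function does not vanish. -/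
theorem exists_sqrt_branch {β : ℂ → ℂ} {U : Set ℂ} {z₀ : ℂ} (hU : IsOpen U)
    (hβ : DifferentiableOn ℂ β U) (h0 : β z₀ ≠ 0) (hlt : ∀ z ∈ U, ‖β z - β z₀‖ < ‖β z₀‖) :
    ∃ s : ℂ → ℂ, AnalyticOnNhd ℂ s U ∧ (∀ z, s z ^ 2 = β z) ∧
      ∀ z κ, ‖β z - β z₀‖ ≤ κ * ‖β z₀‖ → ‖s z - s z₀‖ ≤ κ * ‖s z₀‖ := by
  -- The principal root is applied to the ratio `β z / β z₀`, which stays within distance `1` of `1`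
  -- and so avoids the cut; the root of `β z₀` is a constant factor.
  refine ⟨fun z => β z₀ ^ (2⁻¹ : ℂ) * (β z / β z₀) ^ (2⁻¹ : ℂ), ?_, ?_, ?_⟩
  · have ha : AnalyticOnNhd ℂ β U := hβ.analyticOnNhd hU
    intro z hz
    refine analyticAt_const.mul (((ha z hz).div analyticAt_const h0).cpow analyticAt_const ?_)
    refine Complex.mem_slitPlane_of_norm_lt_one (z := β z / β z₀ - 1) ?_ |> fun h => by
      simpa using h
    rw [div_sub_one h0, norm_div, div_lt_one (norm_pos_iff.2 h0)]
    exact hlt z hz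
  · intro z
    simp only [mul_pow, cpow_half_sq]
    field_simp
  · intro z κ hκ
    simp only [div_self h0, Complex.one_cpow, mul_one]
    have h1 : ‖(β z / β z₀) ^ (2⁻¹ : ℂ) - 1‖ ≤ κ := by
      refine (norm_cpow_half_sub_one_le _).trans ?_
      rw [div_sub_one h0, norm_div, div_le_iff₀ (norm_pos_iff.2 h0)]
      exact hκ
    rw [← mul_sub_one, norm_mul, mul_comm]
    gcongr

/-! ### Separating the two roots by the branches of the square root -/

namespace SmallTriple

variable {r ε : ℝ} {α β₁ β₂ : ℂ → ℂ}

theorem norm_sub_le_half (h : SmallTriple r ε α β₁ β₂) {f : ℂ → ℂ}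
    (hf : DifferentiableOn ℂ f (Metric.ball 0 r)) (hb : ∀ z ∈ Metric.ball (0 : ℂ) r, ‖f z‖ ≤ ε * r)
    {x y : ℂ} (hx : x ∈ Metric.ball (0 : ℂ) (r / 2)) (hy : y ∈ Metric.ball (0 : ℂ) (r / 2)) :
    ‖f y - f x‖ ≤ 2 * ε * ‖y - x‖ := by
  have hr := h.pos
  have := norm_sub_le_of_bounded_on_ball (by linarith : r / 2 < r) hf hb hx hy
  rwa [show ε * r / (r - r / 2) = 2 * ε by field_simp; ring] at this

/-- The distance of the two roots is controlled by `β₁` and `β₂` at their midpoint. -/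
theorem norm_gap_le (h : SmallTriple r ε α β₁ β₂) {zp zm z₀ : ℂ}
    (hp : zp ∈ Metric.ball (0 : ℂ) (r / 2)) (hm : zm ∈ Metric.ball (0 : ℂ) (r / 2))
    (hz₀ : z₀ = (zp + zm) / 2) (hrp : (zp - α zp) ^ 2 = β₁ zp * β₂ zp)
    (hrm : (zm - α zm) ^ 2 = β₁ zm * β₂ zm) :
    (1 - 4 * ε) * ‖zp - zm‖ ≤ ‖β₁ z₀‖ + ‖β₂ z₀‖ := by
  have hmid : z₀ ∈ Metric.ball (0 : ℂ) (r / 2) := by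
    rw [mem_ball_zero_iff] at *
    rw [hz₀, norm_div, div_lt_iff₀ (by simp)]
    refine (norm_add_le _ _).trans_lt ?_
    simp only [Complex.norm_ofNat]
    linarith
  have half : ∀ z ∈ Metric.ball (0 : ℂ) (r / 2), ‖z - z₀‖ = ‖zp - zm‖ / 2 →
      (z - α z) ^ 2 = β₁ z * β₂ z →
      ‖z - α z‖ ≤ (‖β₁ z₀‖ + ‖β₂ z₀‖ + 2 * ε * ‖zp - zm‖) / 2 := by
    intro z hz hd hroot
    have h1 := h.norm_sub_le_half h.diff_one h.bound_one hmid hz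
    have h2 := h.norm_sub_le_half h.diff_two h.bound_two hmid hz
    have h3 : ‖z - α z‖ ^ 2 = ‖β₁ z‖ * ‖β₂ z‖ := by rw [← norm_pow, hroot, norm_mul]
    -- At a root, `|z - α|` is the geometric mean of `|β₁|` and `|β₂|`. The arithmetic mean is then
    -- transported to the midpoint at distance `|zp - zm| / 2`.
    have h4 : ‖z - α z‖ ≤ (‖β₁ z‖ + ‖β₂ z‖) / 2 := by
      refine abs_le_of_sq_le_sq' ?_ (by positivity) |>.2
      rw [h3]; nlinarith [sq_nonneg (‖β₁ z‖ - ‖β₂ z‖)]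
    have h5 := norm_sub_norm_le (β₁ z) (β₁ z₀)
    have h6 := norm_sub_norm_le (β₂ z) (β₂ z₀)
    rw [hd] at h1 h2
    linarith
  have e1 : zp - z₀ = (zp - zm) / 2 := by rw [hz₀]; ring
  have e2 : zm - z₀ = -((zp - zm) / 2) := by rw [hz₀]; ring
  have hpb := half zp hp (by rw [e1]; simp) hrp
  have hmb := half zm hm (by rw [e2]; simp) hrm
  have hα := h.norm_sub_le_half h.diff_alpha h.bound_alpha hm hp
  have e3 : zp - zm = (zp - α zp) - (zm - α zm) + (α zp - α zm) := by ring
  have : ‖zp - zm‖ ≤ ‖zp - α zp‖ + ‖zm - α zm‖ + ‖α zp - α zm‖ := by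
    conv_lhs => rw [e3]
    exact (norm_add_le _ _).trans (add_le_add_left (norm_sub_le _ _) _)
  linarith

/-- If `β₁` and `β₂` are almost constant near the midpoint of the roots `zm, zp` of
`(z - α)² = β₁ β₂`, then these roots are distinct and correspond to the two branches of
`√β₁ √β₂`. -/
theorem exists_branches (h : SmallTriple r ε α β₁ β₂) (hε : ε ≤ 1 / 100) {κ : ℝ}
    (hκ : κ ≤ 1 / 100) {zp zm z₀ : ℂ} (hz₀ : z₀ = (zp + zm) / 2)
    (hp : zp ∈ Metric.ball (0 : ℂ) r) (hm : zm ∈ Metric.ball (0 : ℂ) r)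
    (hroots : ∀ z ∈ Metric.ball (0 : ℂ) r, (z - α z) ^ 2 = β₁ z * β₂ z ↔ z = zm ∨ z = zp)
    (hne₁ : β₁ z₀ ≠ 0) (hne₂ : β₂ z₀ ≠ 0) {D : Set ℂ}
    (hD : D = Metric.closedBall z₀ (2 * (‖β₁ z₀‖ + ‖β₂ z₀‖)))
    (hc₁ : ∀ z ∈ D, ‖β₁ z - β₁ z₀‖ ≤ κ * ‖β₁ z₀‖) (hc₂ : ∀ z ∈ D, ‖β₂ z - β₂ z₀‖ ≤ κ * ‖β₂ z₀‖) :
    ∃ s₁ s₂ : ℂ → ℂ,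
      (∃ U : Set ℂ, IsOpen U ∧ D ⊆ U ∧ AnalyticOnNhd ℂ s₁ U ∧ AnalyticOnNhd ℂ s₂ U ∧
        (∀ z ∈ U, s₁ z ^ 2 = β₁ z) ∧ (∀ z ∈ U, s₂ z ^ 2 = β₂ z)) ∧
      (∀ z, (z ∈ D ∧ z - α z = s₁ z * s₂ z) ↔ z = zp) ∧
      (∀ z, (z ∈ D ∧ z - α z = -(s₁ z * s₂ z)) ↔ z = zm) ∧
      ∀ δ, δ ≤ 1 / 100 → SmallTriple r δ α β₁ β₂ →
        ‖(zp - zm) / (2 * s₁ z₀ * s₂ z₀) - 1‖ ≤ 3 * (δ + κ) := by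
  have hr := h.pos
  have hε0 := h.eps_nonneg
  have hrp := (hroots zp hp).2 (Or.inr rfl)
  have hrm := (hroots zm hm).2 (Or.inl rfl)
  have hzp := h.norm_root_le hp hrp
  have hzm := h.norm_root_le hm hrm
  have hεr : ε * r ≤ r / 100 := by nlinarith
  have hz₀n : ‖z₀‖ ≤ 2 * ε * r := by
    rw [hz₀, norm_div, div_le_iff₀ (by simp)]
    refine (norm_add_le _ _).trans ?_
    simp only [Complex.norm_ofNat]
    linarith
  have hz₀r : z₀ ∈ Metric.ball (0 : ℂ) r := by rw [mem_ball_zero_iff]; linarith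
  have hb₁ := h.bound_one z₀ hz₀r
  have hb₂ := h.bound_two z₀ hz₀r
  have hn₁ := norm_pos_iff.2 hne₁
  have hn₂ := norm_pos_iff.2 hne₂
  set ρ := 2 * (‖β₁ z₀‖ + ‖β₂ z₀‖) with hρ
  have hρ0 : 0 < ρ := by positivity
  have hDr : D ⊆ Metric.ball (0 : ℂ) (r / 2) := by
    intro z hz
    rw [hD, mem_closedBall_iff_norm] at hz
    rw [mem_ball_zero_iff]
    have : ‖z‖ ≤ ‖z - z₀‖ + ‖z₀‖ := by simpa using norm_add_le (z - z₀) z₀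
    linarith
  have hDr' : D ⊆ Metric.ball (0 : ℂ) r := hDr.trans (Metric.ball_subset_ball (by linarith))
  have hp2 : zp ∈ Metric.ball (0 : ℂ) (r / 2) := by rw [mem_ball_zero_iff]; linarith
  have hm2 : zm ∈ Metric.ball (0 : ℂ) (r / 2) := by rw [mem_ball_zero_iff]; linarith
  have hz₀D : z₀ ∈ D := by rw [hD]; exact Metric.mem_closedBall_self hρ0.le
  have hκ0 : 0 ≤ κ := by
    have := (norm_nonneg _).trans (hc₁ z₀ hz₀D)
    exact nonneg_of_mul_nonneg_left this hn₁
  have hgap := h.norm_gap_le hp2 hm2 hz₀ hrp hrm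
  have hgap' : ‖zp - zm‖ ≤ ρ := by nlinarith [norm_nonneg (zp - zm)]
  -- the neighbourhood on which the square roots are analytic
  set U : Set ℂ := Metric.ball (0 : ℂ) r ∩ {z | ‖β₁ z - β₁ z₀‖ < ‖β₁ z₀‖} ∩
    (Metric.ball (0 : ℂ) r ∩ {z | ‖β₂ z - β₂ z₀‖ < ‖β₂ z₀‖}) with hU
  have hUo : IsOpen U := by
    refine IsOpen.inter ?_ ?_
    · exact ((h.diff_one.continuousOn.sub continuousOn_const).norm).isOpen_inter_preimage
        Metric.isOpen_ball isOpen_Iio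
    · exact ((h.diff_two.continuousOn.sub continuousOn_const).norm).isOpen_inter_preimage
        Metric.isOpen_ball isOpen_Iio
  have hDU : D ⊆ U := by
    intro z hz
    refine ⟨⟨hDr' hz, ?_⟩, ⟨hDr' hz, ?_⟩⟩
    · exact (hc₁ z hz).trans_lt (by nlinarith)
    · exact (hc₂ z hz).trans_lt (by nlinarith)
  obtain ⟨t, hta, htsq, htb⟩ := exists_sqrt_branch hUo
    (h.diff_one.mono fun z hz => hz.1.1) hne₁ (fun z hz => hz.1.2)
  obtain ⟨s₂, hsa, hssq, hsb⟩ := exists_sqrt_branch hUo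
    (h.diff_two.mono fun z hz => hz.1.1) hne₂ (fun z hz => hz.2.2)
  set s : ℂ → ℂ := fun z => t z * s₂ z with hs
  have hs_sq : ∀ z, s z ^ 2 = β₁ z * β₂ z := fun z => by
    simp only [hs, mul_pow, htsq, hssq]
  have hs₀ : s z₀ ≠ 0 := fun h0 => by
    have := hs_sq z₀
    rw [h0] at this
    exact mul_ne_zero hne₁ hne₂ (by simpa using this.symm)
  have hs₀n := norm_pos_iff.2 hs₀
  -- Relative errors `κ` of the two roots give `2κ + κ² ≤ 3κ` for their product.
  have hsD : ∀ z ∈ D, ‖s z - s z₀‖ ≤ 3 * κ * ‖s z₀‖ := by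
    intro z hz
    have h1 := htb z κ (hc₁ z hz)
    have h2 := hsb z κ (hc₂ z hz)
    have e : s z - s z₀ = (t z - t z₀) * (s₂ z - s₂ z₀) + t z₀ * (s₂ z - s₂ z₀)
        + (t z - t z₀) * s₂ z₀ := by simp only [hs]; ring
    have h3 : ‖s z₀‖ = ‖t z₀‖ * ‖s₂ z₀‖ := norm_mul _ _
    have h4 : ‖s z - s z₀‖ ≤ ‖t z - t z₀‖ * ‖s₂ z - s₂ z₀‖ + ‖t z₀‖ * ‖s₂ z - s₂ z₀‖
        + ‖t z - t z₀‖ * ‖s₂ z₀‖ := by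
      rw [e]; exact (norm_add₃_le).trans (by simp)
    have h5 : ‖t z - t z₀‖ * ‖s₂ z - s₂ z₀‖ ≤ (κ * ‖t z₀‖) * (κ * ‖s₂ z₀‖) := by gcongr
    have h6 : ‖t z₀‖ * ‖s₂ z - s₂ z₀‖ ≤ ‖t z₀‖ * (κ * ‖s₂ z₀‖) := by gcongr
    have h7 : ‖t z - t z₀‖ * ‖s₂ z₀‖ ≤ (κ * ‖t z₀‖) * ‖s₂ z₀‖ := by gcongr
    have h8 : κ * (κ * ‖s z₀‖) ≤ κ * (1 * ‖s z₀‖) := by gcongr; linarith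
    rw [h3] at h8 ⊢
    nlinarith
  have hs0 : ∀ z ∈ D, s z ≠ 0 := fun z hz h0 => by
    have := hsD z hz
    rw [h0, zero_sub, norm_neg] at this
    nlinarith
  -- Again the inequality of the means: `|s z₀|² = |β₁ z₀| |β₂ z₀|`, and `ρ/4` is the arithmetic
  -- mean. It makes the oscillation of `s` small relative to the radius, hence gives a Lipschitz
  -- constant `3κ` free of `ρ`.
  have hsρ : ‖s z₀‖ ≤ ρ / 4 := by
    refine abs_le_of_sq_le_sq' ?_ (by positivity) |>.2
    rw [← norm_pow, hs_sq, norm_mul, hρ]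
    nlinarith [sq_nonneg (‖β₁ z₀‖ - ‖β₂ z₀‖)]
  have hsL : ∀ x ∈ Metric.ball z₀ (3 * ρ / 4), ∀ y ∈ Metric.ball z₀ (3 * ρ / 4),
      ‖s y - s x‖ ≤ 3 * κ * ‖y - x‖ := by
    intro x hx y hy
    have hsub : Metric.ball z₀ ρ ⊆ D := hD ▸ Metric.ball_subset_closedBall
    have := norm_sub_le_of_bounded_on_ball (f := fun z => s z - s z₀) (M := 3 * κ * ‖s z₀‖)
      (by linarith : 3 * ρ / 4 < ρ)
      (((hta.differentiableOn.mul hsa.differentiableOn).mono (hsub.trans hDU)).sub_const _)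
      (fun z hz => hsD z (hsub hz)) hx hy
    simp only [sub_sub_sub_cancel_right] at this
    refine this.trans (mul_le_mul_of_nonneg_right ?_ (norm_nonneg _))
    rw [div_le_iff₀ (by linarith)]
    nlinarith
  -- The roots lie within `ρ/2` of `z₀`. The radius `5ρ/8` leaves room for the fixed point argument
  -- below, where the image of this disc lies within `ρ/16 + ρ/2 ≤ 5ρ/8` of `z₀`, and is below the
  -- radius `3ρ/4` on which `s` is Lipschitz.
  have near : ∀ z, ‖z - z₀‖ = ‖zp - zm‖ / 2 → z ∈ Metric.closedBall z₀ (5 * ρ / 8) := by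
    intro z hz
    rw [mem_closedBall_iff_norm, hz]
    linarith
  have hpn := near zp (by rw [hz₀, show zp - (zp + zm) / 2 = (zp - zm) / 2 by ring]; simp)
  have hmn := near zm (by rw [hz₀, show zm - (zp + zm) / 2 = -((zp - zm) / 2) by ring]; simp)
  have hsub1 : Metric.closedBall z₀ (5 * ρ / 8) ⊆ Metric.ball z₀ (3 * ρ / 4) :=
    Metric.closedBall_subset_ball (by linarith)
  have hsub2 : Metric.closedBall z₀ (5 * ρ / 8) ⊆ D :=
    hD ▸ Metric.closedBall_subset_closedBall (by linarith)
  have cases_of_sq : ∀ z, (z - α z) ^ 2 = β₁ z * β₂ z → z - α z = s z ∨ z - α z = -s z := by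
    intro z hz
    rw [← hs_sq] at hz
    exact sq_eq_sq_iff_eq_or_eq_neg.1 hz
  have hαL : ∀ x ∈ D, ∀ y ∈ D, ‖α y - α x‖ ≤ 2 * ε * ‖y - x‖ := fun x hx y hy =>
    h.norm_sub_le_half h.diff_alpha h.bound_alpha (hDr hx) (hDr hy)
  -- Both roots on one branch would be fixed points of the same contraction, hence equal to each
  -- other and to `z₀`. The opposite branch `F` also contracts the disc of radius `5ρ/8` into
  -- itself; its fixed point is a root, so it is `z₀` as well, and comparing the two equations gives
  -- `s z₀ = 0`.
  have not_same : ∀ σ : ℂ, σ ^ 2 = 1 → zp - α zp = σ * s zp → zm - α zm = σ * s zm → False := by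
    intro σ hσ hpσ hmσ
    have hσn : ‖σ‖ = 1 := by
      have : ‖σ‖ ^ 2 = 1 := by rw [← norm_pow, hσ, norm_one]
      exact (pow_eq_one_iff_of_nonneg (norm_nonneg _) two_ne_zero).1 this
    have hσ0 : σ ≠ 0 := norm_pos_iff.1 (by rw [hσn]; exact one_pos)
    have hFL : ∀ τ : ℂ, ‖τ‖ = 1 → ∀ x ∈ Metric.closedBall z₀ (5 * ρ / 8),
        ∀ y ∈ Metric.closedBall z₀ (5 * ρ / 8),
        ‖(α y + τ * s y) - (α x + τ * s x)‖ ≤ (1 / 10) * ‖y - x‖ := by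
      intro τ hτ x hx y hy
      have h1 := hαL x (hsub2 hx) y (hsub2 hy)
      have h2 := hsL x (hsub1 hx) y (hsub1 hy)
      have e : (α y + τ * s y) - (α x + τ * s x) = (α y - α x) + τ * (s y - s x) := by ring
      have h3 : ‖(α y + τ * s y) - (α x + τ * s x)‖ ≤ ‖α y - α x‖ + ‖s y - s x‖ := by
        rw [e]; exact (norm_add_le _ _).trans (by rw [norm_mul, hτ, one_mul])
      nlinarith [norm_nonneg (y - x)]
    have heq : zp = zm := by
      have h1 := hFL σ hσn zm hmn zp hpn
      have e : (α zp + σ * s zp) - (α zm + σ * s zm) = zp - zm := by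
        rw [← hpσ, ← hmσ]; ring
      rw [e] at h1
      have : ‖zp - zm‖ ≤ 0 := by linarith [norm_nonneg (zp - zm)]
      exact sub_eq_zero.1 (norm_le_zero_iff.1 this)
    have hz₀p : z₀ = zp := by rw [hz₀, ← heq]; ring
    rw [← hz₀p] at hpσ
    set F : ℂ → ℂ := fun z => α z + -σ * s z with hF
    have hFl := hFL (-σ) (by rw [norm_neg, hσn])
    have hmaps : Set.MapsTo F (Metric.closedBall z₀ (5 * ρ / 8))
        (Metric.closedBall z₀ (5 * ρ / 8)) := by
      intro z hz
      have h1 := hFl z₀ (Metric.mem_closedBall_self (by positivity)) z hz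
      rw [mem_closedBall_iff_norm] at hz ⊢
      have e : F z - z₀ = (F z - F z₀) + -(2 * σ * s z₀) := by
        simp only [hF]; linear_combination -hpσ
      have h2 : ‖F z - z₀‖ ≤ ‖F z - F z₀‖ + 2 * ‖s z₀‖ := by
        rw [e]; exact (norm_add_le _ _).trans (by simp [hσn])
      have h3 : ‖F z - F z₀‖ ≤ 1 / 10 * ‖z - z₀‖ := h1
      linarith
    have hlip : LipschitzOnWith (1 / 10 : NNReal) F (Metric.closedBall z₀ (5 * ρ / 8)) := by
      refine LipschitzOnWith.of_dist_le_mul fun x hx y hy => ?_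
      rw [dist_eq_norm, dist_eq_norm]
      rw [show ((1 / 10 : NNReal) : ℝ) = 1 / 10 by norm_num]
      exact hFl y hy x hx
    have hcon : ContractingWith (1 / 10 : NNReal) (hmaps.restrict F _ _) :=
      ⟨by rw [div_lt_one (by norm_num)]; norm_num, hlip.mapsToRestrict hmaps⟩
    obtain ⟨y, hy, hfix, -⟩ := hcon.exists_fixedPoint' Metric.isClosed_closedBall.isComplete
      hmaps (Metric.mem_closedBall_self (x := z₀) (by positivity)) (edist_ne_top _ _)
    have hfix' : α y + -σ * s y = y := hfix
    have hyr : (y - α y) ^ 2 = β₁ y * β₂ y := by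
      rw [← hs_sq]
      linear_combination (y - α y - σ * s y) * (-hfix') + s y ^ 2 * hσ
    have hyz : y = z₀ := by
      rcases (hroots y (hDr' (hsub2 hy))).1 hyr with h1 | h1
      · rw [h1, ← heq, hz₀p]
      · rw [h1, hz₀p]
    rw [hyz] at hfix'
    have : 2 * (σ * s z₀) = 0 := by linear_combination -hpσ - hfix'
    exact mul_ne_zero hσ0 hs₀ (by simpa using this)
  -- The sign `σ` is chosen so that `zp` belongs to the branch `+`; it is absorbed into the first
  -- square root.
  obtain ⟨σ, hσ, hpσ, hmσ⟩ : ∃ σ : ℂ, σ ^ 2 = 1 ∧ zp - α zp = σ * s zp ∧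
      zm - α zm = -(σ * s zm) := by
    rcases cases_of_sq zp hrp with h1 | h1 <;> rcases cases_of_sq zm hrm with h2 | h2
    · exact (not_same 1 (by norm_num) (by simpa using h1) (by simpa using h2)).elim
    · exact ⟨1, by norm_num, by simpa using h1, by simpa using h2⟩
    · exact ⟨-1, by norm_num, by simpa using h1, by simpa using h2⟩
    · exact (not_same (-1) (by norm_num) (by simpa using h1) (by simpa using h2)).elim
  have hσn : ‖σ‖ = 1 := by
    have : ‖σ‖ ^ 2 = 1 := by rw [← norm_pow, hσ, norm_one]
    exact (pow_eq_one_iff_of_nonneg (norm_nonneg _) two_ne_zero).1 this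
  have hσ0 : σ ≠ 0 := norm_pos_iff.1 (by rw [hσn]; exact one_pos)
  have hclash : ∀ z ∈ D, σ * s z = -(σ * s z) → False := fun z hz hh => by
    have : σ * s z = 0 := self_eq_neg.1 hh
    exact mul_ne_zero hσ0 (hs0 z hz) this
  refine ⟨fun z => σ * t z, s₂, ⟨U, hUo, hDU, fun z hz => analyticAt_const.mul (hta z hz), hsa,
    fun z _ => by simp only [mul_pow, hσ, htsq, one_mul], fun z _ => hssq z⟩, ?_, ?_, ?_⟩
  · intro z
    rw [mul_assoc]
    constructor
    · rintro ⟨hzD, hz⟩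
      rcases (hroots z (hDr' hzD)).1 (by rw [← hs_sq, hz, mul_pow, hσ, one_mul]) with rfl | rfl
      · exact (hclash z hzD (hz.symm.trans hmσ)).elim
      · rfl
    · rintro rfl
      exact ⟨hsub2 hpn, hpσ⟩
  · intro z
    rw [mul_assoc]
    constructor
    · rintro ⟨hzD, hz⟩
      rcases (hroots z (hDr' hzD)).1 (by rw [← hs_sq, hz, neg_sq, mul_pow, hσ, one_mul])
        with rfl | rfl
      · rfl
      · exact (hclash z hzD (hpσ.symm.trans hz)).elim
    · rintro rfl
      exact ⟨hsub2 hmn, hmσ⟩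
  -- The branches depend only on the fixed bounds `ε, κ ≤ 1/100`; a finer `δ` for the same functions
  -- improves only the error, through the Lipschitz constant `2δ` of `α`. With `|zp - zm| ≤ 3 |s
  -- z₀|` the error is `(6δ + 6κ) |s z₀|` against `2 |s z₀|`.
  · intro δ hδ hsmall
    have hδ0 := hsmall.eps_nonneg
    have hden : (2 * (σ * t z₀) * s₂ z₀) = 2 * (σ * s z₀) := by simp only [hs]; ring
    have hden0 : 2 * (σ * s z₀) ≠ 0 := mul_ne_zero two_ne_zero (mul_ne_zero hσ0 hs₀)
    have hdenn : ‖2 * (σ * s z₀)‖ = 2 * ‖s z₀‖ := by simp [hσn]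
    have h1 := hsD zp (hsub2 hpn)
    have h2 := hsD zm (hsub2 hmn)
    have h3 := hsmall.norm_sub_le_half hsmall.diff_alpha hsmall.bound_alpha hm2 hp2
    have e : zp - zm - 2 * (σ * s z₀) =
        (α zp - α zm) + σ * (s zp - s z₀) + σ * (s zm - s z₀) := by
      linear_combination hpσ - hmσ
    have h4 : ‖zp - zm - 2 * (σ * s z₀)‖ ≤ 2 * δ * ‖zp - zm‖ + 6 * κ * ‖s z₀‖ := by
      rw [e]
      refine norm_add₃_le.trans ?_
      rw [norm_mul, norm_mul, hσn]
      linarith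
    have h5 : ‖zp - zm‖ ≤ ‖zp - zm - 2 * (σ * s z₀)‖ + 2 * ‖s z₀‖ := by
      rw [← hdenn]; simpa using norm_add_le (zp - zm - 2 * (σ * s z₀)) (2 * (σ * s z₀))
    have h6 : ‖zp - zm‖ ≤ 3 * ‖s z₀‖ := by nlinarith [norm_nonneg (zp - zm)]
    rw [hden, div_sub_one hden0, norm_div, hdenn, div_le_iff₀ (by positivity)]
    have h7 : δ * ‖zp - zm‖ ≤ δ * (3 * ‖s z₀‖) := by gcongr
    nlinarith

end SmallTriple

/-! ### Infinite matrices that are small in a weighted Hilbert–Schmidt norm -/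

section Weighted

variable {ι : Type} {V : ι → ι → ℂ} {D : ι → ℝ} {θ : ℝ} {d : ι → ℂ} {a b : ι}

/-- `f` is square summable with the weight `D`. -/
def WSummable (D : ι → ℝ) (f : ι → ℂ) : Prop := Summable fun i => D i * ‖f i‖ ^ 2

/-- The squared norm of `f` with respect to the weight `D`. -/
noncomputable def energy (D : ι → ℝ) (f : ι → ℂ) : ℝ := ∑' i, D i * ‖f i‖ ^ 2

theorem energy_nonneg (hD : ∀ j, 0 ≤ D j) (f : ι → ℂ) : 0 ≤ energy D f :=
  tsum_nonneg fun i => mul_nonneg (hD i) (sq_nonneg _)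

theorem summable_mul_and_tsum_le_sqrt {x y : ι → ℝ} (hx0 : ∀ i, 0 ≤ x i) (hy0 : ∀ i, 0 ≤ y i)
    (hx : Summable fun i => x i ^ 2) (hy : Summable fun i => y i ^ 2) :
    (Summable fun i => x i * y i) ∧
      ∑' i, x i * y i ≤ √(∑' i, x i ^ 2) * √(∑' i, y i ^ 2) := by
  have hx' : Summable fun i => x i ^ (2 : ℝ) := by simpa using hx
  have hy' : Summable fun i => y i ^ (2 : ℝ) := by simpa using hy
  refine ⟨Real.summable_mul_of_Lp_Lq_of_nonneg Real.HolderConjugate.two_two hx0 hy0 hx' hy', ?_⟩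
  have := Real.inner_le_Lp_mul_Lq_tsum_of_nonneg Real.HolderConjugate.two_two hx0 hy0 hx' hy'
  simpa [Real.sqrt_eq_rpow] using this

theorem sqrt_weight_sq (hD : ∀ j, 0 ≤ D j) (f : ι → ℂ) (i : ι) :
    (√(D i) * ‖f i‖) ^ 2 = D i * ‖f i‖ ^ 2 := by
  rw [mul_pow, Real.sq_sqrt (hD i)]

theorem weighted_cauchy_schwarz (hD : ∀ j, 0 ≤ D j) {x f : ι → ℂ} (hx : WSummable D x)
    (hf : WSummable D f) :
    (Summable fun i => D i * (‖x i‖ * ‖f i‖)) ∧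
      ∑' i, D i * (‖x i‖ * ‖f i‖) ≤ √(energy D x) * √(energy D f) := by
  have key := summable_mul_and_tsum_le_sqrt (x := fun i => √(D i) * ‖x i‖)
    (y := fun i => √(D i) * ‖f i‖) (fun i => by positivity) (fun i => by positivity)
    (hx.congr fun i => (sqrt_weight_sq hD x i).symm) (hf.congr fun i => (sqrt_weight_sq hD f i).symm)
  have e : ∀ i, (√(D i) * ‖x i‖) * (√(D i) * ‖f i‖) = D i * (‖x i‖ * ‖f i‖) := fun i => by
    rw [mul_mul_mul_comm, Real.mul_self_sqrt (hD i)]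
  simpa only [e, sqrt_weight_sq hD] using! key

theorem summable_norm_apply (hD : ∀ j, 0 ≤ D j) (hd : ∀ j, ‖d j‖ ≤ D j) {x f : ι → ℂ}
    (hx : WSummable D x) (hf : WSummable D f) :
    (Summable fun i => ‖x i * d i * f i‖) ∧
      ∑' i, ‖x i * d i * f i‖ ≤ √(energy D x) * √(energy D f) := by
  obtain ⟨h1, h2⟩ := weighted_cauchy_schwarz hD hx hf
  have hle : ∀ i, ‖x i * d i * f i‖ ≤ D i * (‖x i‖ * ‖f i‖) := fun i => by
    rw [norm_mul, norm_mul, mul_comm ‖x i‖, mul_assoc]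
    exact mul_le_mul_of_nonneg_right (hd i) (by positivity)
  have hs := Summable.of_nonneg_of_le (fun _ => norm_nonneg _) hle h1
  exact ⟨hs, (hs.tsum_le_tsum hle h1).trans h2⟩

theorem norm_apply_le (hD : ∀ j, 0 ≤ D j) (hd : ∀ j, ‖d j‖ ≤ D j) {x f : ι → ℂ}
    (hx : WSummable D x) (hf : WSummable D f) :
    ‖∑' i, x i * d i * f i‖ ≤ √(energy D x) * √(energy D f) :=
  (norm_tsum_le_tsum_norm (summable_norm_apply hD hd hx hf).1).trans
    (summable_norm_apply hD hd hx hf).2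

theorem WSummable.of_norm_le (hD : ∀ j, 0 ≤ D j) {f g : ι → ℂ} (hg : WSummable D g)
    (h : ∀ j, D j ≠ 0 → ‖f j‖ ≤ ‖g j‖) : WSummable D f := by
  refine Summable.of_nonneg_of_le (fun i => mul_nonneg (hD i) (sq_nonneg _)) (fun i => ?_) hg
  rcases eq_or_ne (D i) 0 with h0 | h0
  · simp [h0]
  · exact mul_le_mul_of_nonneg_left (by gcongr; exact h i h0) (hD i)

theorem WSummable.add (hD : ∀ j, 0 ≤ D j) {f g : ι → ℂ} (hf : WSummable D f)
    (hg : WSummable D g) : WSummable D (fun i => f i + g i) := by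
  refine Summable.of_nonneg_of_le (fun i => mul_nonneg (hD i) (sq_nonneg _)) (fun i => ?_)
    ((Summable.add hf hg).mul_left 2)
  have h1 : ‖f i + g i‖ ^ 2 ≤ (‖f i‖ + ‖g i‖) ^ 2 := by gcongr; exact norm_add_le _ _
  nlinarith [hD i, mul_nonneg (hD i) (sq_nonneg (‖f i‖ - ‖g i‖)),
    mul_le_mul_of_nonneg_left h1 (hD i)]

theorem WSummable.const_mul {f : ι → ℂ} (hf : WSummable D f) (c : ℂ) :
    WSummable D (fun i => c * f i) := by
  refine (Summable.mul_left (‖c‖ ^ 2) hf).congr fun i => ?_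
  rw [norm_mul]; ring

variable (V D θ) in
/-- The matrix `√D V √D` has Hilbert–Schmidt norm at most `θ < 1`. -/
structure HSBound : Prop where
  weight_nonneg : ∀ j, 0 ≤ D j
  theta_nonneg : 0 ≤ θ
  theta_lt_one : θ < 1
  -- Since `tsum` is `0` on families that are not summable, bounds on `energy` carry information
  -- only together with this condition. Rows of weight `0`, among them the resonant ones, are left
  -- free.
  row : ∀ j, D j ≠ 0 → WSummable D (V j)
  summable : Summable fun j => D j * energy D (V j)
  tsum_le : ∑' j, D j * energy D (V j) ≤ θ ^ 2

namespace HSBound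

theorem wsummable_sqrt_row (h : HSBound V D θ) :
    WSummable D (fun j => ((√(energy D (V j)) : ℝ) : ℂ)) := by
  refine h.summable.congr fun j => ?_
  rw [Complex.norm_real, Real.norm_eq_abs, sq_abs, Real.sq_sqrt (energy_nonneg h.weight_nonneg _)]

/-- Cauchy–Schwarz in each row, then summation over the rows: the Hilbert–Schmidt norm bounds the
operator norm of `V d` in the weighted space. -/
theorem energy_apply (h : HSBound V D θ) (hd : ∀ j, ‖d j‖ ≤ D j) {f : ι → ℂ}
    (hf : WSummable D f) :
    WSummable D (fun a => ∑' j, V a j * d j * f j) ∧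
      energy D (fun a => ∑' j, V a j * d j * f j) ≤ θ ^ 2 * energy D f := by
  have hle : ∀ a, D a * ‖∑' j, V a j * d j * f j‖ ^ 2 ≤ D a * energy D (V a) * energy D f := by
    intro a
    rcases eq_or_ne (D a) 0 with h0 | h0
    · simp [h0]
    · have h1 := norm_apply_le h.weight_nonneg hd (h.row a h0) hf
      rw [mul_assoc]
      refine mul_le_mul_of_nonneg_left ?_ (h.weight_nonneg a)
      calc ‖∑' j, V a j * d j * f j‖ ^ 2 ≤ (√(energy D (V a)) * √(energy D f)) ^ 2 := by gcongr
        _ = _ := by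
          rw [mul_pow, Real.sq_sqrt (energy_nonneg h.weight_nonneg _),
            Real.sq_sqrt (energy_nonneg h.weight_nonneg _)]
  have hs : WSummable D (fun a => ∑' j, V a j * d j * f j) :=
    Summable.of_nonneg_of_le (fun i => mul_nonneg (h.weight_nonneg i) (sq_nonneg _)) hle
      (h.summable.mul_right _)
  refine ⟨hs, (Summable.tsum_le_tsum hle hs (h.summable.mul_right _)).trans ?_⟩
  rw [tsum_mul_right]
  exact mul_le_mul_of_nonneg_right h.tsum_le (energy_nonneg h.weight_nonneg _)

theorem iterEntry_energy (h : HSBound V D θ) (hd : ∀ j, ‖d j‖ ≤ D j)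
    (hb : WSummable D fun j => V j b) (k : ℕ) :
    WSummable D (iterEntry V d b k) ∧
      √(energy D (iterEntry V d b k)) ≤ θ ^ k * √(energy D fun j => V j b) := by
  induction k with
  | zero => exact ⟨hb, by simp [iterEntry]⟩
  | succ k ih =>
    obtain ⟨h1, h2⟩ := h.energy_apply hd ih.1
    refine ⟨h1, ?_⟩
    calc √(energy D (iterEntry V d b (k + 1)))
        ≤ √(θ ^ 2 * energy D (iterEntry V d b k)) := Real.sqrt_le_sqrt h2
      _ = θ * √(energy D (iterEntry V d b k)) := by
        rw [Real.sqrt_mul (sq_nonneg _), Real.sqrt_sq h.theta_nonneg]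
      _ ≤ θ * (θ ^ k * √(energy D fun j => V j b)) :=
        mul_le_mul_of_nonneg_left ih.2 h.theta_nonneg
      _ = _ := by ring

/-- The endpoints `a, b` may have weight `0`, where the weighted norm sees nothing. So the last
factor `V a ·` is paired by Cauchy–Schwarz with the `k`-th iterate, at the cost of the energies of
one row and one column. -/
theorem norm_iterEntry_succ_le (h : HSBound V D θ) (hd : ∀ j, ‖d j‖ ≤ D j)
    (hb : WSummable D fun j => V j b) (ha : WSummable D (V a)) (k : ℕ) :
    ‖iterEntry V d b (k + 1) a‖ ≤ √(energy D (V a)) * √(energy D fun j => V j b) * θ ^ k := by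
  obtain ⟨h1, h2⟩ := h.iterEntry_energy hd hb k
  refine (norm_apply_le h.weight_nonneg hd ha h1).trans ?_
  calc _ ≤ √(energy D (V a)) * (θ ^ k * √(energy D fun j => V j b)) := by gcongr
    _ = _ := by ring

theorem summable_geometric (h : HSBound V D θ) (C : ℝ) : Summable fun k : ℕ => C * θ ^ k :=
  (summable_geometric_of_lt_one h.theta_nonneg h.theta_lt_one).mul_left _

theorem summable_iterEntry_succ (h : HSBound V D θ) (hd : ∀ j, ‖d j‖ ≤ D j)
    (hb : WSummable D fun j => V j b) (ha : WSummable D (V a)) :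
    Summable fun k => iterEntry V d b (k + 1) a :=
  Summable.of_norm_bounded (h.summable_geometric _) (h.norm_iterEntry_succ_le hd hb ha)

theorem summable_iterEntry (h : HSBound V D θ) (hd : ∀ j, ‖d j‖ ≤ D j)
    (hb : WSummable D fun j => V j b) (ha : WSummable D (V a)) :
    Summable fun k => iterEntry V d b k a :=
  (summable_nat_add_iff 1).1 (h.summable_iterEntry_succ hd hb ha)

theorem reducedEntry_eq_add (h : HSBound V D θ) (hd : ∀ j, ‖d j‖ ≤ D j)
    (hb : WSummable D fun j => V j b) (ha : WSummable D (V a)) :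
    reducedEntry V d a b = V a b + ∑' k, iterEntry V d b (k + 1) a :=
  (h.summable_iterEntry hd hb ha).tsum_eq_zero_add

theorem norm_reducedEntry_sub_le (h : HSBound V D θ) (hd : ∀ j, ‖d j‖ ≤ D j)
    (hb : WSummable D fun j => V j b) (ha : WSummable D (V a)) :
    ‖reducedEntry V d a b - V a b‖ ≤
      √(energy D (V a)) * √(energy D fun j => V j b) * (1 - θ)⁻¹ := by
  rw [h.reducedEntry_eq_add hd hb ha, add_sub_cancel_left]
  refine (tsum_of_norm_bounded (h.summable_geometric _).hasSum
    (h.norm_iterEntry_succ_le hd hb ha)).trans ?_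
  rw [tsum_mul_left, tsum_geometric_of_lt_one h.theta_nonneg h.theta_lt_one]

theorem wsummable_reducedEntry (h : HSBound V D θ) (hd : ∀ j, ‖d j‖ ≤ D j)
    (hb : WSummable D fun j => V j b) : WSummable D (fun j => reducedEntry V d j b) := by
  have h1 : WSummable D fun j => reducedEntry V d j b - V j b := by
    refine WSummable.of_norm_le h.weight_nonneg
      (h.wsummable_sqrt_row.const_mul ((√(energy D fun j => V j b) * (1 - θ)⁻¹ : ℝ) : ℂ))
      fun j hj => ?_
    refine (h.norm_reducedEntry_sub_le hd hb (h.row j hj)).trans (le_of_eq ?_)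
    rw [norm_mul, Complex.norm_real, Complex.norm_real, Real.norm_of_nonneg,
      Real.norm_of_nonneg (Real.sqrt_nonneg _)]
    · ring
    · exact mul_nonneg (Real.sqrt_nonneg _) (inv_nonneg.2 (by linarith [h.theta_lt_one]))
  refine (h1.add h.weight_nonneg hb).congr fun j => ?_
  simp

/-- The equation `S = V + V d S`. -/
theorem reducedEntry_eq_add_apply (h : HSBound V D θ) (hd : ∀ j, ‖d j‖ ≤ D j)
    (hb : WSummable D fun j => V j b) (ha : WSummable D (V a)) :
    reducedEntry V d a b = V a b + ∑' j, V a j * d j * reducedEntry V d j b := by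
  rw [h.reducedEntry_eq_add hd hb ha]
  congr 1
  have hnorm : ∀ k, (Summable fun j => ‖V a j * d j * iterEntry V d b k j‖) ∧
      ∑' j, ‖V a j * d j * iterEntry V d b k j‖ ≤
        √(energy D (V a)) * √(energy D fun j => V j b) * θ ^ k := fun k => by
    obtain ⟨h1, h2⟩ := h.iterEntry_energy hd hb k
    obtain ⟨h3, h4⟩ := summable_norm_apply h.weight_nonneg hd ha h1
    refine ⟨h3, h4.trans ?_⟩
    calc _ ≤ √(energy D (V a)) * (θ ^ k * √(energy D fun j => V j b)) := by gcongr
      _ = _ := by ring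
  have hprod : Summable (Function.uncurry fun (k : ℕ) j => V a j * d j * iterEntry V d b k j) := by
    refine Summable.of_norm ((summable_prod_of_nonneg fun _ => norm_nonneg _).2
      ⟨fun k => (hnorm k).1, ?_⟩)
    exact Summable.of_nonneg_of_le (fun k => tsum_nonneg fun _ => norm_nonneg _)
      (fun k => (hnorm k).2) (h.summable_geometric _)
  change ∑' k, ∑' j, V a j * d j * iterEntry V d b k j = _
  rw [← hprod.tsum_comm]
  refine tsum_congr fun j => ?_
  rw [tsum_mul_left, reducedEntry]

/-- A fixed vector of a strict contraction has energy `0`, which forces it to vanish wherever the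
weight is positive. -/
theorem eq_zero_of_eq_apply (h : HSBound V D θ) (hd : ∀ j, ‖d j‖ ≤ D j) {H : ι → ℂ}
    (hH : WSummable D H) (heq : ∀ a, D a ≠ 0 → H a = ∑' j, V a j * d j * H j) :
    ∀ a, D a ≠ 0 → H a = 0 := by
  obtain ⟨h1, h2⟩ := h.energy_apply hd hH
  have e : energy D (fun a => ∑' j, V a j * d j * H j) = energy D H := by
    refine tsum_congr fun a => ?_
    rcases eq_or_ne (D a) 0 with h0 | h0
    · simp [h0]
    · simp only [← heq a h0]
  rw [e] at h2
  have hE := energy_nonneg h.weight_nonneg H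
  have hθ : θ ^ 2 < 1 := by nlinarith [h.theta_nonneg, h.theta_lt_one]
  have hE0 : energy D H = 0 := by nlinarith
  intro a ha
  have h3 : D a * ‖H a‖ ^ 2 ≤ 0 := hE0 ▸ hH.le_tsum a fun j _ =>
    mul_nonneg (h.weight_nonneg j) (sq_nonneg _)
  have h4 : 0 < D a := lt_of_le_of_ne (h.weight_nonneg a) (Ne.symm ha)
  have h5 : ‖H a‖ ^ 2 ≤ 0 := by nlinarith [sq_nonneg ‖H a‖]
  simpa using le_antisymm h5 (sq_nonneg _)

/-- Transposition: a symmetry `τ` of the weights that transposes the matrix `V` transposes `S`. -/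
theorem reducedEntry_symm (h : HSBound V D θ) (hd : ∀ j, ‖d j‖ ≤ D j) (τ : ι ≃ ι)
    (hV : ∀ i j, V (τ i) (τ j) = V j i) (hDτ : ∀ j, D (τ j) = D j) (hdτ : ∀ j, d (τ j) = d j)
    (ha : WSummable D (V a)) (hb : WSummable D fun j => V j b)
    (ha' : WSummable D fun j => V j (τ a)) (hb' : WSummable D (V (τ b))) :
    reducedEntry V d (τ b) (τ a) = reducedEntry V d a b := by
  set T : ι → ℂ := fun i => reducedEntry V d (τ i) (τ a) with hT
  set S : ι → ℂ := fun i => reducedEntry V d i b with hS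
  have hTw : WSummable D T := by
    have := (τ.summable_iff (f := fun i => D i * ‖reducedEntry V d i (τ a)‖ ^ 2)).2
      (h.wsummable_reducedEntry hd ha')
    exact this.congr fun i => by simp [hT, hDτ]
  have hSw : WSummable D S := h.wsummable_reducedEntry hd hb
  have hTeq : ∀ j, WSummable D (V (τ j)) → T j = V a j + ∑' i, T i * d i * V i j := by
    intro j hj
    simp only [hT]
    rw [h.reducedEntry_eq_add_apply hd ha' hj, hV]
    congr 1
    rw [← τ.tsum_eq]
    exact tsum_congr fun i => by rw [hV, hdτ]; ring
  have hTrow : ∀ j, D j ≠ 0 → T j = V a j + ∑' i, T i * d i * V i j := fun j hj =>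
    hTeq j (h.row _ (by rwa [hDτ]))
  have hSeq : ∀ i, D i ≠ 0 → S i = V i b + ∑' j, V i j * d j * S j := fun i hi =>
    h.reducedEntry_eq_add_apply hd hb (h.row i hi)
  have hd0 : ∀ j, D j = 0 → d j = 0 := fun j hj => norm_le_zero_iff.1 (hj ▸ hd j)
  have hrow : ∀ i, (Summable fun j => ‖T i * d i * (V i j * d j * S j)‖) ∧
      ∑' j, ‖T i * d i * (V i j * d j * S j)‖ ≤
        D i * (‖T i‖ * ‖((√(energy D (V i)) : ℝ) : ℂ)‖) * √(energy D S) := by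
    intro i
    simp only [norm_mul (T i * d i)]
    rcases eq_or_ne (D i) 0 with h0 | h0
    · simp [hd0 i h0, h0, summable_zero]
    · obtain ⟨h1, h2⟩ := summable_norm_apply h.weight_nonneg hd (h.row i h0) hSw
      refine ⟨h1.mul_left _, ?_⟩
      rw [tsum_mul_left, norm_mul, Complex.norm_real, Real.norm_of_nonneg (Real.sqrt_nonneg _)]
      calc _ ≤ ‖T i‖ * D i * (√(energy D (V i)) * √(energy D S)) := by
            have := hd i
            have := h.weight_nonneg i
            gcongr
        _ = _ := by ring
  have hprod : Summable (Function.uncurry fun i j => T i * d i * (V i j * d j * S j)) := by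
    refine Summable.of_norm ((summable_prod_of_nonneg fun _ => norm_nonneg _).2
      ⟨fun i => (hrow i).1, ?_⟩)
    exact Summable.of_nonneg_of_le (fun k => tsum_nonneg fun _ => norm_nonneg _)
      (fun i => (hrow i).2)
      ((weighted_cauchy_schwarz h.weight_nonneg hTw h.wsummable_sqrt_row).1.mul_right _)
  -- The form `T d V d S` is evaluated in two ways: the inner sum over `j` by the equation for `S`,
  -- the inner sum over `i` by the transposed equation for `T`. The common term `T d S` cancels,
  -- leaving the equality of `T d V(·, b)` and `V(a, ·) d S`.
  have hcomm : ∑' i, ∑' j, T i * d i * (V i j * d j * S j) =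
      ∑' j, ∑' i, T i * d i * (V i j * d j * S j) := hprod.tsum_comm.symm
  have hTS := (summable_norm_apply h.weight_nonneg hd hTw hSw).1.of_norm
  have hTV := (summable_norm_apply h.weight_nonneg hd hTw hb).1.of_norm
  have hVS := (summable_norm_apply h.weight_nonneg hd ha hSw).1.of_norm
  have e1 : ∀ i, ∑' j, T i * d i * (V i j * d j * S j) = T i * d i * S i - T i * d i * V i b := by
    intro i
    rw [tsum_mul_left]
    rcases eq_or_ne (D i) 0 with h0 | h0
    · simp [hd0 i h0]
    · rw [hSeq i h0]; ring
  have e2 : ∀ j, ∑' i, T i * d i * (V i j * d j * S j) = T j * d j * S j - V a j * d j * S j := by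
    intro j
    have : ∀ i, T i * d i * (V i j * d j * S j) = T i * d i * V i j * (d j * S j) := fun i => by
      ring
    simp only [this]
    rw [tsum_mul_right]
    rcases eq_or_ne (D j) 0 with h0 | h0
    · simp [hd0 j h0]
    · rw [hTrow j h0]; ring
  simp only [e1, e2] at hcomm
  rw [hTS.tsum_sub hTV, hTS.tsum_sub hVS] at hcomm
  have f1 := hTeq b hb'
  have f2 := h.reducedEntry_eq_add_apply hd hb ha
  change T b = _
  rw [f1, f2]
  linear_combination -hcomm

/-- Weierstrass's theorem at every level: the bounds on the iterates depend on `d` only through `D`,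
so the series over `j` has a summable majorant independent of `z`. -/
theorem differentiableOn_iterEntry (h : HSBound V D θ) {s : Set ℂ} (hs : IsOpen s)
    {d : ℂ → ι → ℂ} (hd : ∀ z ∈ s, ∀ j, ‖d z j‖ ≤ D j)
    (hdiff : ∀ j, DifferentiableOn ℂ (fun z => d z j) s)
    (hb : WSummable D fun j => V j b) (k : ℕ) (ha : WSummable D (V a)) :
    DifferentiableOn ℂ (fun z => iterEntry V (d z) b k a) s := by
  obtain ⟨M, hM, hMk⟩ : ∃ M : ℕ → ι → ℂ, (∀ k, WSummable D (M k)) ∧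
      ∀ k, ∀ z ∈ s, ∀ j, D j ≠ 0 → ‖iterEntry V (d z) b k j‖ ≤ ‖M k j‖ := by
    refine ⟨fun k => k.casesOn (fun j => V j b) fun k j =>
      ((√(energy D fun j => V j b) * θ ^ k : ℝ) : ℂ) * ((√(energy D (V j)) : ℝ) : ℂ), ?_, ?_⟩
    · rintro (_ | k)
      · exact hb
      · exact h.wsummable_sqrt_row.const_mul _
    · rintro (_ | k) z hz j hj
      · exact le_rfl
      · refine (h.norm_iterEntry_succ_le (hd z hz) hb (h.row j hj) k).trans (le_of_eq ?_)
        simp only [norm_mul, Complex.norm_real, Real.norm_of_nonneg (Real.sqrt_nonneg _),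
          Real.norm_of_nonneg (pow_nonneg h.theta_nonneg k)]
        ring
  induction k generalizing a with
  | zero => exact differentiableOn_const _
  | succ k ih =>
    refine Complex.differentiableOn_tsum_of_summable_norm
      (weighted_cauchy_schwarz h.weight_nonneg ha (hM k)).1 (fun j => ?_) hs fun j z hz => ?_
    · rcases eq_or_ne (D j) 0 with h0 | h0
      · refine (differentiableOn_const (0 : ℂ)).congr fun z hz => ?_
        have hd0 : d z j = 0 := norm_le_zero_iff.1 (h0 ▸ hd z hz j)
        simp [hd0]
      · exact ((differentiableOn_const _).mul (hdiff j)).mul (ih (h.row j h0))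
    · rcases eq_or_ne (D j) 0 with h0 | h0
      · have hd0 : d z j = 0 := norm_le_zero_iff.1 (h0 ▸ hd z hz j)
        simp [hd0, h0]
      · rw [norm_mul, norm_mul, mul_comm ‖V a j‖, mul_assoc]
        have := hMk k z hz j h0
        have := hd z hz j
        have := h.weight_nonneg j
        gcongr

theorem differentiableOn_reducedEntry (h : HSBound V D θ) {s : Set ℂ} (hs : IsOpen s)
    {d : ℂ → ι → ℂ} (hd : ∀ z ∈ s, ∀ j, ‖d z j‖ ≤ D j)
    (hdiff : ∀ j, DifferentiableOn ℂ (fun z => d z j) s)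
    (hb : WSummable D fun j => V j b) (ha : WSummable D (V a)) :
    DifferentiableOn ℂ (fun z => reducedEntry V (d z) a b) s := by
  have : DifferentiableOn ℂ (fun z => V a b + ∑' k, iterEntry V (d z) b (k + 1) a) s :=
    (differentiableOn_const _).add (Complex.differentiableOn_tsum_of_summable_norm
      (h.summable_geometric _)
      (fun k => h.differentiableOn_iterEntry hs hd hdiff hb (k + 1) ha) hs
      fun k z hz => h.norm_iterEntry_succ_le (hd z hz) hb ha k)
  exact this.congr fun z hz => h.reducedEntry_eq_add (hd z hz) hb ha

/-! ### Reduction of the eigenvalue equation to a two-dimensional one -/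

variable [DecidableEq ι]

/-- The vector `Y` equals `d G` except at `a, b`, and `d` vanishes there with its majorant, so the
resonant and the remaining contributions simply add up. -/
theorem hasSum_of_two_add (h : HSBound V D θ) (hd : ∀ j, ‖d j‖ ≤ D j) (hab : a ≠ b)
    (hDa : D a = 0) (hDb : D b = 0) {Y G : ι → ℂ} (hG : WSummable D G)
    (hoff : ∀ j, j ≠ a → j ≠ b → Y j = d j * G j) {j : ι} (hj : WSummable D (V j)) :
    HasSum (fun i => V j i * Y i) (Y a * V j a + Y b * V j b + ∑' i, V j i * d i * G i) := by
  have hda : d a = 0 := norm_le_zero_iff.1 (hDa ▸ hd a)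
  have hdb : d b = 0 := norm_le_zero_iff.1 (hDb ▸ hd b)
  have h1 : HasSum (fun i => if i = a then Y a * V j a else 0) (Y a * V j a) :=
    hasSum_ite_eq a _
  have h2 : HasSum (fun i => if i = b then Y b * V j b else 0) (Y b * V j b) :=
    hasSum_ite_eq b _
  have h3 := (summable_norm_apply h.weight_nonneg hd hj hG).1.of_norm.hasSum
  refine ((h1.add h2).add h3).congr_fun fun i => ?_
  rcases eq_or_ne i a with rfl | hia
  · simp [hda, hab, mul_comm]
  · rcases eq_or_ne i b with rfl | hib
    · simp [hdb, hia, mul_comm]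
    · simp [hia, hib, hoff i hia hib, mul_assoc]

/-- Every solution `Y` of the eigenvalue equation (with `G = V Y`) yields a null vector of
`z - S(z)`. -/
theorem det_eq_zero_of_solution (h : HSBound V D θ) (hd : ∀ j, ‖d j‖ ≤ D j) (hab : a ≠ b)
    (hDa : D a = 0) (hDb : D b = 0) (hra : WSummable D (V a)) (hrb : WSummable D (V b))
    (hca : WSummable D fun j => V j a) (hcb : WSummable D fun j => V j b) {z : ℂ} {Y G : ι → ℂ}
    (hY : ∃ j, Y j ≠ 0) (hG : WSummable D G) (hoff : ∀ j, j ≠ a → j ≠ b → Y j = d j * G j)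
    (hsum : ∀ j, D j ≠ 0 ∨ j = a ∨ j = b → HasSum (fun i => V j i * Y i) (G j))
    (hza : G a = z * Y a) (hzb : G b = z * Y b) :
    (z - reducedEntry V d a a) * (z - reducedEntry V d b b) =
      reducedEntry V d a b * reducedEntry V d b a := by
  have hgood : ∀ j, D j ≠ 0 ∨ j = a ∨ j = b → WSummable D (V j) := by
    rintro j (hj | rfl | rfl)
    exacts [h.row j hj, hra, hrb]
  have hGeq : ∀ j, D j ≠ 0 ∨ j = a ∨ j = b →
      G j = Y a * V j a + Y b * V j b + ∑' i, V j i * d i * G i := fun j hj =>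
    (hsum j hj).unique (h.hasSum_of_two_add hd hab hDa hDb hG hoff (hgood j hj))
  -- The vector `S (Y_a e_a + Y_b e_b)` solves the same inhomogeneous equation as `G`. By uniqueness
  -- `G = F` on the support of the weight, hence also at `a` and `b`, where the equation expresses
  -- the value through that support.
  set F : ι → ℂ := fun j => Y a * reducedEntry V d j a + Y b * reducedEntry V d j b with hF
  have hFw : WSummable D F := ((h.wsummable_reducedEntry hd hca).const_mul _).add h.weight_nonneg
    ((h.wsummable_reducedEntry hd hcb).const_mul _)
  have hFeq : ∀ j, D j ≠ 0 ∨ j = a ∨ j = b →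
      F j = Y a * V j a + Y b * V j b + ∑' i, V j i * d i * F i := by
    intro j hj
    have s1 := (summable_norm_apply h.weight_nonneg hd (hgood j hj)
      (h.wsummable_reducedEntry hd hca)).1.of_norm
    have s2 := (summable_norm_apply h.weight_nonneg hd (hgood j hj)
      (h.wsummable_reducedEntry hd hcb)).1.of_norm
    have e : ∀ i, V j i * d i * F i = Y a * (V j i * d i * reducedEntry V d i a) +
        Y b * (V j i * d i * reducedEntry V d i b) := fun i => by simp only [hF]; ring
    simp only [e]
    rw [(s1.mul_left _).tsum_add (s2.mul_left _), tsum_mul_left, tsum_mul_left]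
    simp only [hF]
    rw [h.reducedEntry_eq_add_apply hd hca (hgood j hj),
      h.reducedEntry_eq_add_apply hd hcb (hgood j hj)]
    ring
  have hHw : WSummable D fun j => G j - F j :=
    (hG.add h.weight_nonneg (hFw.const_mul (-1))).congr fun i => by
      simp only [neg_one_mul, ← sub_eq_add_neg]
  have hHeq : ∀ j, D j ≠ 0 ∨ j = a ∨ j = b → G j - F j = ∑' i, V j i * d i * (G i - F i) := by
    intro j hj
    have s1 := (summable_norm_apply h.weight_nonneg hd (hgood j hj) hG).1.of_norm
    have s2 := (summable_norm_apply h.weight_nonneg hd (hgood j hj) hFw).1.of_norm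
    simp only [mul_sub]
    rw [s1.tsum_sub s2]
    linear_combination hGeq j hj - hFeq j hj
  have hH0 := h.eq_zero_of_eq_apply hd hHw fun j hj => hHeq j (Or.inl hj)
  have hdH : ∀ i, d i * (G i - F i) = 0 := fun i => by
    rcases eq_or_ne (D i) 0 with h0 | h0
    · have hd0 : d i = 0 := norm_le_zero_iff.1 (h0 ▸ hd i)
      rw [hd0, zero_mul]
    · rw [hH0 i h0, mul_zero]
  have hGF : ∀ j, D j ≠ 0 ∨ j = a ∨ j = b → G j = F j := fun j hj => by
    have := hHeq j hj
    simp only [mul_assoc, hdH, mul_zero, tsum_zero] at this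
    exact sub_eq_zero.1 this
  have ea : z * Y a = Y a * reducedEntry V d a a + Y b * reducedEntry V d a b :=
    hza ▸ hGF a (Or.inr (Or.inl rfl))
  have eb : z * Y b = Y a * reducedEntry V d b a + Y b * reducedEntry V d b b :=
    hzb ▸ hGF b (Or.inr (Or.inr rfl))
  -- If both resonant coordinates vanished, then `F = 0`, so `d G = 0` and `Y` would vanish off `a,
  -- b` too.
  have hne : Y a ≠ 0 ∨ Y b ≠ 0 := by
    by_contra! hcon
    obtain ⟨j, hj⟩ := hY
    refine hj ?_
    by_cases hja : j = a
    · rw [hja, hcon.1]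
    by_cases hjb : j = b
    · rw [hjb, hcon.2]
    rw [hoff j hja hjb]
    have : F j = 0 := by simp [hF, hcon.1, hcon.2]
    simpa [this] using hdH j
  rcases hne with h0 | h0
  · refine mul_left_cancel₀ h0 ?_
    linear_combination (z - reducedEntry V d b b) * ea + reducedEntry V d a b * eb
  · refine mul_left_cancel₀ h0 ?_
    linear_combination (z - reducedEntry V d a a) * eb + reducedEntry V d b a * ea

/-- Every null vector of `z - S(z)` yields a solution of the eigenvalue equation. -/
theorem exists_solution_of_det_eq_zero (h : HSBound V D θ) (hd : ∀ j, ‖d j‖ ≤ D j) (hab : a ≠ b)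
    (hDa : D a = 0) (hDb : D b = 0) (hra : WSummable D (V a)) (hrb : WSummable D (V b))
    (hca : WSummable D fun j => V j a) (hcb : WSummable D fun j => V j b) {z : ℂ}
    (hdet : (z - reducedEntry V d a a) * (z - reducedEntry V d b b) =
      reducedEntry V d a b * reducedEntry V d b a) :
    ∃ Y G : ι → ℂ, (Y a ≠ 0 ∨ Y b ≠ 0) ∧ WSummable D G ∧
      (∀ j, j ≠ a → j ≠ b → Y j = d j * G j) ∧
      (∀ j, D j ≠ 0 ∨ j = a ∨ j = b → HasSum (fun i => V j i * Y i) (G j)) ∧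
      G a = z * Y a ∧ G b = z * Y b := by
  have hgood : ∀ j, D j ≠ 0 ∨ j = a ∨ j = b → WSummable D (V j) := by
    rintro j (hj | rfl | rfl)
    exacts [h.row j hj, hra, hrb]
  -- A null vector of a singular `2 × 2` matrix: read off from the first row if that row is nonzero,
  -- otherwise from the second, and arbitrary if both are zero.
  obtain ⟨p, q, hpq, ea, eb⟩ : ∃ p q : ℂ, (p ≠ 0 ∨ q ≠ 0) ∧
      p * reducedEntry V d a a + q * reducedEntry V d a b = z * p ∧
      p * reducedEntry V d b a + q * reducedEntry V d b b = z * q := by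
    by_cases h1 : reducedEntry V d a b = 0 ∧ z - reducedEntry V d a a = 0
    · by_cases h2 : reducedEntry V d b a = 0 ∧ z - reducedEntry V d b b = 0
      · exact ⟨1, 0, by simp, by linear_combination -h1.2, by linear_combination h2.1⟩
      · refine ⟨z - reducedEntry V d b b, reducedEntry V d b a, ?_, ?_, by ring⟩
        · by_contra! hcon; exact h2 ⟨hcon.2, hcon.1⟩
        · linear_combination -hdet
    · refine ⟨reducedEntry V d a b, z - reducedEntry V d a a, ?_, by ring, ?_⟩
      · by_contra! hcon; exact h1 hcon
      · linear_combination -hdet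
  set G : ι → ℂ := fun j => p * reducedEntry V d j a + q * reducedEntry V d j b with hGdef
  have hG : WSummable D G := ((h.wsummable_reducedEntry hd hca).const_mul _).add h.weight_nonneg
    ((h.wsummable_reducedEntry hd hcb).const_mul _)
  set Y : ι → ℂ := fun j => if j = a then p else if j = b then q else d j * G j with hY
  have hYa : Y a = p := by simp [hY]
  have hYb : Y b = q := by simp [hY, hab.symm]
  have hoff : ∀ j, j ≠ a → j ≠ b → Y j = d j * G j := fun j h1 h2 => by simp [hY, h1, h2]
  refine ⟨Y, G, by rwa [hYa, hYb], hG, hoff, ?_, by rw [hYa]; exact ea, by rw [hYb]; exact eb⟩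
  intro j hj
  have hs := h.hasSum_of_two_add hd hab hDa hDb hG hoff (hgood j hj)
  convert hs using 1
  have s1 := (summable_norm_apply h.weight_nonneg hd (hgood j hj)
    (h.wsummable_reducedEntry hd hca)).1.of_norm
  have s2 := (summable_norm_apply h.weight_nonneg hd (hgood j hj)
    (h.wsummable_reducedEntry hd hcb)).1.of_norm
  have e : ∀ i, V j i * d i * G i = p * (V j i * d i * reducedEntry V d i a) +
      q * (V j i * d i * reducedEntry V d i b) := fun i => by simp only [hGdef]; ring
  simp only [e]
  rw [(s1.mul_left _).tsum_add (s2.mul_left _), tsum_mul_left, tsum_mul_left, hYa, hYb]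
  simp only [hGdef]
  rw [h.reducedEntry_eq_add_apply hd hca (hgood j hj),
    h.reducedEntry_eq_add_apply hd hcb (hgood j hj)]
  ring

end HSBound

end Weighted

/-! ### Fourier series on `[0, π]` with frequencies in `r + 2ℤ` -/

theorem intervalMeasure_eq_restrict_Ioc :
    intervalMeasure = volume.restrict (Set.Ioc 0 Real.pi) :=
  Measure.restrict_congr_set Ioc_ae_eq_Icc.symm

instance : IsFiniteMeasure intervalMeasure := by
  unfold intervalMeasure; infer_instance

theorem fourierCoeffPi_eq (f : ℝ → ℂ) (m : ℤ) :
    fourierCoeffPi f m =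
      (Real.pi : ℂ)⁻¹ * ∫ x, f x * Complex.exp (-(Complex.I * m * x)) ∂intervalMeasure := by
  rw [fourierCoeffPi, intervalIntegral.integral_of_le Real.pi_pos.le,
    intervalMeasure_eq_restrict_Ioc]

theorem intervalIntegrable_iff_integrable {f : ℝ → ℂ} :
    IntervalIntegrable f volume 0 Real.pi ↔ Integrable f intervalMeasure :=
  intervalIntegrable_iff_integrableOn_Icc_of_le Real.pi_pos.le

theorem norm_exp_I_mul (m : ℤ) (x : ℝ) : ‖Complex.exp (-(Complex.I * m * x))‖ = 1 := by
  rw [show -(Complex.I * m * x) = ((-(m * x) : ℝ) : ℂ) * Complex.I by push_cast; ring]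
  exact Complex.norm_exp_ofReal_mul_I _

theorem continuous_exp_I_mul (m : ℤ) :
    Continuous fun x : ℝ => Complex.exp (-(Complex.I * m * x)) := by fun_prop

theorem integrable_mul_exp {f : ℝ → ℂ} (hf : Integrable f intervalMeasure) (m : ℤ) :
    Integrable (fun x => f x * Complex.exp (-(Complex.I * m * x))) intervalMeasure :=
  hf.mul_bdd (c := 1) (continuous_exp_I_mul m).aestronglyMeasurable
    (ae_of_all _ fun x => (norm_exp_I_mul m x).le)

theorem memLp_mul_exp {f : ℝ → ℂ} (hf : MemLp f 2 intervalMeasure) (m : ℤ) :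
    MemLp (fun x => f x * Complex.exp (-(Complex.I * m * x))) 2 intervalMeasure := by
  refine MemLp.of_le hf (hf.1.mul (continuous_exp_I_mul m).aestronglyMeasurable)
    (ae_of_all _ fun x => ?_)
  rw [norm_mul, norm_exp_I_mul, mul_one]

theorem fourierCoeffPi_add {f g : ℝ → ℂ} (hf : Integrable f intervalMeasure)
    (hg : Integrable g intervalMeasure) (m : ℤ) :
    fourierCoeffPi (fun x => f x + g x) m = fourierCoeffPi f m + fourierCoeffPi g m := by
  simp only [fourierCoeffPi_eq, add_mul]
  rw [integral_add (integrable_mul_exp hf m) (integrable_mul_exp hg m), mul_add]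

theorem fourierCoeffPi_const_mul (c : ℂ) (f : ℝ → ℂ) (m : ℤ) :
    fourierCoeffPi (fun x => c * f x) m = c * fourierCoeffPi f m := by
  simp only [fourierCoeffPi_eq, mul_assoc c]
  rw [integral_const_mul]; ring

theorem fourierCoeffPi_sub {f g : ℝ → ℂ} (hf : Integrable f intervalMeasure)
    (hg : Integrable g intervalMeasure) (m : ℤ) :
    fourierCoeffPi (fun x => f x - g x) m = fourierCoeffPi f m - fourierCoeffPi g m := by
  simp only [fourierCoeffPi_eq, sub_mul]
  rw [integral_sub (integrable_mul_exp hf m) (integrable_mul_exp hg m), mul_sub]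

theorem fourierCoeffPi_congr {f g : ℝ → ℂ} (h : ∀ᵐ x ∂intervalMeasure, f x = g x) (m : ℤ) :
    fourierCoeffPi f m = fourierCoeffPi g m := by
  simp only [fourierCoeffPi_eq]
  congr 1
  exact integral_congr_ae (h.mono fun x hx => by simp only [hx])

/-- Multiplication by `e^{-irx}` carries the frequencies `r + 2ℤ` to `2ℤ`, the characters of the
circle of length `π`. The antiperiodic class is thereby reduced to ordinary Fourier series. -/
theorem fourierCoeffPi_mul_exp (f : ℝ → ℂ) (r m : ℤ) :
    fourierCoeffPi (fun x => f x * Complex.exp (-(Complex.I * r * x))) m =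
      fourierCoeffPi f (r + m) := by
  simp only [fourierCoeffPi, mul_assoc, ← Complex.exp_add]
  congr 2
  ext x
  congr 2
  push_cast; ring

theorem fourierCoeffPi_two_mul_eq_fourierCoeffOn (f : ℝ → ℂ) (k : ℤ) :
    fourierCoeffPi f (2 * k) = fourierCoeffOn Real.pi_pos f k := by
  rw [fourierCoeffOn_eq_integral, fourierCoeffPi]
  simp only [sub_zero, one_div, smul_eq_mul, Complex.real_smul, Complex.ofReal_inv]
  congr 2
  ext x
  rw [fourier_coe_apply, mul_comm]
  congr 2
  have : (Real.pi : ℂ) ≠ 0 := by exact_mod_cast Real.pi_ne_zero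
  push_cast
  field_simp
  simp

theorem fourierCoeffPi_two_mul_eq_fourierCoeff [Fact (0 < Real.pi)]
    (F : AddCircle Real.pi → ℂ) (k : ℤ) :
    fourierCoeffPi (fun x : ℝ => F x) (2 * k) = fourierCoeff F k := by
  rw [fourierCoeff_eq_intervalIntegral F k 0, fourierCoeffPi]
  simp only [zero_add, one_div, smul_eq_mul, Complex.real_smul, Complex.ofReal_inv]
  congr 2
  ext x
  rw [fourier_coe_apply, mul_comm]
  congr 2
  have : (Real.pi : ℂ) ≠ 0 := by exact_mod_cast Real.pi_ne_zero
  push_cast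
  field_simp

/-- Parseval's identity. -/
theorem hasSum_sq_fourierCoeffPi {f : ℝ → ℂ} (hf : MemLp f 2 intervalMeasure) (r : ℤ) :
    HasSum (fun k : ℤ => ‖fourierCoeffPi f (r + 2 * k)‖ ^ 2)
      (Real.pi⁻¹ * ∫ x, ‖f x‖ ^ 2 ∂intervalMeasure) := by
  have h := memLp_mul_exp hf r
  rw [intervalMeasure_eq_restrict_Ioc] at h
  have := hasSum_sq_fourierCoeffOn Real.pi_pos h
  simp only [← fourierCoeffPi_two_mul_eq_fourierCoeffOn, fourierCoeffPi_mul_exp, norm_mul,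
    norm_exp_I_mul, mul_one, sub_zero, smul_eq_mul] at this
  rwa [intervalIntegral.integral_of_le Real.pi_pos.le, ← intervalMeasure_eq_restrict_Ioc] at this

theorem ae_eq_zero_of_fourierCoeffPi {f : ℝ → ℂ} (hf : MemLp f 2 intervalMeasure) (r : ℤ)
    (h0 : ∀ k : ℤ, fourierCoeffPi f (r + 2 * k) = 0) : ∀ᵐ x ∂intervalMeasure, f x = 0 := by
  have h1 := hasSum_sq_fourierCoeffPi hf r
  simp only [h0, norm_zero, ne_eq, OfNat.ofNat_ne_zero, not_false_eq_true, zero_pow] at h1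
  have h2 := h1.unique hasSum_zero
  have h3 : ∫ x, ‖f x‖ ^ 2 ∂intervalMeasure = 0 := by
    simpa [Real.pi_ne_zero] using h2
  rw [integral_eq_zero_iff_of_nonneg (fun x => sq_nonneg _)
    ((memLp_two_iff_integrable_sq_norm hf.1).1 hf)] at h3
  exact h3.mono fun x hx => by simpa using hx

/-- The Riesz–Fischer theorem. -/
theorem exists_memLp_fourierCoeffPi {c : ℤ → ℂ} (hc : Summable fun k => ‖c k‖ ^ 2) (r : ℤ) :
    ∃ f : ℝ → ℂ, MemLp f 2 intervalMeasure ∧ ∀ k, fourierCoeffPi f (r + 2 * k) = c k := by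
  have : Fact (0 < Real.pi) := ⟨Real.pi_pos⟩
  have hmem : Memℓp c 2 := memℓp_gen (by simpa using hc)
  set F := (fourierBasis (T := Real.pi)).repr.symm ⟨c, hmem⟩ with hF
  have hcoef : ∀ k, fourierCoeff F k = c k := fun k => by
    rw [← fourierBasis_repr, hF, LinearIsometryEquiv.apply_symm_apply]
  have hFm : MemLp (fun x : ℝ => F (x : AddCircle Real.pi)) 2 intervalMeasure := by
    have h1 : MemLp F 2 (volume : Measure (AddCircle Real.pi)) :=
      memLp_haarAddCircle_iff.1 (Lp.memLp F)
    have h2 := h1.comp_measurePreserving (AddCircle.measurePreserving_mk Real.pi 0)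
    rw [zero_add] at h2
    rw [intervalMeasure_eq_restrict_Ioc]
    exact h2
  refine ⟨fun x => F (x : AddCircle Real.pi) * Complex.exp (-(Complex.I * ((-r : ℤ) : ℂ) * x)),
    memLp_mul_exp hFm (-r), fun k => ?_⟩
  rw [fourierCoeffPi_mul_exp, neg_add_cancel_left, fourierCoeffPi_two_mul_eq_fourierCoeff, hcoef]

theorem integrable_mul {f g : ℝ → ℂ} (hf : MemLp f 2 intervalMeasure)
    (hg : MemLp g 2 intervalMeasure) : Integrable (fun x => f x * g x) intervalMeasure :=
  hf.integrable_mul hg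

theorem fourierCoeffPi_conj (f : ℝ → ℂ) (m : ℤ) :
    (starRingEnd ℂ) (fourierCoeffPi (fun x => (starRingEnd ℂ) (f x)) m) =
      fourierCoeffPi f (-m) := by
  simp only [fourierCoeffPi_eq, map_mul, ← integral_conj, ← Complex.exp_conj, Complex.conj_conj]
  simp

/-- The polarised Parseval identity on the circle of length `π`, for the inner product of the
conjugate of `f` with `g`. -/
theorem hasSum_mul_fourierCoeffPi_zero {f g : ℝ → ℂ} (hf : MemLp f 2 intervalMeasure)
    (hg : MemLp g 2 intervalMeasure) :
    HasSum (fun k : ℤ => fourierCoeffPi f (-(2 * k)) * fourierCoeffPi g (2 * k))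
      (fourierCoeffPi (fun x => f x * g x) 0) := by
  have : Fact (0 < Real.pi) := ⟨Real.pi_pos⟩
  have lift_mem : ∀ {u : ℝ → ℂ}, MemLp u 2 intervalMeasure →
      MemLp (AddCircle.liftIoc Real.pi 0 u) 2 (AddCircle.haarAddCircle (T := Real.pi)) := by
    intro u hu
    rw [intervalMeasure_eq_restrict_Ioc, ← zero_add Real.pi] at hu
    exact hu.memLp_liftIoc.haarAddCircle
  have lift_coeff : ∀ (u : ℝ → ℂ) (k : ℤ),
      fourierCoeff (AddCircle.liftIoc Real.pi 0 u) k = fourierCoeffPi u (2 * k) := by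
    intro u k
    rw [← fourierCoeffPi_two_mul_eq_fourierCoeff]
    refine fourierCoeffPi_congr ?_ _
    rw [intervalMeasure_eq_restrict_Ioc]
    filter_upwards [ae_restrict_mem measurableSet_Ioc] with x hx
    exact AddCircle.liftIoc_coe_apply (by rwa [zero_add])
  have hf' : MemLp (fun x => (starRingEnd ℂ) (f x)) 2 intervalMeasure := hf.star
  set X := (lift_mem hf').toLp with hX
  set Y := (lift_mem hg).toLp with hY
  have hXc : ∀ k, fourierCoeff X k = fourierCoeffPi (fun x => (starRingEnd ℂ) (f x)) (2 * k) :=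
    fun k => by rw [hX, fourierCoeff_congr_ae (lift_mem hf').coeFn_toLp, lift_coeff]
  have hYc : ∀ k, fourierCoeff Y k = fourierCoeffPi g (2 * k) :=
    fun k => by rw [hY, fourierCoeff_congr_ae (lift_mem hg).coeFn_toLp, lift_coeff]
  have key := (fourierBasis (T := Real.pi)).hasSum_inner_mul_inner X Y
  have hinner : inner ℂ X Y = fourierCoeffPi (fun x => f x * g x) 0 := by
    have e := lift_coeff (fun x => f x * g x) 0
    rw [mul_zero] at e
    rw [← e, L2.inner_def, fourierCoeff]
    refine integral_congr_ae ?_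
    filter_upwards [(lift_mem hf').coeFn_toLp, (lift_mem hg).coeFn_toLp] with t h1 h2
    rw [h1, h2]
    simp [AddCircle.liftIoc, mul_comm]
  rw [hinner] at key
  refine key.congr_fun fun k => ?_
  rw [← inner_conj_symm, ← HilbertBasis.repr_apply_apply, ← HilbertBasis.repr_apply_apply,
    fourierBasis_repr, fourierBasis_repr, hXc, hYc, fourierCoeffPi_conj]

/-- The Fourier coefficients of a product of two square integrable functions. -/
theorem hasSum_mul_fourierCoeffPi {f g : ℝ → ℂ} (hf : MemLp f 2 intervalMeasure)
    (hg : MemLp g 2 intervalMeasure) (r j : ℤ) :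
    HasSum (fun k : ℤ => fourierCoeffPi f (j - (r + 2 * k)) * fourierCoeffPi g (r + 2 * k))
      (fourierCoeffPi (fun x => f x * g x) j) := by
  have := hasSum_mul_fourierCoeffPi_zero (memLp_mul_exp hf (j - r)) (memLp_mul_exp hg r)
  simp only [fourierCoeffPi_mul_exp] at this
  have e : fourierCoeffPi (fun x => f x * Complex.exp (-(Complex.I * (j - r : ℤ) * x)) *
      (g x * Complex.exp (-(Complex.I * r * x)))) 0 = fourierCoeffPi (fun x => f x * g x) j := by
    conv_rhs => rw [← add_zero j, ← fourierCoeffPi_mul_exp]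
    congr 1
    ext x
    rw [mul_mul_mul_comm, ← Complex.exp_add]
    congr 2
    push_cast; ring
  rw [e] at this
  refine this.congr_fun fun k => ?_
  congr 2; ring

/-! ### Absolutely continuous functions and their Fourier coefficients -/

theorem HasL1Deriv.continuousOn {y g : ℝ → ℂ} (h : HasL1Deriv y g) :
    ContinuousOn y (Set.Icc 0 Real.pi) := by
  have h1 : ContinuousOn (fun x => y 0 + ∫ t in (0 : ℝ)..x, g t) (Set.Icc 0 Real.pi) := by
    refine continuousOn_const.add ?_
    have := intervalIntegral.continuousOn_primitive_interval (μ := volume) (f := g)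
      (a := 0) (b := Real.pi) (by
        rw [Set.uIcc_of_le Real.pi_pos.le]; exact intervalIntegrable_iff_integrable.1 h.1)
    rwa [Set.uIcc_of_le Real.pi_pos.le] at this
  exact h1.congr h.2

theorem memLp_of_continuousOn {y : ℝ → ℂ} (h : ContinuousOn y (Set.Icc 0 Real.pi)) :
    MemLp y 2 intervalMeasure := by
  obtain ⟨C, hC⟩ := isCompact_Icc.exists_bound_of_continuousOn h
  refine MemLp.of_bound (h.aestronglyMeasurable measurableSet_Icc) C ?_
  exact (ae_restrict_mem measurableSet_Icc).mono fun x hx => hC x hx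

theorem memLp_mul_of_continuousOn {y f : ℝ → ℂ} (h : ContinuousOn y (Set.Icc 0 Real.pi))
    (hf : MemLp f 2 intervalMeasure) : MemLp (fun x => f x * y x) 2 intervalMeasure := by
  obtain ⟨C, hC⟩ := isCompact_Icc.exists_bound_of_continuousOn h
  refine MemLp.of_le_mul (c := C) hf (hf.1.mul (h.aestronglyMeasurable measurableSet_Icc)) ?_
  refine (ae_restrict_mem measurableSet_Icc).mono fun x hx => ?_
  rw [norm_mul, mul_comm]
  gcongr
  exact hC x hx

theorem eqOn_zero_of_ae_eq_zero {y : ℝ → ℂ} (h : ContinuousOn y (Set.Icc 0 Real.pi))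
    (h0 : ∀ᵐ x ∂intervalMeasure, y x = 0) : ∀ x ∈ Set.Icc 0 Real.pi, y x = 0 := by
  have := Measure.eqOn_Icc_of_ae_eq volume Real.pi_pos.ne (f := y) (g := fun _ => 0) h0 h
    continuousOn_const
  exact fun x hx => this hx

/-- Integration by parts against an exponential. -/
theorem integral_deriv_mul_exp {y g : ℝ → ℂ} (h : HasL1Deriv y g) (m : ℤ) :
    ∫ x in (0 : ℝ)..Real.pi, g x * Complex.exp (-(Complex.I * m * x)) =
      y Real.pi * Complex.exp (-(Complex.I * m * Real.pi)) - y 0 +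
        Complex.I * m * ∫ x in (0 : ℝ)..Real.pi, y x * Complex.exp (-(Complex.I * m * x)) := by
  set φ : ℝ → ℂ := fun x => Complex.exp (-(Complex.I * m * x)) with hφ
  set ψ : ℝ → ℂ := fun x => -(Complex.I * m) * φ x with hψ
  have hφc : Continuous φ := continuous_exp_I_mul m
  have hψc : Continuous ψ := continuous_const.mul hφc
  have hder : ∀ x, HasDerivAt φ (ψ x) x := by
    intro x
    have h1 : HasDerivAt (fun x : ℝ => -(Complex.I * m * (x : ℂ))) (-(Complex.I * m * 1)) x :=
      ((Complex.ofRealCLM.hasDerivAt (x := x)).const_mul _).neg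
    have := h1.cexp
    simp only [mul_one] at this
    rwa [mul_comm (Complex.exp _)] at this
  have hftc : ∀ a b : ℝ, ∫ x in a..b, ψ x = φ b - φ a := fun a b =>
    intervalIntegral.integral_eq_sub_of_hasDerivAt (fun x _ => hder x) (hψc.intervalIntegrable _ _)
  have hgi := intervalIntegrable_iff_integrable.1 h.1
  set μ := intervalMeasure with hμ
  have hμ' : μ = volume.restrict (Set.Ioc (0 : ℝ) Real.pi) := intervalMeasure_eq_restrict_Ioc
  have hψi : Integrable ψ μ :=
    (hψc.continuousOn (s := Set.Icc 0 Real.pi)).integrableOn_Icc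
  have hpos := Real.pi_pos.le
  -- Fubini's theorem on the triangle `t ≤ x`
  have hprod : Integrable (Function.uncurry fun x t : ℝ =>
      Set.indicator {p : ℝ × ℝ | p.2 ≤ p.1} (fun p => ψ p.1 * g p.2) (x, t)) (μ.prod μ) := by
    have : Integrable (fun p : ℝ × ℝ => ψ p.1 * g p.2) (μ.prod μ) := hψi.mul_prod hgi
    exact this.indicator (measurableSet_le measurable_snd measurable_fst)
  have hswap := integral_integral_swap hprod
  have eL : ∀ᵐ x ∂μ, ∫ t, Set.indicator {p : ℝ × ℝ | p.2 ≤ p.1} (fun p => ψ p.1 * g p.2) (x, t) ∂μ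
      = ψ x * (y x - y 0) := by
    filter_upwards [hμ' ▸ ae_restrict_mem measurableSet_Ioc] with x hx
    rw [h.2 x ⟨hx.1.le, hx.2⟩, add_sub_cancel_left, intervalIntegral.integral_of_le hx.1.le,
      ← integral_const_mul, hμ']
    have e : ∀ t, Set.indicator {p : ℝ × ℝ | p.2 ≤ p.1} (fun p => ψ p.1 * g p.2) (x, t) =
        Set.indicator (Set.Iic x) (fun t => ψ x * g t) t := fun t => by
      simp [Set.indicator]
    simp only [e]
    rw [integral_indicator measurableSet_Iic, Measure.restrict_restrict measurableSet_Iic]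
    congr 2
    ext t
    simp only [Set.mem_inter_iff, Set.mem_Iic, Set.mem_Ioc]
    exact ⟨fun ht => ⟨ht.2.1, ht.1⟩, fun ht => ⟨ht.2, ht.1, ht.2.trans hx.2⟩⟩
  have eR : ∀ᵐ t ∂μ, ∫ x, Set.indicator {p : ℝ × ℝ | p.2 ≤ p.1} (fun p => ψ p.1 * g p.2) (x, t) ∂μ
      = (φ Real.pi - φ t) * g t := by
    filter_upwards [hμ' ▸ ae_restrict_mem measurableSet_Ioc] with t ht
    rw [← hftc, intervalIntegral.integral_of_le ht.2, ← integral_mul_const, hμ']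
    have e : ∀ x, Set.indicator {p : ℝ × ℝ | p.2 ≤ p.1} (fun p => ψ p.1 * g p.2) (x, t) =
        Set.indicator (Set.Ici t) (fun x => ψ x * g t) x := fun x => by
      simp [Set.indicator]
    simp only [e]
    rw [integral_indicator measurableSet_Ici, Measure.restrict_restrict measurableSet_Ici,
      ← setIntegral_congr_set (Ioc_ae_eq_Icc (a := t) (b := Real.pi)).symm]
    congr 2
    ext x
    simp only [Set.mem_inter_iff, Set.mem_Ici, Set.mem_Icc, Set.mem_Ioc]
    exact ⟨fun hx => ⟨hx.1, hx.2.2⟩, fun hx => ⟨hx.1, ht.1.trans_le hx.1, hx.2⟩⟩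
  rw [integral_congr_ae eL, integral_congr_ae eR] at hswap
  have hyi : Integrable y μ := (memLp_of_continuousOn h.continuousOn).integrable (by norm_num)
  have hψy : Integrable (fun x => ψ x * y x) μ :=
    ((integrable_mul_exp hyi m).const_mul (-(Complex.I * m))).congr
      (ae_of_all _ fun x => by simp only [hψ, hφ]; ring)
  have hφg : Integrable (fun x => g x * φ x) μ := integrable_mul_exp hgi m
  have i1 : ∫ x, ψ x * (y x - y 0) ∂μ =
      -(Complex.I * m) * (∫ x, y x * φ x ∂μ) - (φ Real.pi - φ 0) * y 0 := by
    simp only [mul_sub]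
    rw [integral_sub hψy (hψi.mul_const _), integral_mul_const, ← hftc,
      intervalIntegral.integral_of_le hpos, ← integral_const_mul, ← hμ']
    congr 2
    ext x
    simp only [hψ]; ring
  have i2 : ∫ t, (φ Real.pi - φ t) * g t ∂μ = φ Real.pi * (y Real.pi - y 0) -
      ∫ x, g x * φ x ∂μ := by
    simp only [sub_mul]
    rw [integral_sub (hgi.const_mul _) (hφg.congr (ae_of_all _ fun x => mul_comm _ _)),
      integral_const_mul, h.2 Real.pi ⟨hpos, le_rfl⟩, intervalIntegral.integral_of_le hpos, ← hμ']
    congr 1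
    · ring
    · congr 1; ext x; ring
  rw [i1, i2] at hswap
  have hφ0 : φ 0 = 1 := by simp [hφ]
  rw [intervalIntegral.integral_of_le hpos, intervalIntegral.integral_of_le hpos, ← hμ']
  rw [hφ0] at hswap
  linear_combination hswap

/-- For frequencies in the class of `n`, the sign in the boundary condition cancels the value of the
exponential at `π`, so integration by parts leaves no boundary term. -/
theorem exp_neg_I_mul_pi {n j : ℤ} (hj : Even (j - n)) :
    (-1 : ℂ) ^ n * Complex.exp (-(Complex.I * j * Real.pi)) = 1 := by
  have h1 : Complex.exp (-(Complex.I * j * Real.pi)) = (-1 : ℂ) ^ (-j) := by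
    rw [← Complex.exp_pi_mul_I, ← Complex.exp_int_mul]
    congr 1; push_cast; ring
  rw [h1, ← zpow_add₀ (by norm_num)]
  rw [show n + -j = -(j - n) by ring]
  exact Even.neg_one_zpow (even_neg.2 hj)

/-- The Fourier coefficients of a derivative. -/
theorem fourierCoeffPi_deriv {y g : ℝ → ℂ} (h : HasL1Deriv y g) {n j : ℤ} (hj : Even (j - n))
    (hbc : y Real.pi = (-1 : ℂ) ^ n * y 0) :
    fourierCoeffPi g j = Complex.I * j * fourierCoeffPi y j := by
  rw [fourierCoeffPi, fourierCoeffPi, integral_deriv_mul_exp h, hbc]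
  linear_combination (Real.pi : ℂ)⁻¹ * y 0 * exp_neg_I_mul_pi hj

/-- A square integrable function whose Fourier coefficients are those of an antiderivative of `h`
is almost everywhere equal to such an antiderivative. -/
theorem exists_hasL1Deriv {f h : ℝ → ℂ} (hf : MemLp f 2 intervalMeasure)
    (hh : Integrable h intervalMeasure) {n : ℤ}
    (hcoef : ∀ j, Even (j - n) → fourierCoeffPi h j = Complex.I * j * fourierCoeffPi f j) :
    ∃ u : ℝ → ℂ, HasL1Deriv u h ∧ (∀ᵐ x ∂intervalMeasure, u x = f x) ∧
      u Real.pi = (-1 : ℂ) ^ n * u 0 := by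
  set H : ℝ → ℂ := fun x => ∫ t in (0 : ℝ)..x, h t with hH
  have hD : ∀ C : ℂ, HasL1Deriv (fun x => C + H x) h := fun C =>
    ⟨intervalIntegrable_iff_integrable.2 hh, fun x _ => by simp [hH]⟩
  have hH0 : H 0 = 0 := by simp [hH]
  -- For even `n` the assumption at frequency `0` says that `h` has mean zero, so every constant
  -- gives a periodic function and `C` is fixed by the mean of `f`. For odd `n` the frequency `0` is
  -- not in the class, and antiperiodicity determines `C`.
  obtain ⟨C, hbc, h0⟩ : ∃ C : ℂ, C + H Real.pi = (-1 : ℂ) ^ n * C ∧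
      (Even n → fourierCoeffPi (fun x => C + H x) 0 = fourierCoeffPi f 0) := by
    rcases Int.even_or_odd n with hn | hn
    · have hHpi : H Real.pi = 0 := by
        have := hcoef 0 (by simpa using hn.neg)
        simpa [fourierCoeffPi, Real.pi_ne_zero] using this
      refine ⟨fourierCoeffPi f 0 - fourierCoeffPi H 0, by rw [hn.neg_one_zpow, hHpi]; ring,
        fun _ => ?_⟩
      have hHi : Integrable H intervalMeasure := by
        have := (memLp_of_continuousOn (hD 0).continuousOn).integrable (by norm_num)
        simpa using this
      rw [fourierCoeffPi_add (integrable_const _) hHi]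
      have hc : ∀ c : ℂ, fourierCoeffPi (fun _ => c) 0 = c := fun c => by
        simp [fourierCoeffPi, Real.pi_ne_zero]
      rw [hc]; ring
    · refine ⟨-H Real.pi / 2, by rw [hn.neg_one_zpow]; ring, fun he => ?_⟩
      exact absurd he (Int.not_even_iff_odd.2 hn)
  have hbc' : (fun x => C + H x) Real.pi = (-1 : ℂ) ^ n * (fun x => C + H x) 0 := by
    simp only [hH0, add_zero, hbc]
  refine ⟨fun x => C + H x, hD C, ?_, hbc'⟩
  have hu := memLp_of_continuousOn (hD C).continuousOn
  have hz : ∀ᵐ x ∂intervalMeasure, (C + H x) - f x = 0 := by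
    refine ae_eq_zero_of_fourierCoeffPi (hu.sub hf) n fun k => ?_
    have hj : Even (n + 2 * k - n) := by simp
    change fourierCoeffPi (fun x => (C + H x) - f x) _ = 0
    rw [fourierCoeffPi_sub (hu.integrable (by norm_num)) (hf.integrable (by norm_num)), sub_eq_zero]
    rcases eq_or_ne (n + 2 * k) 0 with hz | hz
    · rw [hz]
      exact h0 (by rw [show n = -(2 * k) by omega]; simp)
    · have e := (fourierCoeffPi_deriv (hD C) hj hbc').symm.trans (hcoef _ hj)
      refine mul_left_cancel₀ (mul_ne_zero Complex.I_ne_zero ?_) e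
      exact_mod_cast hz
  exact hz.mono fun x hx => sub_eq_zero.1 hx

/-! ### Lattice sums -/

/-- `1 / |s|`, with the value `0` at `s = 0`. -/
noncomputable def invAbs (s : ℤ) : ℝ := |(s : ℝ)|⁻¹

theorem invAbs_nonneg (s : ℤ) : 0 ≤ invAbs s := inv_nonneg.2 (abs_nonneg _)

@[simp] theorem invAbs_zero : invAbs 0 = 0 := by simp [invAbs]

theorem invAbs_neg (s : ℤ) : invAbs (-s) = invAbs s := by simp [invAbs]

theorem one_le_abs_cast {s : ℤ} (hs : s ≠ 0) : (1 : ℝ) ≤ |(s : ℝ)| := by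
  exact_mod_cast Int.one_le_abs hs

theorem invAbs_le_one (s : ℤ) : invAbs s ≤ 1 := by
  rcases eq_or_ne s 0 with rfl | hs
  · simp
  · exact inv_le_one_of_one_le₀ (one_le_abs_cast hs)

theorem abs_mul_invAbs_le (s : ℤ) : |(s : ℝ)| * invAbs s ≤ 1 := by
  rcases eq_or_ne s 0 with rfl | hs
  · simp
  · rw [invAbs, mul_inv_cancel₀ (by linarith [one_le_abs_cast hs])]

/-- This is `|x - y| / (|x| |y|) ≤ 1/|x| + 1/|y|`, valid also with the convention `invAbs 0 = 0`. It
absorbs one factor of the growth of the Hill coefficients. -/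
theorem abs_sub_mul_invAbs_le (x y : ℤ) :
    |((x - y : ℤ) : ℝ)| * (invAbs x * invAbs y) ≤ invAbs x + invAbs y := by
  have h1 : |((x - y : ℤ) : ℝ)| ≤ |(x : ℝ)| + |(y : ℝ)| := by push_cast; exact abs_sub _ _
  have hx := invAbs_nonneg x
  have hy := invAbs_nonneg y
  have h2 := mul_le_mul_of_nonneg_right (abs_mul_invAbs_le x) hy
  have h3 := mul_le_mul_of_nonneg_right (abs_mul_invAbs_le y) hx
  have h4 := mul_le_mul_of_nonneg_right h1 (mul_nonneg hx hy)
  nlinarith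

theorem tendsto_invAbs : Tendsto invAbs cofinite (𝓝 0) := by
  have h1 : Tendsto (fun s : ℤ => |(s : ℝ)|) cofinite atTop :=
    (tendsto_norm_cocompact_atTop (E := ℝ)).comp Int.tendsto_coe_cofinite
  exact tendsto_inv_atTop_zero.comp h1

theorem summable_invAbs_sq : Summable fun s : ℤ => invAbs s ^ 2 := by
  refine (Real.summable_abs_int_rpow (b := 2) (by norm_num)).congr fun s => ?_
  rw [Real.rpow_neg (abs_nonneg _), invAbs, inv_pow]
  simp

theorem summable_invAbs_mul_sqrt : Summable fun s : ℤ => invAbs s * √(invAbs s) := by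
  refine (Real.summable_abs_int_rpow (b := 3 / 2) (by norm_num)).congr fun s => ?_
  rcases eq_or_ne s 0 with rfl | hs
  · simp [Real.zero_rpow]
  · have hs0 : 0 < |(s : ℝ)| := by linarith [one_le_abs_cast hs]
    rw [invAbs, Real.sqrt_eq_rpow, ← Real.rpow_neg_one, ← Real.rpow_mul hs0.le,
      ← Real.rpow_add hs0]
    norm_num

theorem summable_invAbs_conv (p q : ℤ) :
    Summable fun s : ℤ => invAbs (p - s) * invAbs (q + s) := by
  have h1 : Summable fun s : ℤ => invAbs (p - s) ^ 2 :=
    (Equiv.subLeft p).summable_iff (f := fun s : ℤ => invAbs s ^ 2) |>.2 summable_invAbs_sq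
  have h2 : Summable fun s : ℤ => invAbs (q + s) ^ 2 :=
    (Equiv.addLeft q).summable_iff (f := fun s : ℤ => invAbs s ^ 2) |>.2 summable_invAbs_sq
  exact (summable_mul_and_tsum_le_sqrt (fun s => invAbs_nonneg _) (fun s => invAbs_nonneg _)
    h1 h2).1

/-- `∑_{s + t = u} 1 / (|s| |t|)`. -/
noncomputable def invConv (u : ℤ) : ℝ := ∑' s : ℤ, invAbs s * invAbs (u - s)

theorem tsum_invAbs_conv (p q : ℤ) :
    ∑' s : ℤ, invAbs (p - s) * invAbs (q + s) = invConv (p + q) := by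
  rw [invConv, ← (Equiv.subLeft p).tsum_eq]
  refine tsum_congr fun s => ?_
  simp only [Equiv.subLeft_apply]
  congr 2 <;> ring

theorem invConv_nonneg (u : ℤ) : 0 ≤ invConv u :=
  tsum_nonneg fun _ => mul_nonneg (invAbs_nonneg _) (invAbs_nonneg _)

/-- The larger summand satisfies `|t| ≥ |u|/2`. Half of its decay is spent on `|u|^{-1/2}`; the
other half is bounded by `|s|^{-1/2}`, leaving the summable `|s|^{-3/2}`. -/
theorem invAbs_mul_le_aux {u s t : ℤ} (hu : u ≠ 0) (hst : s + t = u) (hs : s ≠ 0) (ht : t ≠ 0)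
    (h : |(s : ℝ)| ≤ |(t : ℝ)|) :
    invAbs s * invAbs t ≤ 2 * √(invAbs u) * (invAbs s * √(invAbs s)) := by
  have hs1 := one_le_abs_cast hs
  have ht1 := one_le_abs_cast ht
  have hu1 := one_le_abs_cast hu
  have h1 : invAbs t ≤ invAbs s := inv_anti₀ (by linarith) h
  have h2 : |(u : ℝ)| ≤ 2 * |(t : ℝ)| := by
    have : |(u : ℝ)| ≤ |(s : ℝ)| + |(t : ℝ)| := by rw [← hst]; push_cast; exact abs_add_le _ _
    linarith
  have h3 : invAbs t ≤ 4 * invAbs u := by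
    unfold invAbs
    rw [inv_le_comm₀ (by linarith) (by positivity), mul_inv, inv_inv]
    linarith
  have h4 : √(invAbs t) ≤ 2 * √(invAbs u) := by
    rw [show (2 : ℝ) = √4 by rw [show (4 : ℝ) = 2 ^ 2 by norm_num]; simp,
      ← Real.sqrt_mul (by norm_num)]
    exact Real.sqrt_le_sqrt h3
  have h5 : √(invAbs t) ≤ √(invAbs s) := Real.sqrt_le_sqrt h1
  have h6 : invAbs t = √(invAbs t) * √(invAbs t) := (Real.mul_self_sqrt (invAbs_nonneg t)).symm
  rw [h6]
  have h7 := mul_le_mul h4 h5 (Real.sqrt_nonneg _) (by positivity)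
  have := mul_le_mul_of_nonneg_left h7 (invAbs_nonneg s)
  linarith

theorem invAbs_mul_le {u : ℤ} (hu : u ≠ 0) (s : ℤ) :
    invAbs s * invAbs (u - s) ≤
      2 * √(invAbs u) * (invAbs s * √(invAbs s) + invAbs (u - s) * √(invAbs (u - s))) := by
  have hpos : ∀ t, 0 ≤ 2 * √(invAbs u) * (invAbs t * √(invAbs t)) := fun t =>
    mul_nonneg (by positivity) (mul_nonneg (invAbs_nonneg t) (Real.sqrt_nonneg _))
  rw [mul_add]
  by_cases hs : s = 0
  · rw [hs, invAbs_zero, zero_mul]; linarith [hpos 0, hpos (u - 0)]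
  by_cases ht : u - s = 0
  · rw [ht, invAbs_zero, mul_zero]; linarith [hpos 0, hpos s]
  rcases le_total |(s : ℝ)| |((u - s : ℤ) : ℝ)| with h | h
  · linarith [invAbs_mul_le_aux hu (by ring : s + (u - s) = u) hs ht h, hpos (u - s)]
  · linarith [invAbs_mul_le_aux hu (by ring : (u - s) + s = u) ht hs h, hpos s]

theorem exists_invConv_le : ∃ C : ℝ, ∀ u : ℤ, u ≠ 0 → invConv u ≤ C * √(invAbs u) := by
  refine ⟨4 * ∑' s : ℤ, invAbs s * √(invAbs s), fun u hu => ?_⟩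
  have hs1 := summable_invAbs_mul_sqrt
  have hs2 : Summable fun s : ℤ => invAbs (u - s) * √(invAbs (u - s)) :=
    (Equiv.subLeft u).summable_iff (f := fun s : ℤ => invAbs s * √(invAbs s)) |>.2 hs1
  have e : ∑' s : ℤ, invAbs (u - s) * √(invAbs (u - s)) = ∑' s : ℤ, invAbs s * √(invAbs s) :=
    (Equiv.subLeft u).tsum_eq fun s => invAbs s * √(invAbs s)
  have hs3 := (hs1.add hs2).mul_left (2 * √(invAbs u))
  have hs0 : Summable fun s : ℤ => invAbs s * invAbs (u - s) :=
    Summable.of_nonneg_of_le (fun s => mul_nonneg (invAbs_nonneg _) (invAbs_nonneg _))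
      (invAbs_mul_le hu) hs3
  refine (hs0.tsum_le_tsum (invAbs_mul_le hu) hs3).trans (le_of_eq ?_)
  rw [tsum_mul_left, hs1.tsum_add hs2, e]
  ring

theorem tendsto_invConv : Tendsto invConv cofinite (𝓝 0) := by
  obtain ⟨C, hC⟩ := exists_invConv_le
  have h1 : Tendsto (fun u => C * √(invAbs u)) cofinite (𝓝 0) := by
    have := (tendsto_invAbs.sqrt).const_mul C
    simpa using this
  refine squeeze_zero' (Eventually.of_forall invConv_nonneg) ?_ h1
  filter_upwards [(Set.finite_singleton (0 : ℤ)).compl_mem_cofinite] with u hu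
  exact hC u hu

theorem exists_invConv_bound : ∃ C : ℝ, ∀ u : ℤ, invConv u ≤ C := by
  obtain ⟨C, hC⟩ := exists_invConv_le
  refine ⟨max |C| (invConv 0), fun u => ?_⟩
  rcases eq_or_ne u 0 with rfl | hu
  · exact le_max_right _ _
  · refine ((hC u hu).trans ?_).trans (le_max_left _ _)
    have h1 : √(invAbs u) ≤ 1 := Real.sqrt_le_one.2 (invAbs_le_one u)
    calc C * √(invAbs u) ≤ |C| * √(invAbs u) := by gcongr; exact le_abs_self C
      _ ≤ |C| * 1 := by gcongr
      _ = |C| := mul_one _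

theorem tendsto_two_mul_add (m : ℤ) : Tendsto (fun n : ℤ => 2 * n + m) cofinite cofinite :=
  Function.Injective.tendsto_cofinite fun a b h => by simpa using h

theorem tendsto_two_mul_sub (m : ℤ) : Tendsto (fun n : ℤ => 2 * n - m) cofinite cofinite :=
  Function.Injective.tendsto_cofinite fun a b h => by simpa using h

/-- Tannery's theorem for weighted sums. -/
theorem tendsto_weighted_tsum {κ : Type*} {l : Filter ℤ} {w : κ → ℝ} (hw : Summable w)
    (hw0 : ∀ m, 0 ≤ w m) {G : ℤ → κ → ℝ} {C : ℝ} (hG0 : ∀ n m, 0 ≤ G n m)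
    (hGC : ∀ n m, G n m ≤ C) (hG : ∀ m, Tendsto (fun n => G n m) l (𝓝 0)) :
    Tendsto (fun n => ∑' m, w m * G n m) l (𝓝 0) := by
  have := tendsto_tsum_of_dominated_convergence (𝓕 := l) (f := fun n m => w m * G n m)
    (g := fun _ => (0 : ℝ)) (hw.mul_right C)
    (fun m => by simpa using (hG m).const_mul (w m))
    (Eventually.of_forall fun n m => by
      rw [Real.norm_of_nonneg (mul_nonneg (hw0 m) (hG0 n m))]
      exact mul_le_mul_of_nonneg_left (hGC n m) (hw0 m))
  simpa using this

theorem summable_weighted {κ : Type*} {w : κ → ℝ} (hw : Summable w) (hw0 : ∀ m, 0 ≤ w m)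
    {G : κ → ℝ} {C : ℝ} (hG0 : ∀ m, 0 ≤ G m) (hGC : ∀ m, G m ≤ C) :
    Summable fun m => w m * G m :=
  Summable.of_nonneg_of_le (fun m => mul_nonneg (hw0 m) (hG0 m))
    (fun m => mul_le_mul_of_nonneg_left (hGC m) (hw0 m)) (hw.mul_right C)

/-- A double sum, dominated after a change of variables. -/
theorem summable_and_tsum_le_of_equiv {κ κ' ι : Type*} {F : ι × ι → ℝ} (hF : ∀ p, 0 ≤ F p)
    (e : κ × κ' ≃ ι × ι) {w : κ → ℝ} {g : κ → κ' → ℝ} (hle : ∀ m j, F (e (m, j)) ≤ w m * g m j)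
    (hg : ∀ m, Summable (g m)) (hwg : Summable fun m => w m * ∑' j, g m j) :
    Summable F ∧ ∑' p, F p ≤ ∑' m, w m * ∑' j, g m j := by
  have hrow : ∀ m, Summable fun j => F (e (m, j)) := fun m =>
    Summable.of_nonneg_of_le (fun j => hF _) (hle m) ((hg m).mul_left _)
  have hrow_le : ∀ m, ∑' j, F (e (m, j)) ≤ w m * ∑' j, g m j := fun m => by
    rw [← tsum_mul_left]
    exact (hrow m).tsum_le_tsum (hle m) ((hg m).mul_left _)
  have hs1 : Summable fun m => ∑' j, F (e (m, j)) :=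
    Summable.of_nonneg_of_le (fun m => tsum_nonneg fun j => hF _) hrow_le hwg
  have hs : Summable (F ∘ e) := (summable_prod_of_nonneg fun p => hF _).2 ⟨hrow, hs1⟩
  refine ⟨e.summable_iff.1 hs, ?_⟩
  have hprod : ∑' p, F (e p) = ∑' m, ∑' j, F (e (m, j)) := hs.tsum_prod
  rw [← e.tsum_eq, hprod]
  exact hs1.tsum_le_tsum hrow_le hwg

/-! ### Hypotheses for the two-dimensional reduction -/

theorem HSBound.of_prod {ι : Type} {V : ι → ι → ℂ} {D : ι → ℝ} {θ : ℝ} (hD : ∀ j, 0 ≤ D j)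
    (hθ : 0 ≤ θ) (hθ1 : θ < 1) (hs : Summable fun p : ι × ι => D p.1 * (D p.2 * ‖V p.1 p.2‖ ^ 2))
    (hle : ∑' p : ι × ι, D p.1 * (D p.2 * ‖V p.1 p.2‖ ^ 2) ≤ θ ^ 2) : HSBound V D θ where
  weight_nonneg := hD
  theta_nonneg := hθ
  theta_lt_one := hθ1
  row j hj := (summable_mul_left_iff hj).1 (hs.prod_factor j)
  summable := hs.prod.congr fun j => by rw [energy, ← tsum_mul_left]
  tsum_le := by
    rw [hs.tsum_prod] at hle
    refine le_trans (le_of_eq (tsum_congr fun j => ?_)) hle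
    rw [energy, ← tsum_mul_left]

/-- The assumptions under which the reduction to the span of `e_a, e_b` is possible and the
reduced matrix is `O(ε R)`. -/
structure ReducedSetup {ι : Type} (V : ι → ι → ℂ) (D : ι → ℝ) (a b : ι) (ε R : ℝ) : Prop where
  hs : HSBound V D (1 / 2)
  ne : a ≠ b
  weight_left : D a = 0
  weight_right : D b = 0
  row : ∀ x, x = a ∨ x = b → WSummable D (V x) ∧ energy D (V x) ≤ ε * R
  col : ∀ x, x = a ∨ x = b → (WSummable D fun j => V j x) ∧ energy D (fun j => V j x) ≤ ε * R
  entry : ∀ x y, (x = a ∨ x = b) → (y = a ∨ y = b) → ‖V x y‖ ≤ ε * R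

namespace ReducedSetup

variable {ι : Type} {V : ι → ι → ℂ} {D : ι → ℝ} {a b : ι} {ε R : ℝ}

/-- One `ε R` from the entry of `V` itself, and `2 ε R` from the Neumann tail, where the ratio `1/2`
contributes the factor `2`. -/
theorem norm_reducedEntry_le (h : ReducedSetup V D a b ε R) {d : ι → ℂ}
    (hd : ∀ j, ‖d j‖ ≤ D j) {x y : ι} (hx : x = a ∨ x = b) (hy : y = a ∨ y = b) :
    ‖reducedEntry V d x y‖ ≤ 3 * (ε * R) := by
  have h1 := h.hs.norm_reducedEntry_sub_le hd (h.col y hy).1 (h.row x hx).1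
  have h0 : 0 ≤ ε * R := (norm_nonneg _).trans (h.entry x y hx hy)
  have h2 : √(energy D (V x)) * √(energy D fun j => V j y) ≤ √(ε * R) * √(ε * R) := by
    gcongr
    · exact (h.row x hx).2
    · exact (h.col y hy).2
  rw [Real.mul_self_sqrt h0] at h2
  have h3 := h.entry x y hx hy
  have h4 : ‖reducedEntry V d x y‖ ≤ ‖reducedEntry V d x y - V x y‖ + ‖V x y‖ := by
    simpa using norm_add_le (reducedEntry V d x y - V x y) (V x y)
  norm_num at h1
  linarith

theorem smallTriple (h : ReducedSetup V D a b ε R) {r δ : ℝ} (hr : 0 < r)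
    (hδ : 3 * (ε * R) ≤ δ * r) {d : ℂ → ι → ℂ}
    (hd : ∀ z ∈ Metric.ball (0 : ℂ) r, ∀ j, ‖d z j‖ ≤ D j)
    (hdiff : ∀ j, DifferentiableOn ℂ (fun z => d z j) (Metric.ball 0 r)) :
    SmallTriple r δ (fun z => reducedEntry V (d z) a a) (fun z => reducedEntry V (d z) a b)
      (fun z => reducedEntry V (d z) b a) := by
  have hD : ∀ x y, (x = a ∨ x = b) → (y = a ∨ y = b) →
      DifferentiableOn ℂ (fun z => reducedEntry V (d z) x y) (Metric.ball 0 r) :=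
    fun x y hx hy => h.hs.differentiableOn_reducedEntry Metric.isOpen_ball hd hdiff
      (h.col y hy).1 (h.row x hx).1
  have hB : ∀ x y, (x = a ∨ x = b) → (y = a ∨ y = b) → ∀ z ∈ Metric.ball (0 : ℂ) r,
      ‖reducedEntry V (d z) x y‖ ≤ δ * r :=
    fun x y hx hy z hz => (h.norm_reducedEntry_le (hd z hz) hx hy).trans hδ
  exact ⟨hr, hD _ _ (.inl rfl) (.inl rfl), hD _ _ (.inl rfl) (.inr rfl),
    hD _ _ (.inr rfl) (.inl rfl), hB _ _ (.inl rfl) (.inl rfl), hB _ _ (.inl rfl) (.inr rfl),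
    hB _ _ (.inr rfl) (.inl rfl)⟩

theorem reducedEntry_diag_eq (h : ReducedSetup V D a b ε R) {d : ι → ℂ}
    (hd : ∀ j, ‖d j‖ ≤ D j) (τ : ι ≃ ι) (hV : ∀ i j, V (τ i) (τ j) = V j i)
    (hDτ : ∀ j, D (τ j) = D j) (hdτ : ∀ j, d (τ j) = d j) (hτ : τ a = b) :
    reducedEntry V d b b = reducedEntry V d a a := by
  have := h.hs.reducedEntry_symm (a := a) (b := a) hd τ hV hDτ hdτ (h.row a (.inl rfl)).1
    (h.col a (.inl rfl)).1 (h.col _ (.inr hτ)).1 (h.row _ (.inr hτ)).1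
  rwa [hτ] at this

end ReducedSetup

theorem summable_ite_even {f : ℝ → ℂ} (hf : MemLp f 2 intervalMeasure) :
    Summable fun m : ℤ => if Even m then ‖fourierCoeffPi f m‖ ^ 2 else 0 := by
  have hinj : Function.Injective fun k : ℤ => 2 * k := fun a b h => by simpa using h
  rw [← hinj.summable_iff]
  · have := (hasSum_sq_fourierCoeffPi hf 0).summable
    simp only [zero_add] at this
    exact this.congr fun k => by simp
  · intro m hm
    rw [if_neg]
    rintro ⟨k, rfl⟩
    exact hm ⟨k, by simp; ring⟩

/-! ### The Hill matrix -/

/-- A majorant of the reduced resolvent of `-d²/dx²`. -/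
noncomputable def hillWeight (n j : ℤ) : ℝ :=
  if Even (j - n) then 2 * (invAbs (n - j) * invAbs (n + j)) else 0

theorem hillWeight_nonneg (n j : ℤ) : 0 ≤ hillWeight n j := by
  unfold hillWeight
  split_ifs
  · exact mul_nonneg two_pos.le (mul_nonneg (invAbs_nonneg _) (invAbs_nonneg _))
  · exact le_rfl

theorem hillWeight_le (n j : ℤ) : hillWeight n j ≤ 2 * (invAbs (n - j) * invAbs (n + j)) := by
  unfold hillWeight
  split_ifs
  · exact le_rfl
  · exact mul_nonneg two_pos.le (mul_nonneg (invAbs_nonneg _) (invAbs_nonneg _))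

theorem hillWeight_neg (n j : ℤ) : hillWeight n (-j) = hillWeight n j := by
  have : Even (-j - n) ↔ Even (j - n) := by simp [Int.even_sub]
  simp only [hillWeight, this]
  rw [sub_neg_eq_add, ← sub_eq_add_neg, mul_comm (invAbs (n + j))]

theorem hillWeight_self (n : ℤ) : hillWeight n n = 0 := by simp [hillWeight]

theorem hillWeight_neg_self (n : ℤ) : hillWeight n (-n) = 0 := by
  rw [hillWeight_neg, hillWeight_self]

/-- Two numbers that are at least `1` and have sum at least `2n` have product at least `2n - 1 ≥ n`.
Hence `|z| < n/4` costs at most half of the denominator, which is the factor `2` in `hillWeight`. -/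
theorem abs_sq_sub_sq_ge {n j : ℤ} (hn : 0 < n) (h1 : j ≠ n) (h2 : j ≠ -n) :
    (n : ℝ) ≤ |((n - j : ℤ) : ℝ)| * |((n + j : ℤ) : ℝ)| := by
  have e1 := one_le_abs_cast (sub_ne_zero.2 h1.symm)
  have e2 := one_le_abs_cast (s := n + j) (by omega)
  have e3 : (2 * n : ℝ) ≤ |((n - j : ℤ) : ℝ)| + |((n + j : ℤ) : ℝ)| := by
    refine le_trans (le_of_eq ?_) ((le_abs_self _).trans (abs_add_le _ _))
    push_cast; ring
  have e4 : (1 : ℝ) ≤ n := by exact_mod_cast hn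
  nlinarith [mul_nonneg (sub_nonneg.2 e1) (sub_nonneg.2 e2)]

theorem hillDenominator_ge {n j : ℤ} (hn : 0 < n) (h1 : j ≠ n) (h2 : j ≠ -n) {z : ℂ}
    (hz : ‖z‖ < n / 4) :
    |((n - j : ℤ) : ℝ)| * |((n + j : ℤ) : ℝ)| / 2 ≤ ‖(n : ℂ) ^ 2 - (j : ℂ) ^ 2 + z‖ := by
  have e := abs_sq_sub_sq_ge hn h1 h2
  have e1 : ‖(n : ℂ) ^ 2 - (j : ℂ) ^ 2‖ = |((n - j : ℤ) : ℝ)| * |((n + j : ℤ) : ℝ)| := by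
    rw [← abs_mul, ← Real.norm_eq_abs, ← Complex.norm_real]
    congr 1; push_cast; ring
  have e2 : ‖(n : ℂ) ^ 2 - (j : ℂ) ^ 2‖ ≤ ‖(n : ℂ) ^ 2 - (j : ℂ) ^ 2 + z‖ + ‖z‖ := by
    have := norm_sub_le ((n : ℂ) ^ 2 - (j : ℂ) ^ 2 + z) z
    rwa [add_sub_cancel_right] at this
  have : (1 : ℝ) ≤ n := by exact_mod_cast hn
  linarith

theorem hillDenominator_pos {n j : ℤ} (hn : 0 < n) (h1 : j ≠ n) (h2 : j ≠ -n) :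
    0 < |((n - j : ℤ) : ℝ)| * |((n + j : ℤ) : ℝ)| / 2 := by
  have := abs_sq_sub_sq_ge hn h1 h2
  have : (1 : ℝ) ≤ n := by exact_mod_cast hn
  linarith

theorem norm_hillDiag_le {n : ℤ} (hn : 0 < n) {z : ℂ} (hz : ‖z‖ < n / 4) (j : ℤ) :
    ‖hillDiag n z j‖ ≤ hillWeight n j := by
  unfold hillDiag
  split_ifs with h
  · rw [hillWeight, if_pos h.1, norm_inv]
    refine (inv_anti₀ (hillDenominator_pos hn h.2.1 h.2.2)
      (hillDenominator_ge hn h.2.1 h.2.2 hz)).trans (le_of_eq ?_)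
    rw [invAbs, invAbs, inv_div, ← mul_inv, div_eq_mul_inv]
  · simpa using hillWeight_nonneg n j

theorem hillDenominator_ne_zero {n j : ℤ} (hn : 0 < n) (h1 : j ≠ n) (h2 : j ≠ -n) {z : ℂ}
    (hz : ‖z‖ < n / 4) : (n : ℂ) ^ 2 - (j : ℂ) ^ 2 + z ≠ 0 :=
  norm_pos_iff.1 ((hillDenominator_pos hn h1 h2).trans_le (hillDenominator_ge hn h1 h2 hz))

theorem differentiableOn_hillDiag {n : ℤ} (hn : 0 < n) (j : ℤ) :
    DifferentiableOn ℂ (fun z => hillDiag n z j) (Metric.ball 0 ((n : ℝ) / 4)) := by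
  unfold hillDiag
  split_ifs with h
  · refine DifferentiableOn.inv (by fun_prop) fun z hz => ?_
    exact hillDenominator_ne_zero hn h.2.1 h.2.2 (by simpa using hz)
  · exact differentiableOn_const _

/-- The squared coefficients of `Q` at the even frequencies, with `‖c‖²` at `0`. -/
noncomputable def hillSq (c : ℂ) (Q : ℝ → ℂ) (m : ℤ) : ℝ :=
  if Even m then (if m = 0 then ‖c‖ ^ 2 else ‖fourierCoeffPi Q m‖ ^ 2) else 0

theorem hillSq_nonneg (c : ℂ) (Q : ℝ → ℂ) (m : ℤ) : 0 ≤ hillSq c Q m := by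
  unfold hillSq
  split_ifs <;> positivity

theorem summable_hillSq (c : ℂ) {Q : ℝ → ℂ} (hQ : MemLp Q 2 intervalMeasure) :
    Summable (hillSq c Q) := by
  have h1 := summable_ite_even hQ
  have h2 : Summable fun m : ℤ => if m = 0 then ‖c‖ ^ 2 else 0 :=
    (hasSum_ite_eq (0 : ℤ) (‖c‖ ^ 2)).summable
  refine Summable.of_nonneg_of_le (hillSq_nonneg c Q) (fun m => ?_) (h1.add h2)
  unfold hillSq
  split_ifs with h3 h4
  · have := sq_nonneg ‖fourierCoeffPi Q m‖
    linarith
  · simp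
  · positivity
  · simp

theorem norm_hillCoeff_sq (c : ℂ) (Q : ℝ → ℂ) {m : ℤ} (hm : Even m) :
    ‖hillCoeff c Q m‖ ^ 2 = (if m = 0 then 1 else |(m : ℝ)| ^ 2) * hillSq c Q m := by
  unfold hillCoeff hillSq
  rw [if_pos hm]
  split_ifs with h
  · simp
  · rw [norm_mul, norm_mul, Complex.norm_I, one_mul, mul_pow]
    simp

/-- The entry contributes `|j - k|²`. Since `j - k` is both `(n - k) - (n - j)` and `(n + j) - (n +
k)`, one factor is absorbed by the weights at distance from `n`, the other by those at distance from
`-n`. On the diagonal the coefficient is `c` and there is nothing to absorb. -/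
theorem hill_kernel_le (c : ℂ) (Q : ℝ → ℂ) (n j k : ℤ) :
    hillWeight n j * (hillWeight n k * ‖hillMatrix c Q j k‖ ^ 2) ≤
      hillSq c Q (j - k) * (4 * ((invAbs (n - k) + invAbs (n - j)) *
        (invAbs (n + k) + invAbs (n + j)))) := by
  have hw := hillSq_nonneg c Q (j - k)
  have p1 := invAbs_nonneg (n - k)
  have p2 := invAbs_nonneg (n - j)
  have p3 := invAbs_nonneg (n + k)
  have p4 := invAbs_nonneg (n + j)
  by_cases hj : Even (j - n)
  swap
  · rw [hillWeight, if_neg hj, zero_mul]; positivity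
  by_cases hk : Even (k - n)
  swap
  · rw [hillWeight, hillWeight, if_neg hk, zero_mul, mul_zero]; positivity
  have hm : Even (j - k) := by
    have := hj.sub hk
    rwa [sub_sub_sub_cancel_right] at this
  rw [hillWeight, hillWeight, if_pos hj, if_pos hk, hillMatrix, norm_hillCoeff_sq c Q hm]
  have key : (invAbs (n - j) * invAbs (n + j)) * (invAbs (n - k) * invAbs (n + k)) *
      (if j - k = 0 then 1 else |((j - k : ℤ) : ℝ)| ^ 2) ≤
      (invAbs (n - k) + invAbs (n - j)) * (invAbs (n + k) + invAbs (n + j)) := by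
    split_ifs with h0
    · rw [mul_one]
      have q1 : invAbs (n - j) * invAbs (n - k) ≤ invAbs (n - k) + invAbs (n - j) := by
        nlinarith [invAbs_le_one (n - j)]
      have q2 : invAbs (n + j) * invAbs (n + k) ≤ invAbs (n + k) + invAbs (n + j) := by
        nlinarith [invAbs_le_one (n + j)]
      calc _ = (invAbs (n - j) * invAbs (n - k)) * (invAbs (n + j) * invAbs (n + k)) := by ring
        _ ≤ _ := by gcongr
    · have q1 := abs_sub_mul_invAbs_le (n - k) (n - j)
      have q2 := abs_sub_mul_invAbs_le (n + j) (n + k)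
      rw [show n - k - (n - j) = j - k by ring] at q1
      rw [show n + j - (n + k) = j - k by ring] at q2
      calc _ = (|((j - k : ℤ) : ℝ)| * (invAbs (n - k) * invAbs (n - j))) *
            (|((j - k : ℤ) : ℝ)| * (invAbs (n + j) * invAbs (n + k))) := by ring
        _ ≤ (invAbs (n - k) + invAbs (n - j)) * (invAbs (n + j) + invAbs (n + k)) := by gcongr
        _ = _ := by ring
  have := mul_le_mul_of_nonneg_left key hw
  linarith

/-- The change of variables `(m, j) ↦ (j, j - m)`. -/
def subEquiv : ℤ × ℤ ≃ ℤ × ℤ where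
  toFun p := (p.2, p.2 - p.1)
  invFun p := (p.1 - p.2, p.1)
  left_inv p := by simp
  right_inv p := by simp

/-- Sum first along the diagonals `j - k = m`. Expanding the product in the kernel bound yields four
convolutions of `1/|s|`, at `2n + m`, `2n - m` and twice at `2n`, all tending to `0` for fixed `m`.
-/
theorem hill_summable_and_tsum_le (c : ℂ) {Q : ℝ → ℂ} (hQ : MemLp Q 2 intervalMeasure) (n : ℤ) :
    (Summable fun p : ℤ × ℤ =>
      hillWeight n p.1 * (hillWeight n p.2 * ‖hillMatrix c Q p.1 p.2‖ ^ 2)) ∧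
    ∑' p : ℤ × ℤ, hillWeight n p.1 * (hillWeight n p.2 * ‖hillMatrix c Q p.1 p.2‖ ^ 2) ≤
      ∑' m, hillSq c Q m * (4 * (invConv (2 * n + m) + invConv (2 * n - m) +
        2 * invConv (2 * n))) := by
  set g : ℤ → ℤ → ℝ := fun m j => 4 * (invAbs (n + m - j) * invAbs (n + j) +
    invAbs (n - j) * invAbs (n - m + j) +
    (invAbs (n + m - j) * invAbs (n - m + j) + invAbs (n - j) * invAbs (n + j))) with hg
  have hgs : ∀ m, HasSum (g m) (4 * (invConv (2 * n + m) + invConv (2 * n - m) +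
      2 * invConv (2 * n))) := by
    intro m
    have e : ∀ p q : ℤ, HasSum (fun s : ℤ => invAbs (p - s) * invAbs (q + s)) (invConv (p + q)) :=
      fun p q => by rw [← tsum_invAbs_conv]; exact (summable_invAbs_conv p q).hasSum
    have := (((e (n + m) n).add (e n (n - m))).add ((e (n + m) (n - m)).add (e n n))).mul_left 4
    rw [show n + m + n = 2 * n + m by ring, show n + (n - m) = 2 * n - m by ring,
      show n + m + (n - m) = 2 * n by ring, show n + n = 2 * n by ring,
      ← two_mul (invConv (2 * n))] at this
    exact this
  obtain ⟨C, hC⟩ := exists_invConv_bound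
  have := summable_and_tsum_le_of_equiv (F := fun p : ℤ × ℤ =>
    hillWeight n p.1 * (hillWeight n p.2 * ‖hillMatrix c Q p.1 p.2‖ ^ 2))
    (fun p => mul_nonneg (hillWeight_nonneg _ _) (mul_nonneg (hillWeight_nonneg _ _)
      (sq_nonneg _))) subEquiv (w := hillSq c Q) (g := g) (fun m j => ?_)
    (fun m => (hgs m).summable) ?_
  · simpa only [(hgs _).tsum_eq] using this
  · refine (hill_kernel_le c Q n j (j - m)).trans (le_of_eq ?_)
    rw [show j - (j - m) = m by ring, hg]
    rw [show n - (j - m) = n + m - j by ring, show n + (j - m) = n - m + j by ring]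
    ring
  · simp only [(hgs _).tsum_eq]
    refine summable_weighted (summable_hillSq c hQ) (hillSq_nonneg c Q) (C := 4 * (C + C + 2 * C))
      (fun m => ?_) fun m => ?_
    · linarith [invConv_nonneg (2 * n + m), invConv_nonneg (2 * n - m), invConv_nonneg (2 * n)]
    · linarith [hC (2 * n + m), hC (2 * n - m), hC (2 * n)]

theorem tendsto_hill_hs (c : ℂ) {Q : ℝ → ℂ} (hQ : MemLp Q 2 intervalMeasure) :
    Tendsto (fun n : ℤ => ∑' m, hillSq c Q m * (4 * (invConv (2 * n + m) + invConv (2 * n - m) +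
        2 * invConv (2 * n)))) cofinite (𝓝 0) := by
  obtain ⟨C, hC⟩ := exists_invConv_bound
  refine tendsto_weighted_tsum (summable_hillSq c hQ) (hillSq_nonneg c Q)
    (C := 4 * (C + C + 2 * C)) (fun n m => ?_) (fun n m => ?_) fun m => ?_
  · linarith [invConv_nonneg (2 * n + m), invConv_nonneg (2 * n - m), invConv_nonneg (2 * n)]
  · linarith [hC (2 * n + m), hC (2 * n - m), hC (2 * n)]
  · have h1 := tendsto_invConv.comp (tendsto_two_mul_add m)
    have h2 := tendsto_invConv.comp (tendsto_two_mul_sub m)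
    have h3 := tendsto_invConv.comp (tendsto_two_mul_add 0)
    have := ((h1.add h2).add (h3.const_mul 2)).const_mul 4
    simpa using this

/-- A common treatment of the rows and columns at `±n`: `e` labels the index by its frequency `m`,
whose distances to `n` and `-n` are `|m|` and `|s m|` in some order. Of the growth `|m|²`, one
factor cancels against the weight, and `|m| ≤ 2n + |s m|` turns the other into a factor `n` times a
quantity small by Tannery's theorem. -/
theorem hill_energy_le (c : ℂ) {Q : ℝ → ℂ} (hQ : MemLp Q 2 intervalMeasure) {n : ℤ} (hn : 0 < n)
    (e : ℤ ≃ ℤ) (s : ℤ → ℤ) {f : ℤ → ℂ} (hpar : ∀ m, Even (e m - n) → Even m)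
    (hD : ∀ m, invAbs (n - e m) * invAbs (n + e m) = invAbs m * invAbs (s m))
    (hs : ∀ m, |m| ≤ 2 * n + |s m|) (hf : ∀ m, f (e m) = hillCoeff c Q m) :
    WSummable (hillWeight n) f ∧ energy (hillWeight n) f ≤
      (∑' m, hillSq c Q m * (4 * invAbs (s m) + 2 * invAbs n)) * n := by
  have hn' : (0 : ℝ) < n := by exact_mod_cast hn
  have hnn : invAbs n * n = 1 := by
    rw [invAbs, abs_of_pos hn', inv_mul_cancel₀ hn'.ne']
  have hle : ∀ m, hillWeight n (e m) * ‖f (e m)‖ ^ 2 ≤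
      hillSq c Q m * (4 * invAbs (s m) + 2 * invAbs n) * n := by
    intro m
    have hw := hillSq_nonneg c Q m
    have p1 := invAbs_nonneg (s m)
    have p2 := invAbs_nonneg n
    by_cases hm : Even (e m - n)
    swap
    · rw [hillWeight, if_neg hm, zero_mul]; positivity
    rw [hillWeight, if_pos hm, hf, norm_hillCoeff_sq c Q (hpar m hm), hD]
    split_ifs with h0
    · have hm0 : invAbs m = 0 := by rw [h0, invAbs_zero]
      rw [hm0, zero_mul, mul_zero, zero_mul]; positivity
    · have h1 : |(m : ℝ)| ≤ 2 * n + |((s m : ℤ) : ℝ)| := by exact_mod_cast hs m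
      have h2 : |(m : ℝ)| * invAbs m = 1 := by
        rw [invAbs, mul_inv_cancel₀ (by linarith [one_le_abs_cast h0])]
      have h3 := abs_mul_invAbs_le (s m)
      have h4 : |(m : ℝ)| * invAbs (s m) ≤ 2 * n * invAbs (s m) + 1 := by
        nlinarith
      calc _ = 2 * (|(m : ℝ)| * invAbs m) * (|(m : ℝ)| * invAbs (s m)) * hillSq c Q m := by ring
        _ ≤ 2 * 1 * (2 * n * invAbs (s m) + 1) * hillSq c Q m := by rw [h2]; gcongr
        _ = hillSq c Q m * (4 * invAbs (s m) * n + 2 * (invAbs n * n)) := by rw [hnn]; ring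
        _ = _ := by ring
  have hsum : Summable fun m => hillSq c Q m * (4 * invAbs (s m) + 2 * invAbs n) * n :=
    (summable_weighted (summable_hillSq c hQ) (hillSq_nonneg c Q) (C := 6)
      (fun m => by linarith [invAbs_nonneg (s m), invAbs_nonneg n])
      (fun m => by linarith [invAbs_le_one (s m), invAbs_le_one n])).mul_right _
  have h1 : Summable fun m => hillWeight n (e m) * ‖f (e m)‖ ^ 2 :=
    Summable.of_nonneg_of_le (fun m => mul_nonneg (hillWeight_nonneg _ _) (sq_nonneg _)) hle hsum
  refine ⟨e.summable_iff.1 h1, ?_⟩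
  rw [energy, ← e.tsum_eq, ← tsum_mul_right]
  exact h1.tsum_le_tsum hle hsum

theorem tendsto_hill_energy (c : ℂ) {Q : ℝ → ℂ} (hQ : MemLp Q 2 intervalMeasure)
    {s : ℤ → ℤ → ℤ} (hs : ∀ m, Tendsto (fun n => s n m) cofinite cofinite) :
    Tendsto (fun n : ℤ => ∑' m, hillSq c Q m * (4 * invAbs (s n m) + 2 * invAbs n))
      cofinite (𝓝 0) := by
  refine tendsto_weighted_tsum (summable_hillSq c hQ) (hillSq_nonneg c Q) (C := 6)
    (fun n m => by linarith [invAbs_nonneg (s n m), invAbs_nonneg n])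
    (fun n m => by linarith [invAbs_le_one (s n m), invAbs_le_one n]) fun m => ?_
  have := ((tendsto_invAbs.comp (hs m)).const_mul 4).add (tendsto_invAbs.const_mul 2)
  simpa using this

theorem hill_setup (c : ℂ) {Q : ℝ → ℂ} (hQ : MemLp Q 2 intervalMeasure) {ε : ℝ} (hε : 0 < ε) :
    ∀ᶠ n : ℤ in cofinite, 0 < n →
      ReducedSetup (hillMatrix c Q) (hillWeight n) (-n) n ε n := by
  have hlim := (summable_hillSq c hQ).tendsto_cofinite_zero
  have e2 : Tendsto (fun n : ℤ => 2 * √(hillSq c Q (2 * n + 0))) cofinite (𝓝 0) := by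
    simpa using (hlim.comp (tendsto_two_mul_add 0)).sqrt.const_mul 2
  have e3 : Tendsto (fun n : ℤ => 2 * √(hillSq c Q (-2 * n))) cofinite (𝓝 0) := by
    have : Tendsto (fun n : ℤ => -2 * n) cofinite cofinite :=
      Function.Injective.tendsto_cofinite fun a b h => by simpa using h
    simpa using (hlim.comp this).sqrt.const_mul 2
  have e1 : Tendsto (fun n : ℤ => ‖c‖ * invAbs n) cofinite (𝓝 0) := by
    simpa using tendsto_invAbs.const_mul ‖c‖
  -- The bound `1/4` is the square of the Hilbert–Schmidt bound `1/2`. The resonant entries are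
  -- `o(n)`: the diagonal ones equal the constant `c`, the others have modulus `2n |Q̂(±2n)|`.
  filter_upwards [(tendsto_hill_hs c hQ).eventually_le_const (show (0 : ℝ) < 1 / 4 by norm_num),
    (tendsto_hill_energy c hQ tendsto_two_mul_add).eventually_le_const hε,
    (tendsto_hill_energy c hQ tendsto_two_mul_sub).eventually_le_const hε,
    e1.eventually_le_const hε, e2.eventually_le_const hε, e3.eventually_le_const hε]
    with n h1 h2 h3 h4 h5 h6 hn
  have hn' : (0 : ℝ) < n := by exact_mod_cast hn
  have hnn : invAbs n * n = 1 := by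
    rw [invAbs, abs_of_pos hn', inv_mul_cancel₀ hn'.ne']
  obtain ⟨hs1, hs2⟩ := hill_summable_and_tsum_le c hQ n
  have h2' := mul_le_mul_of_nonneg_right h2 hn'.le
  have h3' := mul_le_mul_of_nonneg_right h3 hn'.le
  have hc0 : ‖hillCoeff c Q 0‖ ≤ ε * n := by
    rw [hillCoeff, if_pos rfl]
    calc ‖c‖ = ‖c‖ * invAbs n * n := by rw [mul_assoc, hnn, mul_one]
      _ ≤ ε * n := by gcongr
  have hc2 : ∀ m : ℤ, Even m → m ≠ 0 → |(m : ℝ)| = 2 * n → 2 * √(hillSq c Q m) ≤ ε →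
      ‖hillCoeff c Q m‖ ≤ ε * n := by
    intro m hm hm0 hmn hle
    have : ‖hillCoeff c Q m‖ = |(m : ℝ)| * √(hillSq c Q m) := by
      rw [← Real.sqrt_sq (norm_nonneg (hillCoeff c Q m)), norm_hillCoeff_sq c Q hm, if_neg hm0,
        Real.sqrt_mul (sq_nonneg _), Real.sqrt_sq (abs_nonneg _)]
    rw [this, hmn]
    nlinarith
  have habs : |((2 * n : ℤ) : ℝ)| = 2 * n := by
    rw [abs_of_pos (by push_cast; linarith)]; push_cast; ring
  refine ⟨HSBound.of_prod (hillWeight_nonneg n) (by norm_num) (by norm_num) hs1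
    ((hs2.trans h1).trans (by norm_num)), by omega, hillWeight_neg_self n, hillWeight_self n,
    ?_, ?_, ?_⟩
  · rintro x (rfl | rfl)
    · have := hill_energy_le c hQ hn (Equiv.subLeft (-n)) (fun m => 2 * n + m)
        (f := hillMatrix c Q (-n)) (fun m hm => by simp at hm; grind)
        (fun m => by
          simp only [Equiv.subLeft_apply]
          rw [show n - (-n - m) = 2 * n + m by ring, show n + (-n - m) = -m by ring, invAbs_neg,
            mul_comm])
        (fun m => by grind) (fun m => by simp [hillMatrix])
      exact ⟨this.1, this.2.trans h2'⟩
    · have := hill_energy_le c hQ hn (Equiv.subLeft x) (fun m => 2 * x - m)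
        (f := hillMatrix c Q x) (fun m hm => by simp at hm; grind)
        (fun m => by
          simp only [Equiv.subLeft_apply]
          rw [show x - (x - m) = m by ring, show x + (x - m) = 2 * x - m by ring])
        (fun m => by grind) (fun m => by simp [hillMatrix])
      exact ⟨this.1, this.2.trans h3'⟩
  · rintro x (rfl | rfl)
    · have := hill_energy_le c hQ hn (Equiv.addRight (-n)) (fun m => 2 * n - m)
        (f := fun j => hillMatrix c Q j (-n)) (fun m hm => by simp at hm; grind)
        (fun m => by
          simp only [Equiv.coe_addRight]
          rw [show n - (m + -n) = 2 * n - m by ring, show n + (m + -n) = m by ring, mul_comm])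
        (fun m => by grind) (fun m => by simp [hillMatrix])
      exact ⟨this.1, this.2.trans h3'⟩
    · have := hill_energy_le c hQ hn (Equiv.addRight x) (fun m => 2 * x + m)
        (f := fun j => hillMatrix c Q j x) (fun m hm => by simpa using hm)
        (fun m => by
          simp only [Equiv.coe_addRight]
          rw [show x - (m + x) = -m by ring, show x + (m + x) = 2 * x + m by ring, invAbs_neg])
        (fun m => by grind) (fun m => by simp [hillMatrix])
      exact ⟨this.1, this.2.trans h2'⟩
  · rintro x y (rfl | rfl) (rfl | rfl)
    · simpa [hillMatrix] using hc0
    · rw [hillMatrix, show -y - y = -2 * y by ring]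
      refine hc2 _ (by simp) (by omega) ?_ h6
      rw [← habs, ← abs_neg]; push_cast; ring_nf
    · rw [hillMatrix, show x - -x = 2 * x + 0 by ring]
      exact hc2 _ (by simp) (by omega) (by rw [add_zero, habs]) h5
    · simpa [hillMatrix] using hc0

/-! ### The Dirac matrix -/

/-- A majorant of the reduced resolvent of the free Dirac operator. -/
noncomputable def diracWeight (n : ℤ) (a : Bool × ℤ) : ℝ :=
  if Even (a.2 - n) then 2 * invAbs (n - a.2) else 0

theorem diracWeight_nonneg (n : ℤ) (a : Bool × ℤ) : 0 ≤ diracWeight n a := by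
  unfold diracWeight
  split_ifs
  · exact mul_nonneg two_pos.le (invAbs_nonneg _)
  · exact le_rfl

theorem diracDenominator_ge {n j : ℤ} (h : j ≠ n) {z : ℂ} (hz : ‖z‖ < 1 / 2) :
    |((n - j : ℤ) : ℝ)| / 2 ≤ ‖(n : ℂ) - (j : ℂ) + z‖ := by
  have e0 := one_le_abs_cast (sub_ne_zero.2 h.symm)
  have e1 : ‖(n : ℂ) - (j : ℂ)‖ = |((n - j : ℤ) : ℝ)| := by
    rw [← Real.norm_eq_abs, ← Complex.norm_real]
    congr 1; push_cast; ring
  have e2 := norm_sub_le ((n : ℂ) - (j : ℂ) + z) z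
  rw [add_sub_cancel_right] at e2
  linarith

theorem diracDenominator_pos {n j : ℤ} (h : j ≠ n) : 0 < |((n - j : ℤ) : ℝ)| / 2 := by
  linarith [one_le_abs_cast (sub_ne_zero.2 h.symm)]

theorem diracDenominator_ne_zero {n j : ℤ} (h : j ≠ n) {z : ℂ} (hz : ‖z‖ < 1 / 2) :
    (n : ℂ) - (j : ℂ) + z ≠ 0 :=
  norm_pos_iff.1 ((diracDenominator_pos h).trans_le (diracDenominator_ge h hz))

theorem norm_diracDiag_le (n : ℤ) {z : ℂ} (hz : ‖z‖ < 1 / 2) (a : Bool × ℤ) :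
    ‖diracDiag n z a‖ ≤ diracWeight n a := by
  unfold diracDiag
  split_ifs with h
  · rw [diracWeight, if_pos h.1, norm_inv]
    refine (inv_anti₀ (diracDenominator_pos h.2) (diracDenominator_ge h.2 hz)).trans
      (le_of_eq ?_)
    rw [invAbs, inv_div, div_eq_mul_inv]
  · simpa using diracWeight_nonneg n a

theorem differentiableOn_diracDiag (n : ℤ) (a : Bool × ℤ) :
    DifferentiableOn ℂ (fun z => diracDiag n z a) (Metric.ball 0 (1 / 2)) := by
  unfold diracDiag
  split_ifs with h
  · refine DifferentiableOn.inv (by fun_prop) fun z hz => ?_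
    exact diracDenominator_ne_zero h.2 (by simpa using hz)
  · exact differentiableOn_const _

/-- The squared coefficients of `P` and `Q` at the even frequencies: the block `(s, t)` of the
matrix depends on the sum `m` of the indices. -/
noncomputable def diracSq (P Q : ℝ → ℂ) : Bool × Bool × ℤ → ℝ
  | (false, true, m) => if Even (-m) then ‖fourierCoeffPi P (-m)‖ ^ 2 else 0
  | (true, false, m) => if Even m then ‖fourierCoeffPi Q m‖ ^ 2 else 0
  | (false, false, _) => 0
  | (true, true, _) => 0

theorem diracSq_nonneg (P Q : ℝ → ℂ) (x : Bool × Bool × ℤ) : 0 ≤ diracSq P Q x := by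
  obtain ⟨_ | _, _ | _, m⟩ := x <;> simp only [diracSq, le_refl] <;> split_ifs <;> positivity

theorem norm_diracMatrix_sq (P Q : ℝ → ℂ) {s t : Bool} {k j : ℤ} (h : Even (k + j)) :
    ‖diracMatrix P Q (s, k) (t, j)‖ ^ 2 = diracSq P Q (s, t, k + j) := by
  cases s <;> cases t
  · simp [diracMatrix, diracSq]
  · rw [diracMatrix, diracSq, if_pos h.neg, neg_add']
  · rw [diracMatrix, diracSq, if_pos h]
  · simp [diracMatrix, diracSq]

theorem summable_diracSq_block {P Q : ℝ → ℂ} (hP : MemLp P 2 intervalMeasure)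
    (hQ : MemLp Q 2 intervalMeasure) (s t : Bool) : Summable fun m => diracSq P Q (s, t, m) := by
  cases s <;> cases t
  · exact summable_zero
  · exact (Equiv.neg ℤ).summable_iff (f := fun m : ℤ =>
      if Even m then ‖fourierCoeffPi P m‖ ^ 2 else 0) |>.2 (summable_ite_even hP)
  · exact summable_ite_even hQ
  · exact summable_zero

theorem summable_bool_prod {κ : Type*} {f : Bool × κ → ℝ} (hf : ∀ p, 0 ≤ f p)
    (h : ∀ s, Summable fun k => f (s, k)) : Summable f :=
  (summable_prod_of_nonneg hf).2 ⟨h, Summable.of_finite⟩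

theorem summable_diracSq {P Q : ℝ → ℂ} (hP : MemLp P 2 intervalMeasure)
    (hQ : MemLp Q 2 intervalMeasure) : Summable (diracSq P Q) :=
  summable_bool_prod (diracSq_nonneg P Q) fun s =>
    summable_bool_prod (fun _ => diracSq_nonneg P Q _) fun t => summable_diracSq_block hP hQ s t

/-- The change of variables `((s, t, m), k) ↦ ((s, k), (t, m - k))`. -/
def addEquiv : (Bool × Bool × ℤ) × ℤ ≃ (Bool × ℤ) × (Bool × ℤ) where
  toFun p := ((p.1.1, p.2), (p.1.2.1, p.1.2.2 - p.2))
  invFun p := ((p.1.1, p.2.1, p.1.2 + p.2.2), p.1.2)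
  left_inv p := by simp
  right_inv p := by simp

theorem even_add_of_even_sub {n k j : ℤ} (hk : Even (k - n)) (hj : Even (j - n)) :
    Even (k + j) := by
  rw [Int.even_sub] at hk hj
  rw [Int.even_add, hk, hj]

/-- Here the entries depend on the sum `m` of the indices and do not grow, so for fixed `m` the two
weights form a single convolution, at `2n - m`. -/
theorem dirac_summable_and_tsum_le {P Q : ℝ → ℂ} (hP : MemLp P 2 intervalMeasure)
    (hQ : MemLp Q 2 intervalMeasure) (n : ℤ) :
    (Summable fun p : (Bool × ℤ) × (Bool × ℤ) =>
      diracWeight n p.1 * (diracWeight n p.2 * ‖diracMatrix P Q p.1 p.2‖ ^ 2)) ∧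
    ∑' p : (Bool × ℤ) × (Bool × ℤ),
      diracWeight n p.1 * (diracWeight n p.2 * ‖diracMatrix P Q p.1 p.2‖ ^ 2) ≤
      ∑' x, diracSq P Q x * (4 * invConv (2 * n - x.2.2)) := by
  set g : Bool × Bool × ℤ → ℤ → ℝ := fun x k =>
    4 * (invAbs (n - k) * invAbs (n - x.2.2 + k)) with hg
  have hgs : ∀ x, HasSum (g x) (4 * invConv (2 * n - x.2.2)) := by
    intro x
    have := (summable_invAbs_conv n (n - x.2.2)).hasSum.mul_left 4
    rw [tsum_invAbs_conv, show n + (n - x.2.2) = 2 * n - x.2.2 by ring] at this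
    exact this
  obtain ⟨C, hC⟩ := exists_invConv_bound
  have := summable_and_tsum_le_of_equiv (F := fun p : (Bool × ℤ) × (Bool × ℤ) =>
    diracWeight n p.1 * (diracWeight n p.2 * ‖diracMatrix P Q p.1 p.2‖ ^ 2))
    (fun p => mul_nonneg (diracWeight_nonneg _ _) (mul_nonneg (diracWeight_nonneg _ _)
      (sq_nonneg _))) addEquiv (w := diracSq P Q) (g := g) (fun x k => ?_)
    (fun x => (hgs x).summable) ?_
  · simpa only [(hgs _).tsum_eq] using this
  · obtain ⟨s, t, m⟩ := x
    simp only [addEquiv, Equiv.coe_fn_mk, hg]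
    have hw := diracSq_nonneg P Q (s, t, m)
    have p1 := invAbs_nonneg (n - k)
    have p2 := invAbs_nonneg (n - m + k)
    by_cases hk : Even (k - n)
    swap
    · rw [diracWeight, if_neg hk, zero_mul]; positivity
    by_cases hj : Even (m - k - n)
    swap
    · rw [diracWeight, diracWeight, if_neg hj, zero_mul, mul_zero]; positivity
    rw [norm_diracMatrix_sq P Q (even_add_of_even_sub hk hj), diracWeight, diracWeight, if_pos hk,
      if_pos hj, add_sub_cancel, show n - (m - k) = n - m + k by ring]
    exact le_of_eq (by ring)
  · simp only [(hgs _).tsum_eq]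
    refine summable_weighted (summable_diracSq hP hQ) (diracSq_nonneg P Q) (C := 4 * C)
      (fun m => ?_) fun m => ?_
    · linarith [invConv_nonneg (2 * n - m.2.2)]
    · linarith [hC (2 * n - m.2.2)]

theorem tendsto_dirac_hs {P Q : ℝ → ℂ} (hP : MemLp P 2 intervalMeasure)
    (hQ : MemLp Q 2 intervalMeasure) :
    Tendsto (fun n : ℤ => ∑' x, diracSq P Q x * (4 * invConv (2 * n - x.2.2))) cofinite
      (𝓝 0) := by
  obtain ⟨C, hC⟩ := exists_invConv_bound
  refine tendsto_weighted_tsum (summable_diracSq hP hQ) (diracSq_nonneg P Q)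
    (C := 4 * C) (fun n x => ?_) (fun n x => ?_) fun x => ?_
  · linarith [invConv_nonneg (2 * n - x.2.2)]
  · linarith [hC (2 * n - x.2.2)]
  · simpa using (tendsto_invConv.comp (tendsto_two_mul_sub x.2.2)).const_mul 4

theorem summable_diracSq_comp {P Q : ℝ → ℂ} (hP : MemLp P 2 intervalMeasure)
    (hQ : MemLp Q 2 intervalMeasure) (σ : Bool → Bool × Bool) :
    Summable fun p : Bool × ℤ => diracSq P Q ((σ p.1).1, (σ p.1).2, p.2) :=
  summable_bool_prod (fun p => diracSq_nonneg P Q ((σ p.1).1, (σ p.1).2, p.2)) fun s =>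
    summable_diracSq_block hP hQ (σ s).1 (σ s).2

/-- The map `σ` selects the block: `s ↦ (t, s)` for the row and `s ↦ (s, t)` for the column at `(t,
n)`. -/
theorem dirac_energy_le {P Q : ℝ → ℂ} (hP : MemLp P 2 intervalMeasure)
    (hQ : MemLp Q 2 intervalMeasure) (n : ℤ) (σ : Bool → Bool × Bool) {f : Bool × ℤ → ℂ}
    (hf : ∀ s k, Even (k - n) → ‖f (s, k)‖ ^ 2 = diracSq P Q ((σ s).1, (σ s).2, k + n)) :
    WSummable (diracWeight n) f ∧ energy (diracWeight n) f ≤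
      ∑' p : Bool × ℤ, diracSq P Q ((σ p.1).1, (σ p.1).2, p.2) * (2 * invAbs (2 * n - p.2)) := by
  set e : Bool × ℤ ≃ Bool × ℤ := (Equiv.refl Bool).prodCongr (Equiv.addRight (-n)) with he
  have hle : ∀ p, diracWeight n (e p) * ‖f (e p)‖ ^ 2 ≤
      diracSq P Q ((σ p.1).1, (σ p.1).2, p.2) * (2 * invAbs (2 * n - p.2)) := by
    rintro ⟨s, m⟩
    have e1 : e (s, m) = (s, m + -n) := rfl
    have hw := diracSq_nonneg P Q ((σ s).1, (σ s).2, m)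
    have p1 := invAbs_nonneg (2 * n - m)
    rw [e1]
    by_cases hm : Even (m + -n - n)
    · rw [diracWeight, if_pos hm, hf s _ hm, neg_add_cancel_right,
        show n - (m + -n) = 2 * n - m by ring]
      exact le_of_eq (by ring)
    · rw [diracWeight, if_neg hm, zero_mul]; positivity
  have hsum := summable_weighted (summable_diracSq_comp hP hQ σ)
    (fun p => diracSq_nonneg P Q ((σ p.1).1, (σ p.1).2, p.2)) (C := 2)
    (G := fun p => 2 * invAbs (2 * n - p.2)) (fun p => by linarith [invAbs_nonneg (2 * n - p.2)])
    (fun p => by linarith [invAbs_le_one (2 * n - p.2)])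
  have h1 : Summable fun p => diracWeight n (e p) * ‖f (e p)‖ ^ 2 :=
    Summable.of_nonneg_of_le (fun m => mul_nonneg (diracWeight_nonneg _ _) (sq_nonneg _)) hle hsum
  refine ⟨(e.summable_iff (f := fun p => diracWeight n p * ‖f p‖ ^ 2)).1 h1, ?_⟩
  rw [energy, ← e.tsum_eq]
  exact h1.tsum_le_tsum hle hsum

theorem tendsto_dirac_energy {P Q : ℝ → ℂ} (hP : MemLp P 2 intervalMeasure)
    (hQ : MemLp Q 2 intervalMeasure) (σ : Bool → Bool × Bool) :
    Tendsto (fun n : ℤ => ∑' p : Bool × ℤ,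
      diracSq P Q ((σ p.1).1, (σ p.1).2, p.2) * (2 * invAbs (2 * n - p.2))) cofinite (𝓝 0) := by
  refine tendsto_weighted_tsum (summable_diracSq_comp hP hQ σ)
    (fun p => diracSq_nonneg P Q ((σ p.1).1, (σ p.1).2, p.2)) (C := 2)
    (G := fun n p => 2 * invAbs (2 * n - p.2))
    (fun n p => by linarith [invAbs_nonneg (2 * n - p.2)])
    (fun n p => by linarith [invAbs_le_one (2 * n - p.2)]) fun p => ?_
  simpa using (tendsto_invAbs.comp (tendsto_two_mul_sub p.2)).const_mul 2

theorem dirac_setup {P Q : ℝ → ℂ} (hP : MemLp P 2 intervalMeasure)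
    (hQ : MemLp Q 2 intervalMeasure) {ε : ℝ} (hε : 0 < ε) :
    ∀ᶠ n : ℤ in cofinite,
      ReducedSetup (diracMatrix P Q) (diracWeight n) (false, n) (true, n) ε 1 := by
  have hentry : ∀ s t : Bool, ∀ᶠ n : ℤ in cofinite, √(diracSq P Q (s, t, 2 * n + 0)) ≤ ε := by
    intro s t
    have := ((summable_diracSq_block hP hQ s t).tendsto_cofinite_zero.comp
      (tendsto_two_mul_add 0)).sqrt
    rw [Real.sqrt_zero] at this
    exact this.eventually_le_const hε
  have hrow : ∀ t : Bool, ∀ᶠ n : ℤ in cofinite, _ ≤ ε := fun t =>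
    (tendsto_dirac_energy hP hQ fun s => (t, s)).eventually_le_const hε
  have hcol : ∀ t : Bool, ∀ᶠ n : ℤ in cofinite, _ ≤ ε := fun t =>
    (tendsto_dirac_energy hP hQ fun s => (s, t)).eventually_le_const hε
  simp only [← eventually_all] at hentry hrow hcol
  filter_upwards [(tendsto_dirac_hs hP hQ).eventually_le_const (show (0 : ℝ) < 1 / 4 by norm_num),
    hrow, hcol, hentry]
    with n h1 h2 h3 h4
  obtain ⟨hs1, hs2⟩ := dirac_summable_and_tsum_le hP hQ n
  have form : ∀ x : Bool × ℤ, x = (false, n) ∨ x = (true, n) → ∃ t, x = (t, n) := by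
    rintro x (rfl | rfl)
    exacts [⟨_, rfl⟩, ⟨_, rfl⟩]
  have hpar : ∀ {k : ℤ}, Even (k - n) → Even (k + n) := fun hk =>
    even_add_of_even_sub hk (by simp)
  refine ⟨HSBound.of_prod (diracWeight_nonneg n) (by norm_num) (by norm_num) hs1
    ((hs2.trans h1).trans (by norm_num)), by simp, by simp [diracWeight], by simp [diracWeight],
    ?_, ?_, ?_⟩
  · intro x hx
    obtain ⟨t, rfl⟩ := form x hx
    have := dirac_energy_le hP hQ n (fun s => (t, s)) (f := diracMatrix P Q (t, n))
      fun s k hk => by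
        rw [norm_diracMatrix_sq P Q (by rw [add_comm]; exact hpar hk), add_comm n k]
    exact ⟨this.1, by rw [mul_one]; exact this.2.trans (h2 t)⟩
  · intro x hx
    obtain ⟨t, rfl⟩ := form x hx
    have := dirac_energy_le hP hQ n (fun s => (s, t)) (f := fun a => diracMatrix P Q a (t, n))
      fun s k hk => norm_diracMatrix_sq P Q (hpar hk)
    exact ⟨this.1, by rw [mul_one]; exact this.2.trans (h3 t)⟩
  · intro x y hx hy
    obtain ⟨s, rfl⟩ := form x hx
    obtain ⟨t, rfl⟩ := form y hy
    have := h4 s t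
    rwa [add_zero, two_mul, ← norm_diracMatrix_sq P Q (by simp), Real.sqrt_sq (norm_nonneg _),
      ← mul_one ε] at this

/-! ### Fourier coefficients along one parity class -/

theorem hasSum_of_class {F : ℤ → ℂ} {n : ℤ} {S : ℂ} (h : HasSum (fun k : ℤ => F (n + 2 * k)) S)
    (h0 : ∀ i, ¬Even (i - n) → F i = 0) : HasSum F S := by
  have hinj : Function.Injective fun k : ℤ => n + 2 * k := fun a b h => by simpa using h
  refine (hinj.hasSum_iff fun i hi => h0 i ?_).1 h
  rintro ⟨k, hk⟩
  exact hi ⟨k, by simp only; omega⟩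

theorem summable_ite_class {f : ℝ → ℂ} (hf : MemLp f 2 intervalMeasure) (n : ℤ) :
    Summable fun m : ℤ => if Even (m - n) then ‖fourierCoeffPi f m‖ ^ 2 else 0 := by
  have hinj : Function.Injective fun k : ℤ => n + 2 * k := fun a b h => by simpa using h
  rw [← hinj.summable_iff]
  · exact (hasSum_sq_fourierCoeffPi hf n).summable.congr fun k => by simp
  · intro m hm
    rw [if_neg]
    rintro ⟨k, hk⟩
    exact hm ⟨k, by simp only; omega⟩

theorem exists_class {n j : ℤ} (h : Even (j - n)) : ∃ k, j = n + 2 * k := by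
  obtain ⟨k, hk⟩ := h
  exact ⟨k, by omega⟩

theorem exists_ne_zero_of_fourierCoeffPi {y : ℝ → ℂ} {j : ℤ} (h : fourierCoeffPi y j ≠ 0) :
    ∃ x ∈ Set.Icc 0 Real.pi, y x ≠ 0 := by
  by_contra! hcon
  refine h ?_
  have h0 : ∀ᵐ x ∂intervalMeasure, y x = 0 :=
    (ae_restrict_mem measurableSet_Icc).mono fun x hx => hcon x hx
  rw [fourierCoeffPi_congr (g := fun _ => 0) h0]
  simp [fourierCoeffPi]

theorem exists_fourierCoeffPi_ne_zero {y : ℝ → ℂ} (hy : ContinuousOn y (Set.Icc 0 Real.pi))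
    (h : ∃ x ∈ Set.Icc 0 Real.pi, y x ≠ 0) (n : ℤ) :
    ∃ j, Even (j - n) ∧ fourierCoeffPi y j ≠ 0 := by
  by_contra! hcon
  obtain ⟨x, hx, hne⟩ := h
  refine hne (eqOn_zero_of_ae_eq_zero hy (ae_eq_zero_of_fourierCoeffPi
    (memLp_of_continuousOn hy) n fun k => hcon _ (by simp)) x hx)

/-- A bound for the values at all but two points gives summability. -/
theorem summable_of_le_off_pair {ι : Type*} [DecidableEq ι] {f g : ι → ℝ} (hf : ∀ i, 0 ≤ f i)
    (hg0 : ∀ i, 0 ≤ g i) (hg : Summable g) (a b : ι) (h : ∀ i, i ≠ a → i ≠ b → f i ≤ g i) :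
    Summable f := by
  have h1 : Summable fun i => if i = a then f a else 0 := (hasSum_ite_eq a (f a)).summable
  have h2 : Summable fun i => if i = b then f b else 0 := (hasSum_ite_eq b (f b)).summable
  refine Summable.of_nonneg_of_le hf (fun i => ?_) ((h1.add h2).add hg)
  by_cases ha : i = a
  · subst ha
    have : 0 ≤ if i = b then f b else 0 := by split_ifs <;> simp [hf]
    simp only [if_true]
    linarith [hg0 i]
  · by_cases hb : i = b
    · subst hb
      simp [ha, hg0 i]
    · simpa [ha, hb] using h i ha hb

/-! ### The eigenvalue equation of the Hill operator -/

/-- The Fourier coefficients of `v y = c y + (Q y)' - Q y'`. -/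
theorem hill_hasSum {c : ℂ} {Q y y' : ℝ → ℂ} (hQ : MemLp Q 2 intervalMeasure)
    (hy : MemLp y 2 intervalMeasure) (hy' : MemLp y' 2 intervalMeasure) {n : ℤ}
    (hc : ∀ i, Even (i - n) → fourierCoeffPi y' i = Complex.I * i * fourierCoeffPi y i) {j : ℤ}
    (hj : Even (j - n)) :
    HasSum (fun i => hillMatrix c Q j i * if Even (i - n) then fourierCoeffPi y i else 0)
      (Complex.I * j * fourierCoeffPi (fun x => Q x * y x) j -
        fourierCoeffPi (fun x => Q x * y' x) j + c * fourierCoeffPi y j) := by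
  obtain ⟨l, rfl⟩ := exists_class hj
  refine hasSum_of_class (n := n) ?_ fun i hi => by rw [if_neg hi, mul_zero]
  have h1 := (hasSum_mul_fourierCoeffPi hQ hy n (n + 2 * l)).mul_left
    (Complex.I * ((n + 2 * l : ℤ) : ℂ))
  have h2 := hasSum_mul_fourierCoeffPi hQ hy' n (n + 2 * l)
  have h3 : HasSum (fun k : ℤ => if k = l then c * fourierCoeffPi y (n + 2 * l) else 0)
    (c * fourierCoeffPi y (n + 2 * l)) := hasSum_ite_eq l _
  refine ((h1.sub h2).add h3).congr_fun fun k => ?_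
  -- The terms `i j Q̂(j - k) ŷ(k)` and `-Q̂(j - k) · i k ŷ(k)` combine to the coefficient `i (j -
  -- k) Q̂(j - k)` of `Q'`; it is zero at `k = j`, where `c` takes its place.
  rw [hc _ (by simp), if_pos (by simp), hillMatrix, hillCoeff]
  by_cases hk : k = l
  · subst hk
    simp only [sub_self, if_true]
    ring
  · rw [if_neg hk, if_neg (by omega)]
    push_cast
    ring

theorem hill_even_of_good {n j : ℤ} (h : hillWeight n j ≠ 0 ∨ j = -n ∨ j = n) : Even (j - n) := by
  rcases h with h | rfl | rfl
  · by_contra hcon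
    exact h (by rw [hillWeight, if_neg hcon])
  · rw [show -n - n = 2 * -n by ring]; simp
  · simp

theorem hillWeight_ne_zero {n j : ℤ} (hj : Even (j - n)) (h1 : j ≠ n) (h2 : j ≠ -n) :
    hillWeight n j ≠ 0 := by
  rw [hillWeight, if_pos hj, invAbs, invAbs]
  have e1 : ((n - j : ℤ) : ℝ) ≠ 0 := by exact_mod_cast sub_ne_zero.2 h1.symm
  have e2 : ((n + j : ℤ) : ℝ) ≠ 0 := by
    have : n + j ≠ 0 := by omega
    exact_mod_cast this
  positivity

theorem hillWeight_mul_abs {n j : ℤ} (hj : Even (j - n)) (h1 : j ≠ n) (h2 : j ≠ -n) :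
    hillWeight n j * |(n : ℝ) ^ 2 - (j : ℝ) ^ 2| = 2 := by
  have e1 := one_le_abs_cast (sub_ne_zero.2 h1.symm)
  have e2 := one_le_abs_cast (s := n + j) (by omega)
  have e3 : |(n : ℝ) ^ 2 - (j : ℝ) ^ 2| = |((n - j : ℤ) : ℝ)| * |((n + j : ℤ) : ℝ)| := by
    rw [← abs_mul]; congr 1; push_cast; ring
  rw [hillWeight, if_pos hj, invAbs, invAbs, e3]
  field_simp

theorem hillWeight_le_two (n j : ℤ) : hillWeight n j ≤ 2 := by
  have h1 := hillWeight_le n j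
  have h2 := invAbs_le_one (n - j)
  have h3 := invAbs_le_one (n + j)
  nlinarith [invAbs_nonneg (n - j), invAbs_nonneg (n + j)]

/-- From `j² ≤ |n² - j²| + n²`. It makes the coefficients `i j Y_j` square summable when `V Y` has
finite energy, so that solutions of the reduced equation lie in `H¹`. -/
theorem sq_mul_hillWeight_le (n j : ℤ) : (j : ℝ) ^ 2 * hillWeight n j ≤ 2 + 2 * (n : ℝ) ^ 2 := by
  have h0 := hillWeight_nonneg n j
  by_cases hj : Even (j - n)
  swap
  · rw [hillWeight, if_neg hj, mul_zero]; positivity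
  by_cases h1 : j = n
  · rw [h1, hillWeight_self, mul_zero]; positivity
  by_cases h2 : j = -n
  · rw [h2, hillWeight_neg_self, mul_zero]; positivity
  have h3 := hillWeight_mul_abs hj h1 h2
  have h4 := hillWeight_le_two n j
  have h5 : (j : ℝ) ^ 2 ≤ |(n : ℝ) ^ 2 - (j : ℝ) ^ 2| + (n : ℝ) ^ 2 := by
    linarith [neg_abs_le ((n : ℝ) ^ 2 - (j : ℝ) ^ 2)]
  nlinarith [sq_nonneg (n : ℝ)]

/-- The Fourier coefficients `Y` of an eigenfunction satisfy `(n² + z - j²) Y_j = (V Y)_j`, and `V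
Y` has finite energy because `y ∈ H¹`. -/
theorem hill_det_of_eigenvalue {c : ℂ} {Q : ℝ → ℂ} (hQ : MemLp Q 2 intervalMeasure) {n : ℤ}
    (hn : 0 < n) {ε R : ℝ}
    (hset : ReducedSetup (hillMatrix c Q) (hillWeight n) (-n) n ε R) {z : ℂ} (hz : ‖z‖ < n / 4)
    (h : IsHillEigenvalue c Q ((-1 : ℂ) ^ n) ((n : ℂ) ^ 2 + z)) :
    (z - reducedEntry (hillMatrix c Q) (hillDiag n z) (-n) (-n)) *
      (z - reducedEntry (hillMatrix c Q) (hillDiag n z) n n) =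
    reducedEntry (hillMatrix c Q) (hillDiag n z) (-n) n *
      reducedEntry (hillMatrix c Q) (hillDiag n z) n (-n) := by
  obtain ⟨y, hne, y', u, u', hyD, hy', hu, huD, heq, -, hbc, hubc⟩ := h
  have hyc := hyD.continuousOn
  have hy := memLp_of_continuousOn hyc
  have hyi := hy.integrable (by norm_num)
  have hy'i := hy'.integrable (by norm_num)
  have hu'i := intervalIntegrable_iff_integrable.1 huD.1
  have hQy := (memLp_mul_of_continuousOn hyc hQ).integrable (by norm_num)
  have hQy' := integrable_mul hQ hy'
  have hc : ∀ i, Even (i - n) → fourierCoeffPi y' i = Complex.I * i * fourierCoeffPi y i :=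
    fun i hi => fourierCoeffPi_deriv hyD hi hbc
  -- The coefficients of `u'` are `i j û(j)` by the boundary condition on the quasi-derivative, and
  -- `û(j) = i j ŷ(j) - (Q y)^(j)`; no derivative of `Q` appears.
  have hmain : ∀ j, Even (j - n) → ((n : ℂ) ^ 2 + z - (j : ℂ) ^ 2) * fourierCoeffPi y j =
      Complex.I * j * fourierCoeffPi (fun x => Q x * y x) j -
        fourierCoeffPi (fun x => Q x * y' x) j + c * fourierCoeffPi y j := by
    intro j hj
    have e1 := fourierCoeffPi_congr heq j
    have e2 : fourierCoeffPi (fun x => -u' x - Q x * y' x + c * y x) j =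
        -1 * fourierCoeffPi u' j - fourierCoeffPi (fun x => Q x * y' x) j +
          c * fourierCoeffPi y j := by
      rw [fourierCoeffPi_add (f := fun x => -u' x - Q x * y' x) (hu'i.neg.sub hQy')
        (hyi.const_mul c), fourierCoeffPi_const_mul,
        fourierCoeffPi_sub (f := fun x => -u' x) hu'i.neg hQy', ← fourierCoeffPi_const_mul (-1)]
      simp only [neg_one_mul]
    have e3 := fourierCoeffPi_deriv huD hj hubc
    have e4 := fourierCoeffPi_congr hu j
    rw [fourierCoeffPi_sub hy'i hQy, hc j hj] at e4
    rw [fourierCoeffPi_const_mul, e2, e3, e4] at e1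
    linear_combination e1 - (j : ℂ) ^ 2 * fourierCoeffPi y j * Complex.I_sq
  set Y : ℤ → ℂ := fun i => if Even (i - n) then fourierCoeffPi y i else 0 with hY
  set G : ℤ → ℂ := fun j => ((n : ℂ) ^ 2 + z - (j : ℂ) ^ 2) * Y j with hG
  have hev : Even (-n - n) := by rw [show -n - n = 2 * -n by ring]; simp
  refine hset.hs.det_eq_zero_of_solution (fun j => norm_hillDiag_le hn hz j) hset.ne
    hset.weight_left hset.weight_right (hset.row _ (.inl rfl)).1 (hset.row _ (.inr rfl)).1
    (hset.col _ (.inl rfl)).1 (hset.col _ (.inr rfl)).1 (Y := Y) (G := G) ?_ ?_ ?_ ?_ ?_ ?_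
  · obtain ⟨j, hj, hj0⟩ := exists_fourierCoeffPi_ne_zero hyc hne n
    exact ⟨j, by simpa [hY, hj] using hj0⟩
  -- Finite energy of `G`: the weight is `2 / |n² - j²|` and the perturbed denominator is at most `2
  -- |n² - j²|`, so the summand is at most `8 (n² + j²) |Y_j|²`.
  · have s1 := summable_ite_class hy' n
    have s2 := summable_ite_class hy n
    refine Summable.of_nonneg_of_le (fun j => mul_nonneg (hillWeight_nonneg _ _) (sq_nonneg _))
      (fun j => ?_) ((s1.mul_left 8).add (s2.mul_left (8 * (n : ℝ) ^ 2)))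
    by_cases hj : Even (j - n)
    swap
    · simp [hG, hY, hj]
    simp only [hG, hY, if_pos hj]
    rw [hc j hj, norm_mul, norm_mul, norm_mul, Complex.norm_I, one_mul]
    have e0 : ‖(j : ℂ)‖ = |(j : ℝ)| := by
      rw [← Real.norm_eq_abs, ← Complex.norm_real]; simp
    rw [e0, mul_pow, mul_pow, sq_abs]
    by_cases h1 : j = n
    · rw [h1, hillWeight_self, zero_mul]; positivity
    by_cases h2 : j = -n
    · rw [h2, hillWeight_neg_self, zero_mul]; positivity
    have h3 := hillWeight_mul_abs hj h1 h2
    have h4 : (n : ℝ) ≤ |(n : ℝ) ^ 2 - (j : ℝ) ^ 2| := by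
      refine (abs_sq_sub_sq_ge hn h1 h2).trans (le_of_eq ?_)
      rw [← abs_mul]; congr 1; push_cast; ring
    set A := |(n : ℝ) ^ 2 - (j : ℝ) ^ 2| with hA
    have h5 : ‖(n : ℂ) ^ 2 + z - (j : ℂ) ^ 2‖ ≤ 2 * A := by
      have e1 : (n : ℂ) ^ 2 + z - (j : ℂ) ^ 2 = (((n : ℝ) ^ 2 - (j : ℝ) ^ 2 : ℝ) : ℂ) + z := by
        push_cast; ring
      rw [e1]
      refine (norm_add_le _ _).trans ?_
      rw [Complex.norm_real, Real.norm_eq_abs, ← hA]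
      have : (0 : ℝ) < n := by exact_mod_cast hn
      linarith
    have h6 : A ≤ (n : ℝ) ^ 2 + (j : ℝ) ^ 2 := by
      rw [hA]
      refine (abs_sub _ _).trans (le_of_eq ?_)
      rw [abs_of_nonneg (sq_nonneg _), abs_of_nonneg (sq_nonneg _)]
    have h7 : hillWeight n j * ‖(n : ℂ) ^ 2 + z - (j : ℂ) ^ 2‖ ^ 2 ≤ 8 * A := by
      calc _ ≤ hillWeight n j * (2 * A) ^ 2 := by
            have := hillWeight_nonneg n j
            gcongr
        _ = 4 * (hillWeight n j * A) * A := by ring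
        _ = 8 * A := by rw [h3]; ring
    have h8 := mul_le_mul_of_nonneg_right (h7.trans (by linarith : 8 * A ≤ 8 * ((n : ℝ) ^ 2 +
      (j : ℝ) ^ 2))) (sq_nonneg ‖fourierCoeffPi y j‖)
    linarith
  · intro j h1 h2
    by_cases hj : Even (j - n)
    · have hden := hillDenominator_ne_zero hn h2 h1 hz
      simp only [hG, hillDiag]
      rw [if_pos ⟨hj, h2, h1⟩]
      field_simp
      ring
    · simp [hY, hillDiag, hj]
  · intro j hj
    have hj' := hill_even_of_good hj
    have := hill_hasSum (c := c) hQ hy hy' hc hj'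
    rw [← hmain j hj'] at this
    simpa only [hG, hY, if_pos hj'] using this
  · simp [hG]
  · simp [hG]

/-- A solution of the reduced equation has `Y_j` and `i j Y_j` square summable. Riesz–Fischer and
`exists_hasL1Deriv` turn them into `y ∈ H¹` with its derivative and boundary condition, and a second
use of `exists_hasL1Deriv` supplies the quasi-derivative with its own. -/
theorem hill_eigenvalue_of_det {c : ℂ} {Q : ℝ → ℂ} (hQ : MemLp Q 2 intervalMeasure) {n : ℤ}
    (hn : 0 < n) {ε R : ℝ}
    (hset : ReducedSetup (hillMatrix c Q) (hillWeight n) (-n) n ε R) {z : ℂ} (hz : ‖z‖ < n / 4)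
    (hdet : (z - reducedEntry (hillMatrix c Q) (hillDiag n z) (-n) (-n)) *
      (z - reducedEntry (hillMatrix c Q) (hillDiag n z) n n) =
    reducedEntry (hillMatrix c Q) (hillDiag n z) (-n) n *
      reducedEntry (hillMatrix c Q) (hillDiag n z) n (-n)) :
    IsHillEigenvalue c Q ((-1 : ℂ) ^ n) ((n : ℂ) ^ 2 + z) := by
  have hd := fun j => norm_hillDiag_le hn hz j
  obtain ⟨Y, G, hne, hGw, hoff, hsum, hza, hzb⟩ := hset.hs.exists_solution_of_det_eq_zero hd hset.ne
    hset.weight_left hset.weight_right (hset.row _ (.inl rfl)).1 (hset.row _ (.inr rfl)).1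
    (hset.col _ (.inl rfl)).1 (hset.col _ (.inr rfl)).1 hdet
  have hYsq : ∀ j, j ≠ -n → j ≠ n →
      ‖Y j‖ ^ 2 ≤ hillWeight n j * (hillWeight n j * ‖G j‖ ^ 2) := by
    intro j h1 h2
    rw [hoff j h1 h2, norm_mul, mul_pow]
    have := hd j
    calc _ ≤ hillWeight n j ^ 2 * ‖G j‖ ^ 2 := by gcongr
      _ = _ := by ring
  have hG0 : ∀ j, 0 ≤ hillWeight n j * ‖G j‖ ^ 2 := fun j =>
    mul_nonneg (hillWeight_nonneg _ _) (sq_nonneg _)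
  have hYoff : ∀ j, ¬Even (j - n) → Y j = 0 := by
    intro j hj
    have h1 : j ≠ -n := fun h => hj (hill_even_of_good (.inr (.inl h)))
    have h2 : j ≠ n := fun h => hj (hill_even_of_good (.inr (.inr h)))
    rw [hoff j h1 h2, hillDiag, if_neg (fun h => hj h.1), zero_mul]
  have s0 : Summable fun j => ‖Y j‖ ^ 2 :=
    summable_of_le_off_pair (fun _ => sq_nonneg _) (fun j => mul_nonneg two_pos.le (hG0 j))
      (hGw.mul_left 2) (-n) n fun j h1 h2 => (hYsq j h1 h2).trans
        (mul_le_mul_of_nonneg_right (hillWeight_le_two n j) (hG0 j))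
  have s1 : Summable fun j : ℤ => ‖Complex.I * j * Y j‖ ^ 2 := by
    refine summable_of_le_off_pair (fun _ => sq_nonneg _)
      (fun j => mul_nonneg (by positivity : (0 : ℝ) ≤ 2 + 2 * (n : ℝ) ^ 2) (hG0 j))
      (hGw.mul_left _) (-n) n fun j h1 h2 => ?_
    have e0 : ‖(j : ℂ)‖ = |(j : ℝ)| := by
      rw [← Real.norm_eq_abs, ← Complex.norm_real]; simp
    rw [norm_mul, norm_mul, Complex.norm_I, one_mul, e0, mul_pow, sq_abs]
    calc _ ≤ (j : ℝ) ^ 2 * (hillWeight n j * (hillWeight n j * ‖G j‖ ^ 2)) := by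
          gcongr; exact hYsq j h1 h2
      _ = (j : ℝ) ^ 2 * hillWeight n j * (hillWeight n j * ‖G j‖ ^ 2) := by ring
      _ ≤ _ := mul_le_mul_of_nonneg_right (sq_mul_hillWeight_le n j) (hG0 j)
  have hinj : Function.Injective fun k : ℤ => n + 2 * k := fun a b h => by simpa using h
  obtain ⟨y₀, hy₀, hy₀c⟩ := exists_memLp_fourierCoeffPi (s0.comp_injective hinj) n
  obtain ⟨y', hy', hy'c⟩ := exists_memLp_fourierCoeffPi (s1.comp_injective hinj) n
  have hy'i := hy'.integrable (by norm_num)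
  have hcY₀ : ∀ j, Even (j - n) → fourierCoeffPi y₀ j = Y j := fun j hj => by
    obtain ⟨k, rfl⟩ := exists_class hj
    exact hy₀c k
  have hcY' : ∀ j, Even (j - n) → fourierCoeffPi y' j = Complex.I * j * Y j := fun j hj => by
    obtain ⟨k, rfl⟩ := exists_class hj
    exact hy'c k
  obtain ⟨y, hyD, hyy₀, hbc⟩ := exists_hasL1Deriv hy₀ hy'i (n := n) fun j hj => by
    rw [hcY' j hj, hcY₀ j hj]
  have hyc := hyD.continuousOn
  have hy := memLp_of_continuousOn hyc
  have hyi := hy.integrable (by norm_num)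
  have hcY : ∀ j, Even (j - n) → fourierCoeffPi y j = Y j := fun j hj => by
    rw [fourierCoeffPi_congr hyy₀, hcY₀ j hj]
  have hQyL := memLp_mul_of_continuousOn hyc hQ
  have hQy := hQyL.integrable (by norm_num)
  have hQy' := integrable_mul hQ hy'
  have hGY : ∀ j, Even (j - n) → G j = ((n : ℂ) ^ 2 + z - (j : ℂ) ^ 2) * Y j := by
    intro j hj
    by_cases h1 : j = -n
    · rw [h1, hza]; push_cast; ring
    by_cases h2 : j = n
    · rw [h2, hzb]; ring
    have hden := hillDenominator_ne_zero hn h2 h1 hz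
    rw [hoff j h1 h2, hillDiag, if_pos ⟨hj, h2, h1⟩]
    field_simp
    ring
  have hGc : ∀ j, Even (j - n) → G j = Complex.I * j * fourierCoeffPi (fun x => Q x * y x) j -
      fourierCoeffPi (fun x => Q x * y' x) j + c * Y j := by
    intro j hj
    have hgood : hillWeight n j ≠ 0 ∨ j = -n ∨ j = n := by
      by_cases h1 : j = -n
      · exact .inr (.inl h1)
      by_cases h2 : j = n
      · exact .inr (.inr h2)
      exact .inl (hillWeight_ne_zero hj h2 h1)
    have h1 := hill_hasSum (c := c) hQ hy hy' (n := n)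
      (fun i hi => by rw [hcY' i hi, hcY i hi]) hj
    rw [hcY j hj] at h1
    refine (hsum j hgood).unique (h1.congr_fun fun i => ?_)
    by_cases hi : Even (i - n)
    · rw [if_pos hi, hcY i hi]
    · rw [if_neg hi, hYoff i hi]
  set lam : ℂ := (n : ℂ) ^ 2 + z with hlam
  -- The eigenvalue equation solved for `u'`. Comparing the two expressions for `G` shows that its
  -- coefficients are `i j` times those of `y' - Q y`.
  set u' : ℝ → ℂ := fun x => (c - lam) * y x - Q x * y' x with hu'
  obtain ⟨u, huD, hu, hubc⟩ := exists_hasL1Deriv (f := fun x => y' x - Q x * y x) (h := u')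
    (hy'.sub hQyL) ((hyi.const_mul _).sub hQy') (n := n) fun j hj => by
      rw [hu', fourierCoeffPi_sub (hyi.const_mul _) hQy', fourierCoeffPi_const_mul,
        fourierCoeffPi_sub hy'i hQy, hcY j hj, hcY' j hj]
      linear_combination hGY j hj - hGc j hj - (j : ℂ) ^ 2 * Y j * Complex.I_sq
  refine ⟨y, ?_, y', u, u', hyD, hy', hu, huD, ae_of_all _ fun x => ?_, hy.const_mul _, hbc, hubc⟩
  · rcases hne with h0 | h0
    · exact exists_ne_zero_of_fourierCoeffPi (j := -n)
        (by rwa [hcY _ (hill_even_of_good (.inr (.inl rfl)))])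
    · exact exists_ne_zero_of_fourierCoeffPi (j := n)
        (by rwa [hcY _ (hill_even_of_good (.inr (.inr rfl)))])
  · simp only [hu']; ring

/-! ### The eigenvalue equation of the Dirac operator -/

/-- The coefficients of `(y₁, y₂)` in the basis `(e^{-ikx}, 0)`, `(0, e^{ikx})`, `k ∈ n + 2ℤ`. -/
noncomputable def diracVector (n : ℤ) (y₁ y₂ : ℝ → ℂ) : Bool × ℤ → ℂ
  | (false, k) => if Even (k - n) then fourierCoeffPi y₁ (-k) else 0
  | (true, k) => if Even (k - n) then fourierCoeffPi y₂ k else 0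

theorem dirac_hasSum_first {P Q y₁ y₂ : ℝ → ℂ} (hP : MemLp P 2 intervalMeasure)
    (hy₂ : MemLp y₂ 2 intervalMeasure) (n k : ℤ) :
    HasSum (fun i => diracMatrix P Q (false, k) i * diracVector n y₁ y₂ i)
      (fourierCoeffPi (fun x => P x * y₂ x) (-k)) := by
  have hinj : Function.Injective fun j : ℤ => (true, j) := fun a b h => by simpa using h
  refine (hinj.hasSum_iff ?_).1 (hasSum_of_class (n := n) ?_ ?_)
  · rintro ⟨_ | _, j⟩ hj
    · simp [diracMatrix]
    · exact (hj ⟨j, rfl⟩).elim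
  · refine (hasSum_mul_fourierCoeffPi hP hy₂ n (-k)).congr_fun fun l => ?_
    simp [diracMatrix, diracVector]
  · intro i hi
    simp [diracVector, hi]

theorem dirac_hasSum_second {P Q y₁ y₂ : ℝ → ℂ} (hQ : MemLp Q 2 intervalMeasure)
    (hy₁ : MemLp y₁ 2 intervalMeasure) (n k : ℤ) :
    HasSum (fun i => diracMatrix P Q (true, k) i * diracVector n y₁ y₂ i)
      (fourierCoeffPi (fun x => Q x * y₁ x) k) := by
  have hinj : Function.Injective fun j : ℤ => (false, j) := fun a b h => by simpa using h
  refine (hinj.hasSum_iff ?_).1 (hasSum_of_class (n := n) ?_ ?_)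
  · rintro ⟨_ | _, j⟩ hj
    · exact (hj ⟨j, rfl⟩).elim
    · simp [diracMatrix]
  -- The first component is expanded in `e^{-ikx}`, so its frequencies are `-k` and the summation
  -- index is reversed.
  · have := (Equiv.neg ℤ).hasSum_iff.2 (hasSum_mul_fourierCoeffPi hQ hy₁ (-n) k)
    refine this.congr_fun fun l => ?_
    simp only [Function.comp, diracMatrix, diracVector, Equiv.neg_apply]
    rw [if_pos (by simp)]
    congr 2 <;> ring
  · intro i hi
    simp [diracVector, hi]

theorem even_neg_sub {k n : ℤ} : Even (-k - n) ↔ Even (k - n) := by simp [Int.even_sub]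

theorem diracWeight_le_two (n : ℤ) (a : Bool × ℤ) : diracWeight n a ≤ 2 := by
  unfold diracWeight
  split_ifs
  · linarith [invAbs_le_one (n - a.2)]
  · norm_num

theorem dirac_even_of_good {n : ℤ} {a : Bool × ℤ}
    (h : diracWeight n a ≠ 0 ∨ a = (false, n) ∨ a = (true, n)) : Even (a.2 - n) := by
  rcases h with h | rfl | rfl
  · by_contra hcon
    exact h (by rw [diracWeight, if_neg hcon])
  · simp
  · simp

theorem diracWeight_ne_zero {n : ℤ} {a : Bool × ℤ} (h : Even (a.2 - n)) (h1 : a.2 ≠ n) :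
    diracWeight n a ≠ 0 := by
  rw [diracWeight, if_pos h, invAbs]
  have e1 : ((n - a.2 : ℤ) : ℝ) ≠ 0 := by exact_mod_cast sub_ne_zero.2 h1.symm
  positivity

theorem snd_ne_of_ne {n : ℤ} {a : Bool × ℤ} (h1 : a ≠ (false, n)) (h2 : a ≠ (true, n)) :
    a.2 ≠ n := by
  rintro h
  obtain ⟨_ | _, k⟩ := a
  · exact h1 (by simpa using h)
  · exact h2 (by simpa using h)

/-- Here `V Y` consists of the coefficients of `P y₂` and `Q y₁`, which are in `L²` because
eigenfunctions are continuous; finite energy then only uses that the weight is bounded. -/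
theorem dirac_det_of_eigenvalue {P Q : ℝ → ℂ} (hP : MemLp P 2 intervalMeasure)
    (hQ : MemLp Q 2 intervalMeasure) {n : ℤ} {ε R : ℝ}
    (hset : ReducedSetup (diracMatrix P Q) (diracWeight n) (false, n) (true, n) ε R) {z : ℂ}
    (hz : ‖z‖ < 1 / 2) (h : IsDiracEigenvalue P Q ((-1 : ℂ) ^ n) (n + z)) :
    (z - reducedEntry (diracMatrix P Q) (diracDiag n z) (false, n) (false, n)) *
      (z - reducedEntry (diracMatrix P Q) (diracDiag n z) (true, n) (true, n)) =
    reducedEntry (diracMatrix P Q) (diracDiag n z) (false, n) (true, n) *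
      reducedEntry (diracMatrix P Q) (diracDiag n z) (true, n) (false, n) := by
  obtain ⟨y₁, y₂, ⟨x₀, hx₀, hne⟩, g₁, g₂, hD₁, hD₂, he₁, he₂, -, -, hb₁, hb₂⟩ := h
  have hc₁ := hD₁.continuousOn
  have hc₂ := hD₂.continuousOn
  have hy₁ := memLp_of_continuousOn hc₁
  have hy₂ := memLp_of_continuousOn hc₂
  have hPy := memLp_mul_of_continuousOn hc₂ hP
  have hQy := memLp_mul_of_continuousOn hc₁ hQ
  have hg₁ := intervalIntegrable_iff_integrable.1 hD₁.1
  have hg₂ := intervalIntegrable_iff_integrable.1 hD₂.1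
  have hm₁ : ∀ k, Even (k - n) → (n + z - k) * fourierCoeffPi y₁ (-k) =
      fourierCoeffPi (fun x => P x * y₂ x) (-k) := by
    intro k hk
    have e := fourierCoeffPi_congr he₁ (-k)
    rw [fourierCoeffPi_add (hg₁.const_mul _) (hPy.integrable (by norm_num)),
      fourierCoeffPi_const_mul, fourierCoeffPi_const_mul,
      fourierCoeffPi_deriv hD₁ (even_neg_sub.2 hk) hb₁] at e
    push_cast at e
    linear_combination e - k * fourierCoeffPi y₁ (-k) * Complex.I_sq
  have hm₂ : ∀ k, Even (k - n) → (n + z - k) * fourierCoeffPi y₂ k =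
      fourierCoeffPi (fun x => Q x * y₁ x) k := by
    intro k hk
    have e := fourierCoeffPi_congr he₂ k
    rw [fourierCoeffPi_add (hg₂.const_mul _) (hQy.integrable (by norm_num)),
      fourierCoeffPi_const_mul, fourierCoeffPi_const_mul, fourierCoeffPi_deriv hD₂ hk hb₂] at e
    linear_combination e - k * fourierCoeffPi y₂ k * Complex.I_sq
  set Y := diracVector n y₁ y₂ with hY
  set G : Bool × ℤ → ℂ := fun a => (n + z - a.2) * Y a with hG
  have hG₁ : ∀ k, Even (k - n) → G (false, k) = fourierCoeffPi (fun x => P x * y₂ x) (-k) :=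
    fun k hk => by rw [← hm₁ k hk]; simp [hG, hY, diracVector, hk]
  have hG₂ : ∀ k, Even (k - n) → G (true, k) = fourierCoeffPi (fun x => Q x * y₁ x) k :=
    fun k hk => by rw [← hm₂ k hk]; simp [hG, hY, diracVector, hk]
  refine hset.hs.det_eq_zero_of_solution (fun j => norm_diracDiag_le n hz j) hset.ne
    hset.weight_left hset.weight_right (hset.row _ (.inl rfl)).1 (hset.row _ (.inr rfl)).1
    (hset.col _ (.inl rfl)).1 (hset.col _ (.inr rfl)).1 (Y := Y) (G := G) ?_ ?_ ?_ ?_ ?_ ?_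
  · rcases hne with h0 | h0
    · obtain ⟨j, hj, hj0⟩ := exists_fourierCoeffPi_ne_zero hc₁ ⟨x₀, hx₀, h0⟩ n
      exact ⟨(false, -j), by simpa [hY, diracVector, even_neg_sub.2 hj] using hj0⟩
    · obtain ⟨j, hj, hj0⟩ := exists_fourierCoeffPi_ne_zero hc₂ ⟨x₀, hx₀, h0⟩ n
      exact ⟨(true, j), by simpa [hY, diracVector, hj] using hj0⟩
  · refine summable_bool_prod (fun a => mul_nonneg (diracWeight_nonneg _ _) (sq_nonneg _)) ?_
    rintro (_ | _)
    · have s1 := ((Equiv.neg ℤ).summable_iff.2 (summable_ite_class hPy n)).mul_left 2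
      refine Summable.of_nonneg_of_le
        (fun a => mul_nonneg (diracWeight_nonneg _ _) (sq_nonneg _)) (fun k => ?_) s1
      simp only [Function.comp, Equiv.neg_apply, even_neg_sub]
      by_cases hk : Even (k - n)
      · rw [hG₁ k hk, if_pos hk]
        exact mul_le_mul_of_nonneg_right (diracWeight_le_two _ _) (sq_nonneg _)
      · simp [hG, hY, diracVector, hk]
    · refine Summable.of_nonneg_of_le
        (fun a => mul_nonneg (diracWeight_nonneg _ _) (sq_nonneg _)) (fun k => ?_)
        ((summable_ite_class hQy n).mul_left 2)
      by_cases hk : Even (k - n)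
      · rw [hG₂ k hk, if_pos hk]
        exact mul_le_mul_of_nonneg_right (diracWeight_le_two _ _) (sq_nonneg _)
      · simp [hG, hY, diracVector, hk]
  · intro a h1 h2
    have ha := snd_ne_of_ne h1 h2
    by_cases hk : Even (a.2 - n)
    · have hden := diracDenominator_ne_zero ha hz
      simp only [hG, diracDiag]
      rw [if_pos ⟨hk, ha⟩, show (n : ℂ) + z - a.2 = n - a.2 + z by ring,
        inv_mul_cancel_left₀ hden]
    · have hY0 : Y a = 0 := by
        obtain ⟨_ | _, k⟩ := a
        · exact if_neg hk
        · exact if_neg hk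
      rw [hY0, diracDiag, if_neg (fun h => hk h.1), zero_mul]
  · rintro ⟨_ | _, k⟩ hk
    · rw [hG₁ k (dirac_even_of_good hk)]
      exact dirac_hasSum_first hP hy₂ n k
    · rw [hG₂ k (dirac_even_of_good hk)]
      exact dirac_hasSum_second hQ hy₁ n k
  · simp [hG]
  · simp [hG]

theorem dirac_eigenvalue_of_det {P Q : ℝ → ℂ} (hP : MemLp P 2 intervalMeasure)
    (hQ : MemLp Q 2 intervalMeasure) {n : ℤ} {ε R : ℝ}
    (hset : ReducedSetup (diracMatrix P Q) (diracWeight n) (false, n) (true, n) ε R) {z : ℂ}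
    (hz : ‖z‖ < 1 / 2)
    (hdet : (z - reducedEntry (diracMatrix P Q) (diracDiag n z) (false, n) (false, n)) *
      (z - reducedEntry (diracMatrix P Q) (diracDiag n z) (true, n) (true, n)) =
    reducedEntry (diracMatrix P Q) (diracDiag n z) (false, n) (true, n) *
      reducedEntry (diracMatrix P Q) (diracDiag n z) (true, n) (false, n)) :
    IsDiracEigenvalue P Q ((-1 : ℂ) ^ n) (n + z) := by
  have hd := fun j => norm_diracDiag_le n hz j
  obtain ⟨Y, G, hne, hGw, hoff, hsum, hza, hzb⟩ := hset.hs.exists_solution_of_det_eq_zero hd hset.ne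
    hset.weight_left hset.weight_right (hset.row _ (.inl rfl)).1 (hset.row _ (.inr rfl)).1
    (hset.col _ (.inl rfl)).1 (hset.col _ (.inr rfl)).1 hdet
  have hG0 : ∀ j, 0 ≤ diracWeight n j * ‖G j‖ ^ 2 := fun j =>
    mul_nonneg (diracWeight_nonneg _ _) (sq_nonneg _)
  have s0 : Summable fun j => ‖Y j‖ ^ 2 := by
    refine summable_of_le_off_pair (fun _ => sq_nonneg _) (fun j => mul_nonneg two_pos.le (hG0 j))
      (hGw.mul_left 2) (false, n) (true, n) fun j h1 h2 => ?_
    rw [hoff j h1 h2, norm_mul, mul_pow]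
    have := hd j
    have := diracWeight_nonneg n j
    have h2 := diracWeight_le_two n j
    calc _ ≤ diracWeight n j ^ 2 * ‖G j‖ ^ 2 := by gcongr
      _ = diracWeight n j * (diracWeight n j * ‖G j‖ ^ 2) := by ring
      _ ≤ _ := mul_le_mul_of_nonneg_right h2 (hG0 j)
  have hYoff : ∀ a : Bool × ℤ, ¬Even (a.2 - n) → Y a = 0 := by
    intro a ha
    have h1 : a ≠ (false, n) := fun h => ha (dirac_even_of_good (.inr (.inl h)))
    have h2 : a ≠ (true, n) := fun h => ha (dirac_even_of_good (.inr (.inr h)))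
    rw [hoff a h1 h2, diracDiag, if_neg (fun h => ha h.1), zero_mul]
  have hinj₁ : Function.Injective fun k : ℤ => (false, -(n + 2 * k)) := fun a b h => by
    simpa using h
  have hinj₂ : Function.Injective fun k : ℤ => (true, n + 2 * k) := fun a b h => by
    simpa using h
  obtain ⟨w₁, hw₁, hw₁c⟩ := exists_memLp_fourierCoeffPi (s0.comp_injective hinj₁) n
  obtain ⟨w₂, hw₂, hw₂c⟩ := exists_memLp_fourierCoeffPi (s0.comp_injective hinj₂) n
  have hY₁ : ∀ k, Even (k - n) → fourierCoeffPi w₁ k = Y (false, -k) := fun k hk => by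
    obtain ⟨l, rfl⟩ := exists_class hk
    exact hw₁c l
  have hY₂ : ∀ k, Even (k - n) → fourierCoeffPi w₂ k = Y (true, k) := fun k hk => by
    obtain ⟨l, rfl⟩ := exists_class hk
    exact hw₂c l
  have hvec : Y = diracVector n w₁ w₂ := by
    ext ⟨_ | _, k⟩
    · by_cases hk : Even (k - n)
      · simp only [diracVector, if_pos hk]
        rw [hY₁ _ (even_neg_sub.2 hk), neg_neg]
      · simp only [diracVector, if_neg hk]
        exact hYoff _ hk
    · by_cases hk : Even (k - n)
      · simp only [diracVector, if_pos hk]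
        rw [hY₂ _ hk]
      · simp only [diracVector, if_neg hk]
        exact hYoff _ hk
  have hGY : ∀ a : Bool × ℤ, Even (a.2 - n) → G a = (n + z - a.2) * Y a := by
    intro a ha
    by_cases h1 : a = (false, n)
    · rw [h1, hza]; ring
    by_cases h2 : a = (true, n)
    · rw [h2, hzb]; ring
    have h3 := snd_ne_of_ne h1 h2
    rw [hoff a h1 h2, diracDiag, if_pos ⟨ha, h3⟩, show (n : ℂ) + z - a.2 = n - a.2 + z by ring,
      mul_inv_cancel_left₀ (diracDenominator_ne_zero h3 hz)]
  have hgood : ∀ a : Bool × ℤ, Even (a.2 - n) →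
      diracWeight n a ≠ 0 ∨ a = (false, n) ∨ a = (true, n) := by
    intro a ha
    by_cases h1 : a = (false, n)
    · exact .inr (.inl h1)
    by_cases h2 : a = (true, n)
    · exact .inr (.inr h2)
    exact .inl (diracWeight_ne_zero ha (snd_ne_of_ne h1 h2))
  have hG₁ : ∀ k, Even (k - n) → G (false, k) = fourierCoeffPi (fun x => P x * w₂ x) (-k) := by
    intro k hk
    have h1 := hsum (false, k) (hgood _ hk)
    rw [hvec] at h1
    exact h1.unique (dirac_hasSum_first hP hw₂ n k)
  have hG₂ : ∀ k, Even (k - n) → G (true, k) = fourierCoeffPi (fun x => Q x * w₁ x) k := by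
    intro k hk
    have h1 := hsum (true, k) (hgood _ hk)
    rw [hvec] at h1
    exact h1.unique (dirac_hasSum_second hQ hw₁ n k)
  have hw₁i := hw₁.integrable (by norm_num : (1 : ENNReal) ≤ 2)
  have hw₂i := hw₂.integrable (by norm_num : (1 : ENNReal) ≤ 2)
  have hPw := integrable_mul hP hw₂
  have hQw := integrable_mul hQ hw₁
  set lam : ℂ := n + z with hlam
  -- The prescribed derivative is the equation `i y₁' + P y₂ = λ y₁` solved for `y₁'`, with the `L²`
  -- functions `w₁, w₂` in place of their absolutely continuous representatives.
  obtain ⟨y₁, hD₁, hyw₁, hb₁⟩ := exists_hasL1Deriv hw₁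
    (h := fun x => -Complex.I * (lam * w₁ x - P x * w₂ x))
    (((hw₁i.const_mul _).sub hPw).const_mul _) (n := n) fun k hk => by
      have hk' := even_neg_sub.2 hk
      have e1 := hG₁ _ hk'
      rw [hGY _ hk', neg_neg] at e1
      rw [fourierCoeffPi_const_mul, fourierCoeffPi_sub (hw₁i.const_mul _) hPw,
        fourierCoeffPi_const_mul, hY₁ k hk, ← e1]
      push_cast
      ring
  obtain ⟨y₂, hD₂, hyw₂, hb₂⟩ := exists_hasL1Deriv hw₂
    (h := fun x => Complex.I * (lam * w₂ x - Q x * w₁ x))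
    (((hw₂i.const_mul _).sub hQw).const_mul _) (n := n) fun k hk => by
      have e1 := hG₂ _ hk
      rw [hGY _ hk] at e1
      rw [fourierCoeffPi_const_mul, fourierCoeffPi_sub (hw₂i.const_mul _) hQw,
        fourierCoeffPi_const_mul, hY₂ k hk, ← e1]
      ring
  refine ⟨y₁, y₂, ?_, _, _, hD₁, hD₂, ?_, ?_,
    (memLp_of_continuousOn hD₁.continuousOn).const_mul _,
    (memLp_of_continuousOn hD₂.continuousOn).const_mul _, hb₁, hb₂⟩
  · rcases hne with h0 | h0
    · have h1 : fourierCoeffPi y₁ (-n) ≠ 0 := by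
        rw [fourierCoeffPi_congr hyw₁, hY₁ _ (even_neg_sub.2 (by simp)), neg_neg]
        exact h0
      obtain ⟨x, hx, hx0⟩ := exists_ne_zero_of_fourierCoeffPi h1
      exact ⟨x, hx, .inl hx0⟩
    · have h1 : fourierCoeffPi y₂ n ≠ 0 := by
        rw [fourierCoeffPi_congr hyw₂, hY₂ _ (by simp)]
        exact h0
      obtain ⟨x, hx, hx0⟩ := exists_ne_zero_of_fourierCoeffPi h1
      exact ⟨x, hx, .inr hx0⟩
  · filter_upwards [hyw₁, hyw₂] with x h1 h2
    rw [h1, h2]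
    linear_combination (lam * w₁ x - P x * w₂ x) * Complex.I_sq
  · filter_upwards [hyw₁, hyw₂] with x h1 h2
    rw [h1, h2]
    linear_combination (lam * w₂ x - Q x * w₁ x) * Complex.I_sq

/-! ### The two eigenvalues close to `λ_n^0` -/

theorem LexLE.antisymm {a b : ℂ} (h₁ : LexLE a b) (h₂ : LexLE b a) : a = b := by
  rcases h₁ with h₁ | ⟨h₁, h₁'⟩ <;> rcases h₂ with h₂ | ⟨h₂, h₂'⟩
  · exact absurd h₁ h₂.not_gt
  · exact absurd h₁ h₂.not_gt
  · exact absurd h₂ h₁.not_gt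
  · exact Complex.ext h₁ (le_antisymm h₁' h₂')

theorem LexLE.refl (a : ℂ) : LexLE a a := Or.inr ⟨rfl, le_rfl⟩

theorem LexLE.total (a b : ℂ) : LexLE a b ∨ LexLE b a := by
  rcases lt_trichotomy a.re b.re with h | h | h
  · exact Or.inl (Or.inl h)
  · rcases le_total a.im b.im with h' | h'
    · exact Or.inl (Or.inr ⟨h, h'⟩)
    · exact Or.inr (Or.inr ⟨h.symm, h'⟩)
  · exact Or.inr (Or.inl h)

theorem lexMax_eq {S : Set ℂ} {a : ℂ} (ha : a ∈ S) (h : ∀ b ∈ S, LexLE b a) : lexMax S = a := by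
  have hex : ∃ a ∈ S, ∀ b ∈ S, LexLE b a := ⟨a, ha, h⟩
  rw [lexMax, dif_pos hex]
  exact (h _ hex.choose_spec.1).antisymm (hex.choose_spec.2 a ha)

theorem lexMin_eq {S : Set ℂ} {a : ℂ} (ha : a ∈ S) (h : ∀ b ∈ S, LexLE a b) : lexMin S = a := by
  have hex : ∃ a ∈ S, ∀ b ∈ S, LexLE a b := ⟨a, ha, h⟩
  rw [lexMin, dif_pos hex]
  exact (hex.choose_spec.2 a ha).antisymm (h _ hex.choose_spec.1)

theorem pair_eq_lexMin_lexMax (a b : ℂ) : ({a, b} : Set ℂ) = {lexMin {a, b}, lexMax {a, b}} := by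
  wlog hab : LexLE a b generalizing a b
  · rw [Set.pair_comm a b]
    exact this b a ((LexLE.total a b).resolve_left hab)
  have hmin : lexMin {a, b} = a := lexMin_eq (by simp) (by simp [hab, LexLE.refl])
  have hmax : lexMax {a, b} = b := lexMax_eq (by simp) (by simp [hab, LexLE.refl])
  rw [hmin, hmax]

/-- A nonempty set of at most two complex numbers consists of its smallest and its largest
element. -/
theorem eq_lexMin_lexMax {S : Set ℂ} (hne : S.Nonempty)
    (h : ∀ a ∈ S, ∀ b ∈ S, ∀ c ∈ S, b ≠ a → c ≠ a → b = c) : S = {lexMin S, lexMax S} := by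
  obtain ⟨a, ha⟩ := hne
  obtain ⟨b, rfl⟩ : ∃ b, S = {a, b} := by
    by_cases hb : ∃ b ∈ S, b ≠ a
    · obtain ⟨b, hb, hba⟩ := hb
      refine ⟨b, Set.Subset.antisymm (fun c hc => ?_) (by simp [Set.insert_subset_iff, ha, hb])⟩
      by_cases hca : c = a
      · exact Or.inl hca
      · exact Or.inr (h a ha c hc b hb hca hba)
    · push Not at hb
      exact ⟨a, Set.Subset.antisymm (fun c hc => Or.inl (hb c hc)) (by simp [ha])⟩
  exact pair_eq_lexMin_lexMax a b

namespace Potential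

/-- For large `|n|` the entries of the reduced matrix are small, and its determinant equation
describes the eigenvalues close to `λ_n^0`. -/
theorem eventually_smallTriple (v : Potential) (hv : v.Admissible) {ε : ℝ} (hε : 0 < ε) :
    ∀ᶠ n in cofinite, n ∈ v.indices →
      SmallTriple (v.radius n) ε (v.alpha n) (v.betaMinus n) (v.betaPlus n) ∧
      ∀ z ∈ Metric.ball (0 : ℂ) (v.radius n), v.IsEigenvalue ((-1 : ℂ) ^ n) (v.lam0 n + z) ↔
        (z - v.alpha n z) ^ 2 = v.betaMinus n z * v.betaPlus n z := by
  cases v with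
  | hill c Q =>
    -- The entries are at most `3 (ε/12) n = ε · n/4`, that is, `ε` times the radius. In the Dirac
    -- case `3 (ε/6) = ε · 1/2`.
    filter_upwards [hill_setup c hv (show 0 < ε / 12 by positivity)] with n hset hn
    replace hset := hset hn
    have hn0 : (0 : ℝ) < n := Int.cast_pos.2 hn
    refine ⟨hset.smallTriple (d := hillDiag n) (show (0 : ℝ) < n / 4 by positivity)
      (by linarith) (fun z hz => norm_hillDiag_le hn (by simpa using hz))
      (differentiableOn_hillDiag hn), fun z hz => ?_⟩
    replace hz : ‖z‖ < n / 4 := by simpa [radius] using hz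
    -- The reflection `j ↦ -j` transposes the Toeplitz matrix `V(k - j)`, preserves `n² - j² + z`
    -- and interchanges `±n`. For Dirac the same role is played by exchanging the two components.
    have hsymm := hset.reducedEntry_diag_eq (norm_hillDiag_le hn hz) (Equiv.neg ℤ)
      (fun i j => by simp only [hillMatrix, Equiv.neg_apply]; congr 1; ring)
      (hillWeight_neg n)
      (fun j => by
        have h1 : Even (-j - n) ↔ Even (j - n) := by simp [Int.even_sub]
        have h2 : -j ≠ n ∧ -j ≠ -n ↔ j ≠ n ∧ j ≠ -n := by omega
        simp only [hillDiag, Equiv.neg_apply, h1, h2, Int.cast_neg, neg_sq])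
      (neg_neg n)
    constructor
    · intro h
      have := hill_det_of_eigenvalue hv hn hset hz h
      rw [hsymm, ← sq] at this
      exact this
    · intro h
      refine hill_eigenvalue_of_det hv hn hset hz ?_
      rw [hsymm, ← sq]
      exact h
  | dirac P Q =>
    filter_upwards [dirac_setup hv.1 hv.2 (show 0 < ε / 6 by positivity)] with n hset _
    refine ⟨hset.smallTriple (d := diracDiag n) (show (0 : ℝ) < 1 / 2 by norm_num)
      (by linarith) (fun z hz => norm_diracDiag_le n (by simpa using hz))
      (differentiableOn_diracDiag n), fun z hz => ?_⟩
    replace hz : ‖z‖ < 1 / 2 := by simpa [radius] using hz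
    have hsymm := hset.reducedEntry_diag_eq (norm_diracDiag_le n hz)
      (Equiv.boolNot.prodCongr (Equiv.refl ℤ))
      (fun i j => by
        obtain ⟨_ | _, k⟩ := i <;> obtain ⟨_ | _, l⟩ := j <;>
          simp [diracMatrix, add_comm, sub_eq_add_neg])
      (fun _ => rfl) (fun _ => rfl) rfl
    constructor
    · intro h
      have := dirac_det_of_eigenvalue hv.1 hv.2 hset hz h
      rw [hsymm, ← sq] at this
      exact this
    · intro h
      refine dirac_eigenvalue_of_det hv.1 hv.2 hset hz ?_
      rw [hsymm, ← sq]
      exact h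

/-- `λ_n^-` and `λ_n^+` are the only eigenvalues close to `λ_n^0`. -/
theorem eigenvaluesNear_eq {v : Potential} {n : ℤ} {ε : ℝ} (hε : ε ≤ 1 / 100)
    (h : SmallTriple (v.radius n) ε (v.alpha n) (v.betaMinus n) (v.betaPlus n))
    (heig : ∀ z ∈ Metric.ball (0 : ℂ) (v.radius n),
      v.IsEigenvalue ((-1 : ℂ) ^ n) (v.lam0 n + z) ↔
        (z - v.alpha n z) ^ 2 = v.betaMinus n z * v.betaPlus n z) :
    v.eigenvaluesNear n = {v.lamMinus n, v.lamPlus n} := by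
  refine eq_lexMin_lexMax ?_ fun a ha b hb c hc hba hca => ?_
  · obtain ⟨z, hz, hroot⟩ := h.exists_root hε
    exact ⟨v.lam0 n + z, (heig z hz).2 hroot, by simpa using hz⟩
  · have key : ∀ x ∈ v.eigenvaluesNear n, x - v.lam0 n ∈ Metric.ball (0 : ℂ) (v.radius n) ∧
        (x - v.lam0 n - v.alpha n (x - v.lam0 n)) ^ 2 =
          v.betaMinus n (x - v.lam0 n) * v.betaPlus n (x - v.lam0 n) := by
      rintro x ⟨hx, hxr⟩
      have hxb : x - v.lam0 n ∈ Metric.ball (0 : ℂ) (v.radius n) := mem_ball_zero_iff.2 hxr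
      exact ⟨hxb, (heig _ hxb).1 (by rwa [add_sub_cancel])⟩
    exact sub_left_inj.1 (h.root_eq_of_three hε (key a ha).1 (key b hb).1 (key c hc).1
      (key a ha).2 (key b hb).2 (key c hc).2 (fun e => hba (sub_left_inj.1 e))
      (fun e => hca (sub_left_inj.1 e)))

/-- If `β_n^±` are almost constant on `D_n`, then the roots `z_n^±` of the determinant equation
correspond to the two branches of its square root. -/
theorem exists_sqrt_betas {v : Potential} {n : ℤ} {ε κ : ℝ} (hε : ε ≤ 1 / 100)
    (hκ : κ ≤ 1 / 100)
    (h : SmallTriple (v.radius n) ε (v.alpha n) (v.betaMinus n) (v.betaPlus n))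
    (heig : ∀ z ∈ Metric.ball (0 : ℂ) (v.radius n),
      v.IsEigenvalue ((-1 : ℂ) ^ n) (v.lam0 n + z) ↔
        (z - v.alpha n z) ^ 2 = v.betaMinus n z * v.betaPlus n z)
    (hne : v.betaMinus n (v.zStar n) ≠ 0 ∧ v.betaPlus n (v.zStar n) ≠ 0)
    (hconst : ∀ z ∈ v.disc n,
      ‖v.betaMinus n z - v.betaMinus n (v.zStar n)‖ ≤ κ * ‖v.betaMinus n (v.zStar n)‖ ∧
      ‖v.betaPlus n z - v.betaPlus n (v.zStar n)‖ ≤ κ * ‖v.betaPlus n (v.zStar n)‖) :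
    ∃ sM sP : ℂ → ℂ,
      (∃ U : Set ℂ, IsOpen U ∧ v.disc n ⊆ U ∧ AnalyticOnNhd ℂ sM U ∧ AnalyticOnNhd ℂ sP U ∧
        (∀ z ∈ U, sM z ^ 2 = v.betaMinus n z) ∧ (∀ z ∈ U, sP z ^ 2 = v.betaPlus n z)) ∧
      (∀ z, (z ∈ v.disc n ∧ z - v.alpha n z = sM z * sP z) ↔ z = v.zPlus n) ∧
      (∀ z, (z ∈ v.disc n ∧ z - v.alpha n z = -(sM z * sP z)) ↔ z = v.zMinus n) ∧
      ∀ δ, δ ≤ 1 / 100 →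
        SmallTriple (v.radius n) δ (v.alpha n) (v.betaMinus n) (v.betaPlus n) →
        ‖v.gap n / (2 * sM (v.zStar n) * sP (v.zStar n)) - 1‖ ≤ 3 * (δ + κ) := by
  have hpair := eigenvaluesNear_eq hε h heig
  have hroots : ∀ z ∈ Metric.ball (0 : ℂ) (v.radius n),
      (z - v.alpha n z) ^ 2 = v.betaMinus n z * v.betaPlus n z ↔
        z = v.zMinus n ∨ z = v.zPlus n := by
    intro z hz
    have hmem : v.lam0 n + z ∈ v.eigenvaluesNear n ↔
        v.IsEigenvalue ((-1 : ℂ) ^ n) (v.lam0 n + z) :=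
      ⟨fun hx => hx.1, fun hx => ⟨hx, by simpa using hz⟩⟩
    rw [← heig z hz, ← hmem, hpair, Set.mem_insert_iff, Set.mem_singleton_iff, zMinus, zPlus,
      eq_sub_iff_add_eq', eq_sub_iff_add_eq']
  have hm : v.lamMinus n ∈ v.eigenvaluesNear n := by rw [hpair]; exact Or.inl rfl
  have hp : v.lamPlus n ∈ v.eigenvaluesNear n := by rw [hpair]; exact Or.inr rfl
  obtain ⟨sM, sP, hU, hP, hM, hgap⟩ := h.exists_branches hε hκ (z₀ := v.zStar n) rfl
    (mem_ball_zero_iff.2 hp.2) (mem_ball_zero_iff.2 hm.2) hroots hne.1 hne.2 (D := v.disc n) rfl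
    (fun z hz => (hconst z hz).1) (fun z hz => (hconst z hz).2)
  refine ⟨sM, sP, hU, hP, hM, fun δ hδ hs => ?_⟩
  have := hgap δ hδ hs
  rwa [zPlus, zMinus, sub_sub_sub_cancel_right] at this

end Potential

/-! ### Passage to large indices -/

theorem exists_bound_of_eventually_cofinite {p : ℤ → Prop} (h : ∀ᶠ n in cofinite, p n) :
    ∃ N : ℤ, ∀ n, N ≤ |n| → p n := by
  obtain ⟨M, hM⟩ := (Set.Finite.image (fun n : ℤ => |n|) (eventually_cofinite.1 h)).bddAbove
  refine ⟨M + 1, fun n hn => by_contra fun hp => ?_⟩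
  have := hM (Set.mem_image_of_mem (fun n : ℤ => |n|) hp)
  omega

theorem eventually_cofinite_le_abs (N : ℤ) : ∀ᶠ n : ℤ in cofinite, N ≤ |n| := by
  refine eventually_cofinite.2 ((Set.finite_Icc (-N) N).subset fun n hn => ?_)
  simp only [Set.mem_ofPred_eq, not_le] at hn
  exact ⟨by have := neg_abs_le n; omega, by have := le_abs_self n; omega⟩

end SpectralGap

theorem theorem3 (v : SpectralGap.Potential) (hv : v.Admissible) (Δ : Set ℤ) (hΔ : Δ.Infinite)
    (hΔv : Δ ⊆ v.indices) (hpar : (∀ n ∈ Δ, Even n) ∨ (∀ n ∈ Δ, Odd n))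
    (η : ℤ → ℝ) (hη_pos : ∀ n ∈ Δ, 0 < η n)
    (hη : Filter.Tendsto η (Filter.cofinite ⊓ Filter.principal Δ) (nhds 0))
    (K : ℝ) (N₀ : ℤ)
    (hne : ∀ n ∈ Δ, N₀ ≤ |n| →
      v.betaMinus n (v.zStar n) ≠ 0 ∧ v.betaPlus n (v.zStar n) ≠ 0)
    (hconst : ∀ n ∈ Δ, N₀ ≤ |n| → ∀ z ∈ v.disc n,
      ‖v.betaMinus n z - v.betaMinus n (v.zStar n)‖ ≤ K * η n * ‖v.betaMinus n (v.zStar n)‖ ∧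
      ‖v.betaPlus n z - v.betaPlus n (v.zStar n)‖ ≤ K * η n * ‖v.betaPlus n (v.zStar n)‖) :
    ∃ (N : ℤ) (sM sP : ℤ → ℂ → ℂ),
      (∀ n ∈ Δ, N ≤ |n| →
        v.eigenvaluesNear n = {v.lamMinus n, v.lamPlus n} ∧
        (∃ U : Set ℂ, IsOpen U ∧ v.disc n ⊆ U ∧
          AnalyticOnNhd ℂ (sM n) U ∧ AnalyticOnNhd ℂ (sP n) U ∧
          (∀ z ∈ U, sM n z ^ 2 = v.betaMinus n z) ∧ (∀ z ∈ U, sP n z ^ 2 = v.betaPlus n z)) ∧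
        (∀ z : ℂ, (z ∈ v.disc n ∧ z - v.alpha n z = sM n z * sP n z) ↔ z = v.zPlus n) ∧
        (∀ z : ℂ, (z ∈ v.disc n ∧ z - v.alpha n z = -(sM n z * sP n z)) ↔ z = v.zMinus n)) ∧
      Filter.Tendsto (fun n => v.gap n / (2 * sM n (v.zStar n) * sP n (v.zStar n)))
        (Filter.cofinite ⊓ Filter.principal Δ) (nhds 1) := by
  open SpectralGap in
  have hκ : Tendsto (fun n => K * η n) (cofinite ⊓ 𝓟 Δ) (𝓝 0) := by simpa using hη.const_mul K
  have hsmall : ∀ ε : ℝ, 0 < ε → ∀ᶠ n in cofinite ⊓ 𝓟 Δ,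
      SmallTriple (v.radius n) ε (v.alpha n) (v.betaMinus n) (v.betaPlus n) ∧
      ∀ z ∈ Metric.ball (0 : ℂ) (v.radius n), v.IsEigenvalue ((-1 : ℂ) ^ n) (v.lam0 n + z) ↔
        (z - v.alpha n z) ^ 2 = v.betaMinus n z * v.betaPlus n z := by
    intro ε hε
    refine eventually_inf_principal.2 ?_
    filter_upwards [v.eventually_smallTriple hv hε] with n h hn
    exact h (hΔv hn)
  -- The branches are chosen once, with the smallness `1/100`; keeping `δ` free lets the same
  -- branches satisfy the asymptotic estimate with arbitrarily small error.
  have hex : ∀ᶠ n in cofinite ⊓ 𝓟 Δ, ∃ sM sP : ℂ → ℂ,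
      (v.eigenvaluesNear n = {v.lamMinus n, v.lamPlus n} ∧
        (∃ U : Set ℂ, IsOpen U ∧ v.disc n ⊆ U ∧ AnalyticOnNhd ℂ sM U ∧ AnalyticOnNhd ℂ sP U ∧
          (∀ z ∈ U, sM z ^ 2 = v.betaMinus n z) ∧ (∀ z ∈ U, sP z ^ 2 = v.betaPlus n z)) ∧
        (∀ z : ℂ, (z ∈ v.disc n ∧ z - v.alpha n z = sM z * sP z) ↔ z = v.zPlus n) ∧
        (∀ z : ℂ, (z ∈ v.disc n ∧ z - v.alpha n z = -(sM z * sP z)) ↔ z = v.zMinus n)) ∧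
      ∀ δ, δ ≤ 1 / 100 →
        SmallTriple (v.radius n) δ (v.alpha n) (v.betaMinus n) (v.betaPlus n) →
        ‖v.gap n / (2 * sM (v.zStar n) * sP (v.zStar n)) - 1‖ ≤ 3 * (δ + K * η n) := by
    filter_upwards [hsmall (1 / 100) (by norm_num), hκ.eventually_le_const
        (show (0 : ℝ) < 1 / 100 by norm_num), mem_inf_of_left (eventually_cofinite_le_abs N₀),
      mem_inf_of_right (mem_principal_self Δ)] with n hs hκn hN hn
    obtain ⟨sM, sP, hU, hP, hM, hgap⟩ := Potential.exists_sqrt_betas le_rfl hκn hs.1 hs.2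
      (hne n hn hN) (hconst n hn hN)
    exact ⟨sM, sP, ⟨Potential.eigenvaluesNear_eq le_rfl hs.1 hs.2, hU, hP, hM⟩, hgap⟩
  -- Because `Δ` is infinite the filter is proper, as required for choosing the branches
  -- simultaneously in `n`.
  have := hΔ.cofinite_inf_principal_neBot
  obtain ⟨sM, hex⟩ := hex.choice
  obtain ⟨sP, hex⟩ := hex.choice
  obtain ⟨N, hN⟩ := exists_bound_of_eventually_cofinite (eventually_inf_principal.1 hex)
  refine ⟨N, sM, sP, fun n hn hNn => (hN n hNn hn).1, ?_⟩
  refine Metric.tendsto_nhds.2 fun ε hε => ?_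
  -- With `δ` and `K η n` both at most `ε/12`, the error `3 (δ + K η n)` is at most `ε/2`.
  have hδ : 0 < min (1 / 100) (ε / 12) := by positivity
  filter_upwards [hex, hsmall _ hδ, hκ.eventually_lt_const (show 0 < ε / 12 by positivity)]
    with n h hs hκn
  rw [dist_eq_norm]
  refine (h.2 _ (min_le_left _ _) hs.1).trans_lt ?_
  linarith [min_le_right (1 / 100 : ℝ) (ε / 12)]
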